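/- **Conventions.** For a set $Q$ of qubits, $\mathcal P_Q$ is the Pauli group on $Q$ (for infinite $Q$: operators of finite support), and $\mathcal P_k$ is the $k$-qubit Pauli group, so $\mathcal P_0=\langle i\rangle$. A measurement schedule is a family $(\mathcal M_t)$ of Abelian subgroups of $\mathcal P_Q$. Its instantaneous stabilizer group $\mathcal S_t$ arises from the trivial group by measuring, at each timestep $0,1,\dots,t$ in turn, a list of Paulis generating $\mathcal M_0,\dots,\mathcal M_t$, according to the stabilizer formalism: if $\pm p\in\mathcal S$, measuring $p$ changes nothing; otherwise the elements of $\mathcal S$ that commute with $p$ are kept and $mp$ is adjoined, where $m=\pm1$ is the outcome. The logical Pauli group is $N(\mathcal S_t)/\mathcal S_t$. The code is *established from $T$ on with $k$ logical qubits* if, for all choices of generating lists and all outcomes, and for every $t\ge T$, $\mathcal S_t$ has rank $|Q|-k$ and $N(\mathcal S_t)/\mathcal S_t\cong\mathcal P_k$. A schedule has *period* $\ell$ if $\ell\geq 1$ is least with the property that it repeats after $\ell$ timesteps. *The 6.6.6 colour code* has a qubit at every vertex of the honeycomb lattice. It measures $Z_f=\prod_{v\in f}Z_v$ for all hexagons $f$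 at even timesteps and $X_f=\prod_{v\in f}X_v$ for all $f$ at odd timesteps. In its (phase-free, post-selected, bi-infinite) bulk ZX-diagram, every vertex $v$ and timestep $r$ has a spider, green if $r$ is even and red if $r$ is odd, joined to the spiders of $v$ at times $r\pm1$; every face $f$ and timestep $r$ has a spider of the opposite colour, joined to the spiders of the six vertices of $f$ at time $r$. *The Floquetified colour code* has a qubit at every point $(x,y)$ of the square lattice $\mathbb Z^2$. What $(x,y)$ undergoes at time $t$ depends on $\varphi=t+8x+2y \bmod 13$ and the parity of $x+y$. If $\varphi=0$ it is measured alone; for $\varphi=1,\dots,12$ it is measured jointly with its neighbour in direction $$R,\,L,\,U,\,R,\,D,\,L,\,R,\,U,\,L,\,D,\,R,\,L$$ respectively ($R,L,U,D$ are $(1,0),(-1,0),(0,1),(0,-1)$). For $x+y$ even the measurement is of $Z$- or $ZZ$-type if $\varphi\in\{1,3,6,7,10,12\}$ and of $X$- or $XX$-type otherwise; for $x+y$ odd, $X$ and $Z$ are exchanged. In its bulk ZX-diagram, a $ZZ$ (resp. $XX$) measurement is a pair of green (resp. red) spiders on the two world-lines joined by a wire; a single-qubit $Z$ (resp. $X$)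 measurement cuts the world-line and consists of two one-legged red (resp. green) spiders. *A Pauli web* on such a diagram is a set of wires highlighted green and a set highlighted red such that every spider has an even number of legs highlighted in its own colour and all or none of its legs highlighted in the other colour. *A detecting region* is a Pauli web with finitely many highlighted wires. Its *detector* consists of the measurements whose outcomes parametrise a red spider incident to a green wire or a green spider incident to a red wire: a two-qubit measurement is included if its wire is highlighted in the colour of its basis (green for $Z$, red for $X$), and a single-qubit measurement is included if at least one of its two one-legged spiders meets such a wire. The *basic* region of the colour code at a face $f$ and timestep $r$, in the colour of the basis measured at $r$, highlights all legs of the face spiders $(f,r)$ and $(f,r+2)$ and of the six vertex spiders of $f$ at time $r+1$. **Statement.** 1. *Schedule.* At every timestep each qubit takes part in exactly one measurement, and every measurement has weight one, or has weight two and acts on nearest neighbours of the square lattice. The schedule has period $13$. Whatever happens at time $t$ happens at time $t-2$ translated by $(0,1)$, and at time $t-8$ translated by $(1,0)$, in both cases with $X$ and $Z$ exchanged; it also happens at time $t$ translated by $(3,1)$ and by $(-2,8)$, and at time $t+1$ translated by $(-1,-3)$. 2. *ZX-equivalence.* The bulk ZX-diagram of the Floquetified code is obtained from that of the colour code by spider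 unfusion: there is a map $\pi$ from the spiders of the former to those of the latter, preserving colours, whose fibres are finite trees, such that the wires between different fibres are exactly the wires of the colour code's diagram. Every face spider is unfused into four spiders and every vertex spider into five. Advancing the Floquetified code by $13$ timesteps corresponds to advancing the colour code by two timesteps together with a translation of the honeycomb lattice. 3. *Detectors.* The basic regions of the colour code are detecting regions, and every detecting region of the colour code is a finite product (sum modulo 2 of highlightings) of basic ones. Each basic region extends, along $\pi$, to a unique Pauli web of the Floquetified code. This web is a detecting region; every detecting region of the Floquetified code is a finite product of these images; and any two images agree up to a space-time translation, possibly combined with exchanging $X$ and $Z$. The detector of each image consists of exactly $14$ weight-two and $4$ single-qubit measurements, whose timesteps are exactly $8$ consecutive ones. (Exactly two of the four single-qubit measurements meet the region on both of their halves.) 4. *Torus.* For integers $a,b\ge1$ and $c$, place the bulk on the torus $\mathbb Z^2/\Lambda$ where $\Lambda$ is generated by $a(3,1)+c(-2,8)$ and $b(-2,8)$, that is, on $a$ columns of $b$ tiles each, where the tile is spanned by $(3,1)$ and $(-2,8)$ and the last column is glued to the first with a shift by $c$ tiles. There are $26ab$ qubits, all measurements are still single-qubit measurements or measurements of two distinct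 neighbours, and the schedule of generated groups has period $13$. If $3\mid a$, the code is, from some timestep on, established with four logical qubits: $N(\mathcal S_t)/\mathcal S_t\cong\mathcal P_4$. If $3\nmid a$, it is established with no logical qubits once a full period of measurements is complete: $N(\mathcal S_t)/\mathcal S_t\cong\mathcal P_0$ for all $t\ge12$. 5. *Toric colour code.* On every three-colourable honeycomb torus (the face set is $\mathbb Z^2/\Lambda$, with $\mathbb Z^2$ the triangular lattice of faces, in which the neighbours of $0$ are $\pm(1,0),\pm(0,1),\pm(1,-1)$, and $\Lambda$ has finite index and satisfies $i\equiv j\pmod 3$ for all $(i,j)\in\Lambda$) the colour code has period $2$ and is established from timestep $1$ on with four logical qubits, $N(\mathcal S_t)/\mathcal S_t\cong\mathcal P_4$, as in the case $3\mid a$ of part 4. -/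

import Mathlib

namespace FloquetColour

/-! ## Pauli groups -/

/-- The two CSS bases. As the colour of a spider or of a highlighted wire, `Z` is green and `X`
is red. -/
inductive PauliBasis
  | X
  | Z
  deriving DecidableEq

/-- Exchange of the roles of `X` and `Z`. -/
def PauliBasis.swap : PauliBasis → PauliBasis
  | .X => .Z
  | .Z => .X

/-- The Pauli group on the qubits `Q`: the triple `(k, x, z)` stands for the operator
`i ^ k * ∏ q, X_q ^ (x q) * ∏ q, Z_q ^ (z q)`. Every `i ^ ℓ` times a tensor product of Pauli
matrices has exactly one such normal form (`Y = i * X * Z`), so for `Q = Fin n` this is the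
`n`-qubit Pauli group. -/
@[ext]
structure Pauli (Q : Type) where
  phase : ZMod 4
  x : Q →₀ ZMod 2
  z : Q →₀ ZMod 2

namespace Pauli

variable {Q : Type}

/-- The parity of the overlap of two sets of qubits. -/
noncomputable def dot (a b : Q →₀ ZMod 2) : ZMod 2 := a.sum fun q c => c * b q

/-- The exponent of `i` in `(-1) ^ c`. -/
def sgn (c : ZMod 2) : ZMod 4 := if c = 0 then 0 else 2

theorem sgn_add (c d : ZMod 2) : sgn (c + d) = sgn c + sgn d := by
  revert c d; decide

theorem dot_add_left (a b c : Q →₀ ZMod 2) : dot (a + b) c = dot a c + dot b c := by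
  unfold dot
  exact Finsupp.sum_add_index' (fun q => zero_mul _) (fun q u v => add_mul _ _ _)

theorem dot_add_right (a b c : Q →₀ ZMod 2) : dot a (b + c) = dot a b + dot a c := by
  unfold dot
  simp [mul_add, Finsupp.sum_add]

theorem dot_zero_left (a : Q →₀ ZMod 2) : dot 0 a = 0 := by
  simp [dot]

noncomputable instance : One (Pauli Q) := ⟨⟨0, 0, 0⟩⟩

/-- Moving `Z ^ p.z` past `X ^ r.x` produces the sign `(-1) ^ (p.z · r.x)`. -/
noncomputable instance : Mul (Pauli Q) :=
  ⟨fun p r => ⟨p.phase + r.phase + sgn (dot p.z r.x), p.x + r.x, p.z + r.z⟩⟩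

noncomputable instance : Inv (Pauli Q) :=
  ⟨fun p => ⟨-(p.phase + sgn (dot (-p.z) p.x)), -p.x, -p.z⟩⟩

noncomputable instance : Group (Pauli Q) :=
  Group.ofLeftAxioms
    (fun p r s => by
      change Pauli.mk _ _ _ = Pauli.mk _ _ _
      refine Pauli.ext ?_ (add_assoc _ _ _) (add_assoc _ _ _)
      change p.phase + r.phase + sgn (dot p.z r.x) + s.phase + sgn (dot (p.z + r.z) s.x) =
        p.phase + (r.phase + s.phase + sgn (dot r.z s.x)) + sgn (dot p.z (r.x + s.x))
      rw [dot_add_left, dot_add_right, sgn_add, sgn_add]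
      ring)
    (fun p => by
      refine Pauli.ext ?_ (zero_add _) (zero_add _)
      change 0 + p.phase + sgn (dot 0 p.x) = p.phase
      simp [dot_zero_left, sgn])
    (fun p => by
      refine Pauli.ext ?_ (neg_add_cancel _) (neg_add_cancel _)
      change -(p.phase + sgn (dot (-p.z) p.x)) + p.phase + sgn (dot (-p.z) p.x) = 0
      ring)

/-- The central element `(-1) ^ m`. -/
noncomputable def sign (m : Bool) : Pauli Q := ⟨if m then 2 else 0, 0, 0⟩

/-- The product of the Paulis `X_q` (or of the `Z_q`) over a finite set of qubits. -/
noncomputable def prodOver (b : PauliBasis) (s : Finset Q) : Pauli Q :=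
  match b with
  | .X => ⟨0, ∑ q ∈ s, Finsupp.single q 1, 0⟩
  | .Z => ⟨0, 0, ∑ q ∈ s, Finsupp.single q 1⟩

end Pauli

/-! ## ISG codes -/

section ISG

variable {Q : Type}

open Classical in
/-- Measuring a Hermitian Pauli `p` on a stabilizer group `S`. If `p` or `-p` lies in `S`, the
outcome is deterministic and nothing changes. Otherwise the outcome `(-1) ^ m` is random, the
elements of `S` that commute with `p` survive, and `(-1) ^ m * p` is adjoined. -/
noncomputable def measure (S : Subgroup (Pauli Q)) (p : Pauli Q) (m : Bool) :
    Subgroup (Pauli Q) :=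
  if p ∈ S ∨ Pauli.sign true * p ∈ S then S
  else (S ⊓ Subgroup.centralizer {p}) ⊔ Subgroup.zpowers (Pauli.sign m * p)

/-- The instantaneous stabilizer group after timestep `t`, when the Paulis in the list `gens s` are
measured in turn at every timestep `s`, starting from the trivial group. The random outcomes are
read off from `outcome`. -/
noncomputable def isg (gens : ℕ → List (Pauli Q)) (outcome : ℕ → Pauli Q → Bool) :
    ℕ → Subgroup (Pauli Q)
  | 0 => (gens 0).foldl (fun S p => measure S p (outcome 0 p)) ⊥
  | t + 1 => (gens (t + 1)).foldl (fun S p => measure S p (outcome (t + 1) p))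
      (isg gens outcome t)

/-- The logical Pauli group `N(S) / S`. -/
abbrev LogicalPauliGroup (S : Subgroup (Pauli Q)) : Type :=
  Subgroup.normalizer (S : Set (Pauli Q)) ⧸ S.subgroupOf (Subgroup.normalizer (S : Set (Pauli Q)))

/-- The least size of a generating set. -/
noncomputable def rank (S : Subgroup (Pauli Q)) : ℕ :=
  sInf {r | ∃ s : Finset (Pauli Q), s.card = r ∧ Subgroup.closure (s : Set (Pauli Q)) = S}

/-- `M` repeats after `ℓ` timesteps and not earlier. -/
def HasPeriod {α : Type} (M : ℤ → α) (ℓ : ℕ) : Prop :=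
  0 < ℓ ∧ (∀ t, M (t + ℓ) = M t) ∧ ∀ p : ℕ, 0 < p → p < ℓ → ∃ t, M (t + p) ≠ M t

/-- The measurement schedule `M 0, M 1, …` defines an ISG code which is established from timestep
`T` on and encodes `k` logical qubits: the groups `M t` are Abelian, and whatever the generating
sets measured, their order, and the outcomes, at every `t ≥ T` the instantaneous stabilizer group
has rank `n - k` and its logical Pauli group is isomorphic to the `k`-qubit Pauli group. -/
def EncodesFrom (M : ℤ → Subgroup (Pauli Q)) (T k : ℕ) : Prop :=
  (∀ t, ∀ p ∈ M t, ∀ r ∈ M t, p * r = r * p) ∧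
  ∀ (gens : ℕ → List (Pauli Q)) (outcome : ℕ → Pauli Q → Bool),
    (∀ t : ℕ, Subgroup.closure {p | p ∈ gens t} = M t) →
    ∀ t : ℕ, T ≤ t →
      rank (isg gens outcome t) + k = Nat.card Q ∧
      Nonempty (LogicalPauliGroup (isg gens outcome t) ≃* Pauli (Fin k))

end ISG

/-- A CSS measurement: of the product of the `X_q`, or of the `Z_q`, over a finite set of qubits.
Its weight is the size of the set. -/
@[ext]
structure Measurement (Q : Type) where
  basis : PauliBasis
  support : Finset Q

namespace Measurement

variable {Q R : Type}

open Classical in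
/-- The image of a measurement under a map of qubits. -/
noncomputable def map (f : Q → R) (m : Measurement Q) : Measurement R :=
  ⟨m.basis, m.support.image f⟩

/-- The same measurement with the roles of `X` and `Z` exchanged. -/
def swap (m : Measurement Q) : Measurement Q := ⟨m.basis.swap, m.support⟩

noncomputable def pauli (m : Measurement Q) : Pauli Q := Pauli.prodOver m.basis m.support

end Measurement

/-- The group generated by a set of measurements. -/
noncomputable def measGroup {Q : Type} (R : Set (Measurement Q)) : Subgroup (Pauli Q) :=
  Subgroup.closure (Measurement.pauli '' R)

/-! ## The 6.6.6 colour code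

The faces of the honeycomb lattice are the points of the triangular lattice `ℤ × ℤ` (in which the
neighbours of `0` are `±(1, 0)`, `±(0, 1)` and `±(1, -1)`); its vertices are the triangles of that
lattice. The vertex `(p, false)` is incident to the faces `p, p + (1, 0), p + (0, 1)` and the
vertex `(p, true)` to `p + (1, 0), p + (0, 1), p + (1, 1)`. On a torus, `ℤ × ℤ` is replaced by a
quotient `A`, in which `e₁` and `e₂` are the classes of `(1, 0)` and `(0, 1)`. -/

open Classical in
/-- The six vertices of the hexagon `f`. -/
noncomputable def hexagon {A : Type} [AddCommGroup A] (e₁ e₂ f : A) : Finset (A × Bool) :=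
  {(f, false), (f - e₁, false), (f - e₂, false),
    (f - e₁, true), (f - e₂, true), (f - e₁ - e₂, true)}

/-- The colour code measures all `Z_f` at even timesteps and all `X_f` at odd ones. -/
def ccBasis (r : ℤ) : PauliBasis := if Even r then .Z else .X

/-- The measurement schedule of the colour code on the honeycomb torus with face set `ℤ² / Λ`. -/
noncomputable def toricCCSchedule (Λ : AddSubgroup (ℤ × ℤ)) (r : ℤ) :
    Subgroup (Pauli (((ℤ × ℤ) ⧸ Λ) × Bool)) :=
  measGroup {m | ∃ f : (ℤ × ℤ) ⧸ Λ,
    m = ⟨ccBasis r, hexagon (((1, 0) : ℤ × ℤ) : (ℤ × ℤ) ⧸ Λ) (((0, 1) : ℤ × ℤ) : (ℤ × ℤ) ⧸ Λ) f⟩}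

/-! ## The Floquetified colour code: measurement schedule -/

/-- A qubit of the square lattice. -/
abbrev Site := ℤ × ℤ

/-- What the qubit `(x, y)` undergoes at time `t` depends on `t + 8 x + 2 y` modulo 13 and on the
parity of `x + y`. -/
def phaseOf (q : Site) (t : ℤ) : ZMod 13 := ((t + 8 * q.1 + 2 * q.2 : ℤ) : ZMod 13)

/-- The displacement to the neighbour with which a qubit of the given phase is measured; `none`
for a single-qubit measurement. -/
def partnerAt (φ : ZMod 13) : Option Site :=
  match φ.val with
  | 1 => some (1, 0)
  | 2 => some (-1, 0)
  | 3 => some (0, 1)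
  | 4 => some (1, 0)
  | 5 => some (0, -1)
  | 6 => some (-1, 0)
  | 7 => some (1, 0)
  | 8 => some (0, 1)
  | 9 => some (-1, 0)
  | 10 => some (0, -1)
  | 11 => some (1, 0)
  | 12 => some (-1, 0)
  | _ => none

/-- The basis in which a qubit with `x + y` even is measured. -/
def basisAt (φ : ZMod 13) : PauliBasis :=
  match φ.val with
  | 1 => .Z
  | 3 => .Z
  | 6 => .Z
  | 7 => .Z
  | 10 => .Z
  | 12 => .Z
  | _ => .X

def partner (q : Site) (t : ℤ) : Option Site := partnerAt (phaseOf q t)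

def basis (q : Site) (t : ℤ) : PauliBasis :=
  if Even (q.1 + q.2) then basisAt (phaseOf q t) else (basisAt (phaseOf q t)).swap

/-- The measurement that the qubit `q` undergoes at time `t`. -/
def measAt (q : Site) (t : ℤ) : Measurement Site :=
  ⟨basis q t, match partner q t with
    | none => {q}
    | some d => {q, q + d}⟩

/-- All measurements in the bulk at time `t`. -/
def bulkRound (t : ℤ) : Set (Measurement Site) := Set.range fun q => measAt q t

/-- Nearest neighbours on the square lattice. -/
def Adjacent (p q : Site) : Prop :=
  q - p = (1, 0) ∨ q - p = (-1, 0) ∨ q - p = (0, 1) ∨ q - p = (0, -1)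

/-- The periods of a torus tiled by `a` columns of `b` tiles each. The tile spanned by `(3, 1)` and
`(-2, 8)` is repeated `b` times along `(-2, 8)` in every column and adjacent columns differ by
`(3, 1)`; the last column is glued to the first one with a shift by `c` tiles. -/
def tileLattice (a b : ℕ) (c : ℤ) : AddSubgroup Site :=
  AddSubgroup.closure
    {(a : ℤ) • ((3, 1) : Site) + c • ((-2, 8) : Site), (b : ℤ) • ((-2, 8) : Site)}

/-- The measurements on the torus `ℤ² / Λ` at time `t`. -/
def torusRound (Λ : AddSubgroup Site) (t : ℤ) : Set (Measurement (Site ⧸ Λ)) :=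
  Measurement.map (fun q : Site => (q : Site ⧸ Λ)) '' bulkRound t

noncomputable def torusSchedule (Λ : AddSubgroup Site) (t : ℤ) : Subgroup (Pauli (Site ⧸ Λ)) :=
  measGroup (torusRound Λ t)

/-! ## ZX-diagrams, spider fusion and Pauli webs -/

/-- A phase-free ZX-diagram without open wires, possibly infinite (the bulk of a code has neither
boundaries nor a first or last timestep). Green spiders have colour `Z` and red ones `X`. No two
wires of the diagrams below are parallel and none is a loop, so the wires form a simple graph. -/
structure ZXDiagram (σ : Type) where
  wires : SimpleGraph σ
  colour : σ → PauliBasis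

/-- `D` arises from `D'` by unfusing spiders: `π` sends every spider of `D` to the spider of `D'`
it was split off from. Every spider of `D'` becomes a finite tree of spiders of its colour, and the
wires between different trees are exactly the wires of `D'`. -/
structure IsUnfusion {σ τ : Type} (D : ZXDiagram σ) (D' : ZXDiagram τ) (π : σ → τ) : Prop where
  colour_eq : ∀ s, D.colour s = D'.colour (π s)
  finite_fibre : ∀ y, (π ⁻¹' {y}).Finite
  isTree_fibre : ∀ y, (D.wires.induce (π ⁻¹' {y})).IsTree
  existsUnique_wire : ∀ y y', D'.wires.Adj y y' →
    ∃! p : σ × σ, π p.1 = y ∧ π p.2 = y' ∧ D.wires.Adj p.1 p.2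
  adj_of_wire : ∀ s s', D.wires.Adj s s' → π s ≠ π s' → D'.wires.Adj (π s) (π s')

/-- An unsigned CSS Pauli web: `h .Z` is the set of wires highlighted green and `h .X` the set of
those highlighted red. A spider has an even number of legs highlighted in its own colour, and all
or none of its legs highlighted in the other colour. -/
def IsPauliWeb {σ : Type} (D : ZXDiagram σ) (h : PauliBasis → Set (Sym2 σ)) : Prop :=
  (∀ b, h b ⊆ D.wires.edgeSet) ∧
  ∀ s, Even {e | e ∈ h (D.colour s) ∧ s ∈ e}.ncard ∧
    ((∀ e ∈ D.wires.edgeSet, s ∈ e → e ∈ h (D.colour s).swap) ∨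
      (∀ e ∈ D.wires.edgeSet, s ∈ e → e ∉ h (D.colour s).swap))

/-- A detecting region: a Pauli web that highlights finitely many wires (and touches no open wire,
as there is none). -/
def IsDetectingRegion {σ : Type} (D : ZXDiagram σ) (h : PauliBasis → Set (Sym2 σ)) : Prop :=
  IsPauliWeb D h ∧ ∀ b, (h b).Finite

/-- The web `h` on the unfused diagram agrees with the web `h'` on the wires of the original one. -/
def Extends {σ τ : Type} (D : ZXDiagram σ) (π : σ → τ)
    (h : PauliBasis → Set (Sym2 σ)) (h' : PauliBasis → Set (Sym2 τ)) : Prop :=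
  ∀ b s s', D.wires.Adj s s' → π s ≠ π s' → (s(s, s') ∈ h b ↔ s(π s, π s') ∈ h' b)

/-- The region `h` is the product (the sum modulo 2 of the highlightings) of the regions `R i`,
`i ∈ S`. -/
def IsProductOf {σ ι : Type} (R : ι → PauliBasis → Set (Sym2 σ)) (S : Finset ι)
    (h : PauliBasis → Set (Sym2 σ)) : Prop :=
  ∀ b e, e ∈ h b ↔ Odd {i | i ∈ S ∧ e ∈ R i b}.ncard

/-! ### The bulk of the colour code as a ZX-diagram -/

/-- Spiders: one for every vertex and every timestep on the world-line of the qubit at that vertex,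
and one for every face and every timestep. -/
abbrev CCSpider := ((ℤ × ℤ) × Bool) × ℤ ⊕ (ℤ × ℤ) × ℤ

/-- A `Z_f` measurement is a red spider joined to green spiders on the world-lines of the vertices
of `f`; for an `X_f` measurement the colours are exchanged. -/
def ccDiagram : ZXDiagram CCSpider where
  wires := SimpleGraph.fromRel fun s s' =>
    match s, s' with
    | .inl (v, r), .inl (v', r') => v = v' ∧ r' = r + 1
    | .inl (v, r), .inr (f, r') => r = r' ∧ v ∈ hexagon ((1, 0) : ℤ × ℤ) (0, 1) f
    | _, _ => False
  colour := fun s =>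
    match s with
    | .inl (_, r) => ccBasis r
    | .inr (_, r) => (ccBasis r).swap

/-- Translation of the colour code by `d` in space and by `n` timesteps. -/
def ccShift (d : ℤ × ℤ) (n : ℤ) : CCSpider → CCSpider
  | .inl ((p, k), r) => .inl ((p + d, k), r + n)
  | .inr (f, r) => .inr (f + d, r + n)

/-- The detecting region of the colour code that compares the measurements of the face `i.1` at the
timesteps `i.2` and `i.2 + 2`: in the colour of these measurements, all legs of the two face spiders
and of the six spiders between them are highlighted. -/
def ccRegion (i : (ℤ × ℤ) × ℤ) (b : PauliBasis) : Set (Sym2 CCSpider) :=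
  {e | b = ccBasis i.2 ∧ e ∈ ccDiagram.wires.edgeSet ∧
    (Sum.inr (i.1, i.2) ∈ e ∨ Sum.inr (i.1, i.2 + 2) ∈ e ∨
      ∃ v ∈ hexagon ((1, 0) : ℤ × ℤ) (0, 1) i.1, Sum.inl (v, i.2 + 1) ∈ e)}

/-! ### The bulk of the Floquetified colour code as a ZX-diagram -/

/-- A qubit, a time, and a flag. A pairwise measurement has one spider on the world-line of each of
its two qubits (flag `false`). A single-qubit measurement cuts the world-line: it consists of two
one-legged spiders, the end of the incoming wire (flag `false`) and the start of the outgoing wire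
(flag `true`). -/
abbrev FSpider :=
  {s : Site × ℤ × Bool // s.2.2 = true → partner s.1 s.2.1 = none}

/-- A weight-two `Z` measurement is a pair of green spiders joined by a wire; a single-qubit `Z`
measurement consists of two one-legged red spiders. For `X` measurements the colours are
exchanged. -/
def fDiagram : ZXDiagram FSpider where
  wires := SimpleGraph.fromRel fun s s' =>
    -- a piece of world-line between two consecutive times
    (s'.1.1 = s.1.1 ∧ s'.1.2.1 = s.1.2.1 + 1 ∧ s'.1.2.2 = false ∧
      (s.1.2.2 = true ∨ partner s.1.1 s.1.2.1 ≠ none)) ∨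
    -- a weight-two measurement
    (s'.1.2.1 = s.1.2.1 ∧ ∃ d, partner s.1.1 s.1.2.1 = some d ∧ s'.1.1 = s.1.1 + d)
  colour := fun s =>
    match partner s.1.1 s.1.2.1 with
    | none => (basis s.1.1 s.1.2.1).swap
    | some _ => basis s.1.1 s.1.2.1

/-- The half `k` of the single-qubit measurement of `q` at time `t` is incident to a wire that is
highlighted in the basis of the measurement. -/
def SingleTouched (h : PauliBasis → Set (Sym2 FSpider)) (q : Site) (t : ℤ) (k : Bool) : Prop :=
  partner q t = none ∧ ∃ s : FSpider, s.1 = (q, t, k) ∧ ∃ e ∈ h (basis q t), s ∈ e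

/-- The wire of the weight-two measurement of `q` at time `t` is highlighted in the basis of the
measurement. -/
def PairTouched (h : PauliBasis → Set (Sym2 FSpider)) (q : Site) (t : ℤ) : Prop :=
  ∃ d, partner q t = some d ∧ ∃ s s' : FSpider,
    s.1 = (q, t, false) ∧ s'.1 = (q + d, t, false) ∧ s(s, s') ∈ h (basis q t)

/-- The measurements (with their times) of the detector that belongs to a detecting region: those
whose outcomes parametrise a red spider incident to a green wire or a green spider incident to a
red wire. -/
def detector (h : PauliBasis → Set (Sym2 FSpider)) : Set (ℤ × Measurement Site) :=
  {x | ∃ q t, x = (t, measAt q t) ∧ (PairTouched h q t ∨ ∃ k, SingleTouched h q t k)}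

/-- The highlighted wires, moved by `d` in space and by `n` in time. -/
def shiftWires (d : Site) (n : ℤ) (E : Set (Sym2 FSpider)) : Set (Sym2 (Site × ℤ × Bool)) :=
  Sym2.map (fun s : FSpider => (s.1.1 + d, s.1.2.1 + n, s.1.2.2)) '' E

end FloquetColour

open FloquetColour

namespace FloquetColour

open Pauli

/-! The whole theorem is linear algebra over `ZMod 2`, made finite by one residue modulo 26.

Stabilizers. A Pauli group without nontrivial multiples of the identity is determined, up to signs,
by its space `V` of symplectic vectors. Measuring a commuting round with span `M` replaces `V` by
`(V ∩ Mᗮ) + M`, whatever the generators, their order and the outcomes (`foldl_measure_spec`). For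
CSS rounds the X- and Z-parts evolve separately (`isg_spec`), and the number of logical qubits is
the number of qubits minus the two dimensions (`nonempty_logicalPauliGroup_equiv`). Both torus
statements thereby become dimension counts. For the colour code the hexagons span a self-orthogonal
space with exactly two relations on a three-colourable torus, hence two logical qubits for each
basis.

Schedule. The number `x - 3 y - 8 t` modulo 26 determines both the phase and the parity on which the
schedule depends. A space-time translation of residue 0 is a symmetry, and one of residue 13 is a
symmetry up to exchanging X and Z. Every local statement becomes a check over 26 classes.

Floquetified torus. In a fixed basis the stabilizers after a round are generated by the measured
Paulis and by the time slices of the detecting regions, which live through seven slices ("ages" 0 to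
6). Consecutive slices of a region differ by measured Paulis (`inMeas_slice_add_slice`), newborn
slices are themselves measured, and a measured Pauli survives the next round only if it is a sum of
newborn slices (`eq_slice_of_inMeas`). So from timestep 6 on the stabilizers are the image of a
linear map whose labels sit on half of the qubits, the other half serving the other basis
(`cssGroup_quotRound`). A relation is determined by its labels of class 4. These are invariant under
`(-2, 8)`, and three consecutive ones along `(3, 1)` sum to zero, so they have period 3 along `(3,
1)`. Closing up after `a` columns leaves two dimensions if `3 ∣ a`, given by the three-colouring of
the regions, and none otherwise. With two bases this gives four or zero logical qubits.

ZX-diagrams. Each spider of the colour code is stretched into a path. Along a path a web has no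
freedom: in the colour of the path a wire carries the parity of the legs that left before it, and in
the other colour all wires agree (`PathUnfusion.isWeb_spec`). Webs of the two diagrams thus
correspond bijectively, linearly and with finiteness preserved. A finite web of the colour code is a
product of basic regions whose coefficients are the partial sums, in time, of its highlighting at
the face spiders (`exists_coeff`). Finally, translations act transitively on the basic regions, so
that a single detector has to be computed. -/

theorem zmod_two_cases (c : ZMod 2) : c = 0 ∨ c = 1 := by revert c; decide

theorem zmod_two_add_eq_zero {M : Type*} [AddCommGroup M] [Module (ZMod 2) M] {a b : M} :
    a + b = 0 ↔ a = b := by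
  rw [← ZModModule.sub_eq_add, sub_eq_zero]

/-! ## Pauli groups and stabilizer groups -/

namespace Pauli

variable {Q : Type}

@[simp] theorem one_phase : (1 : Pauli Q).phase = 0 := rfl
@[simp] theorem one_x : (1 : Pauli Q).x = 0 := rfl
@[simp] theorem one_z : (1 : Pauli Q).z = 0 := rfl
@[simp] theorem mul_phase (p r : Pauli Q) :
    (p * r).phase = p.phase + r.phase + sgn (dot p.z r.x) := rfl
@[simp] theorem mul_x (p r : Pauli Q) : (p * r).x = p.x + r.x := rfl
@[simp] theorem mul_z (p r : Pauli Q) : (p * r).z = p.z + r.z := rfl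
@[simp] theorem inv_x (p : Pauli Q) : (p⁻¹).x = p.x :=
  (show (p⁻¹).x = -p.x from rfl).trans (ZModModule.neg_eq_self _)
@[simp] theorem inv_z (p : Pauli Q) : (p⁻¹).z = p.z :=
  (show (p⁻¹).z = -p.z from rfl).trans (ZModModule.neg_eq_self _)
@[simp] theorem sign_phase (m : Bool) : (sign m : Pauli Q).phase = if m then 2 else 0 := rfl
@[simp] theorem sign_x (m : Bool) : (sign m : Pauli Q).x = 0 := rfl
@[simp] theorem sign_z (m : Bool) : (sign m : Pauli Q).z = 0 := rfl

@[simp] theorem sgn_zero : sgn 0 = 0 := rfl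

theorem sgn_injective : Function.Injective sgn := by
  intro a b; revert a b; decide

theorem dot_zero_right (a : Q →₀ ZMod 2) : dot a 0 = 0 := by simp [dot]

/-- The overlap parity as a bilinear form. -/
noncomputable def dotForm (Q : Type) :
    (Q →₀ ZMod 2) →ₗ[ZMod 2] (Q →₀ ZMod 2) →ₗ[ZMod 2] ZMod 2 :=
  LinearMap.mk₂ (ZMod 2) dot dot_add_left
    (fun c a b => by
      obtain rfl | rfl := zmod_two_cases c
      · simp [dot_zero_left]
      · simp)
    dot_add_right
    (fun c a b => by
      obtain rfl | rfl := zmod_two_cases c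
      · simp [dot_zero_right]
      · simp)

@[simp] theorem dotForm_apply (a b : Q →₀ ZMod 2) : dotForm Q a b = dot a b := rfl

theorem dot_single_left (q : Q) (c : ZMod 2) (b : Q →₀ ZMod 2) :
    dot (Finsupp.single q c) b = c * b q := by
  simp [dot]

theorem dot_comm (a b : Q →₀ ZMod 2) : dot a b = dot b a := by
  induction a using Finsupp.induction_linear with
  | zero => rw [dot_zero_left, dot_zero_right]
  | add f g hf hg => rw [dot_add_left, dot_add_right, hf, hg]
  | single q c =>
    rw [dot_single_left]
    induction b using Finsupp.induction_linear with
    | zero => simp [dot_zero_left]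
    | add f g hf hg => rw [dot_add_left, ← hf, ← hg, Finsupp.add_apply, mul_add]
    | single r d =>
      rw [dot_single_left]
      by_cases h : q = r
      · subst h; simp [mul_comm]
      · simp [h, Ne.symm h]

theorem dot_sum_single (s : Finset Q) (b : Q →₀ ZMod 2) :
    dot (∑ q ∈ s, Finsupp.single q 1) b = ∑ q ∈ s, b q := by
  rw [← dotForm_apply, map_sum, LinearMap.sum_apply]
  simp [dot_single_left]

theorem mul_comm_iff (p r : Pauli Q) : p * r = r * p ↔ dot p.z r.x + dot r.z p.x = 0 := by
  rw [Pauli.ext_iff]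
  simp only [mul_phase, mul_x, mul_z, add_comm r.x, add_comm r.z, and_true]
  rw [add_comm r.phase, add_right_inj, sgn_injective.eq_iff, CharTwo.add_eq_zero]

/-- The symplectic form. -/
noncomputable def symp (v w : (Q →₀ ZMod 2) × (Q →₀ ZMod 2)) : ZMod 2 :=
  dot v.2 w.1 + dot w.2 v.1

theorem symp_add_left (u v w : (Q →₀ ZMod 2) × (Q →₀ ZMod 2)) :
    symp (u + v) w = symp u w + symp v w := by
  simp only [symp, Prod.snd_add, Prod.fst_add, dot_add_left, dot_add_right]; ring

theorem symp_comm (v w : (Q →₀ ZMod 2) × (Q →₀ ZMod 2)) : symp v w = symp w v := by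
  simp only [symp]; ring

/-- The symplectic vector of a Pauli. -/
def vec (p : Pauli Q) : (Q →₀ ZMod 2) × (Q →₀ ZMod 2) := (p.x, p.z)

@[simp] theorem vec_mul (p r : Pauli Q) : vec (p * r) = vec p + vec r := rfl
@[simp] theorem vec_inv (p : Pauli Q) : vec p⁻¹ = vec p := by simp [vec]
@[simp] theorem vec_sign (m : Bool) : vec (sign m : Pauli Q) = 0 := rfl

theorem mul_comm_iff_symp (p r : Pauli Q) : p * r = r * p ↔ symp (vec p) (vec r) = 0 :=
  mul_comm_iff p r

/-- The vectors orthogonal to a submodule with respect to the symplectic form. -/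
noncomputable def sympPerp (M : Submodule (ZMod 2) ((Q →₀ ZMod 2) × (Q →₀ ZMod 2))) :
    Submodule (ZMod 2) ((Q →₀ ZMod 2) × (Q →₀ ZMod 2)) :=
  AddSubgroup.toZModSubmodule 2
    { carrier := {v | ∀ w ∈ M, symp v w = 0}
      zero_mem' := fun w _ => by simp [symp, dot_zero_left, dot_zero_right]
      add_mem' := fun ha hb w hw => by rw [symp_add_left, ha w hw, hb w hw, add_zero]
      neg_mem' := fun {a} ha => by rwa [ZModModule.neg_eq_self] }

theorem mem_sympPerp {M : Submodule (ZMod 2) ((Q →₀ ZMod 2) × (Q →₀ ZMod 2))}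
    {v : (Q →₀ ZMod 2) × (Q →₀ ZMod 2)} : v ∈ sympPerp M ↔ ∀ w ∈ M, symp v w = 0 := Iff.rfl

theorem mem_sympPerp_span {s : Set ((Q →₀ ZMod 2) × (Q →₀ ZMod 2))}
    {v : (Q →₀ ZMod 2) × (Q →₀ ZMod 2)} :
    v ∈ sympPerp (Submodule.span (ZMod 2) s) ↔ ∀ w ∈ s, symp v w = 0 := by
  refine ⟨fun h w hw => h w (Submodule.subset_span hw), fun h w hw => ?_⟩
  rw [symp_comm]
  have h' : Submodule.span (ZMod 2) s ≤ sympPerp (Submodule.span (ZMod 2) {v}) := by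
    refine Submodule.span_le.2 fun u hu => ?_
    intro w hw
    obtain ⟨c, rfl⟩ := Submodule.mem_span_singleton.1 hw
    obtain rfl | rfl := zmod_two_cases c
    · simp [symp, dot_zero_left, dot_zero_right]
    · rw [one_smul, symp_comm]; exact h u hu
  exact h' hw v (Submodule.mem_span_singleton_self v)

end Pauli

open Pauli

/-! ### Stabilizer groups modulo signs, and measurement as linear algebra -/

section Stabilizer

variable {Q : Type}

/-- The only multiple of the identity in `S` is the identity. -/
def PhaseFree (S : Subgroup (Pauli Q)) : Prop := ∀ p ∈ S, vec p = 0 → p = 1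

/-- The symplectic vectors of the elements of a group of Paulis. -/
noncomputable def vecs (S : Subgroup (Pauli Q)) :
    Submodule (ZMod 2) ((Q →₀ ZMod 2) × (Q →₀ ZMod 2)) :=
  AddSubgroup.toZModSubmodule 2
    { carrier := vec '' S
      zero_mem' := ⟨1, S.one_mem, rfl⟩
      add_mem' := by
        rintro _ _ ⟨p, hp, rfl⟩ ⟨r, hr, rfl⟩
        exact ⟨p * r, S.mul_mem hp hr, rfl⟩
      neg_mem' := by
        rintro _ ⟨p, hp, rfl⟩
        exact ⟨p⁻¹, S.inv_mem hp, by rw [vec_inv, ZModModule.neg_eq_self]⟩ }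

theorem mem_vecs {S : Subgroup (Pauli Q)} {v : (Q →₀ ZMod 2) × (Q →₀ ZMod 2)} :
    v ∈ vecs S ↔ ∃ p ∈ S, vec p = v := Iff.rfl

theorem vec_mem_vecs {S : Subgroup (Pauli Q)} {p : Pauli Q} (hp : p ∈ S) : vec p ∈ vecs S :=
  ⟨p, hp, rfl⟩

theorem PhaseFree.eq_of_vec_eq {S : Subgroup (Pauli Q)} (hS : PhaseFree S) {p r : Pauli Q}
    (hp : p ∈ S) (hr : r ∈ S) (h : vec p = vec r) : p = r := by
  have := hS (p * r⁻¹) (S.mul_mem hp (S.inv_mem hr)) (by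
    rw [vec_mul, vec_inv, h, ZModModule.add_self])
  exact mul_inv_eq_one.1 this

theorem PhaseFree.commute {S : Subgroup (Pauli Q)} (hS : PhaseFree S) {p r : Pauli Q}
    (hp : p ∈ S) (hr : r ∈ S) : p * r = r * p :=
  hS.eq_of_vec_eq (S.mul_mem hp hr) (S.mul_mem hr hp) (by simp [add_comm])

theorem PhaseFree.mul_self {S : Subgroup (Pauli Q)} (hS : PhaseFree S) {p : Pauli Q}
    (hp : p ∈ S) : p * p = 1 :=
  hS _ (S.mul_mem hp hp) (by rw [vec_mul, ZModModule.add_self])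

/-- The condition `p * p = 1` prescribes twice the phase in `ZMod 4`, which leaves two phases
differing by 2. -/
theorem eq_or_eq_sign_mul {p r : Pauli Q} (hp : p * p = 1) (hr : r * r = 1) (h : vec p = vec r) :
    p = r ∨ p = Pauli.sign true * r := by
  have hx : p.x = r.x := congrArg Prod.fst h
  have hz : p.z = r.z := congrArg Prod.snd h
  have h1 := congrArg Pauli.phase (hp.trans hr.symm)
  simp only [mul_phase, hx, hz, add_left_inj] at h1
  have h2 : ∀ a b : ZMod 4, a + a = b + b → a = b ∨ a = 2 + b := by decide
  rcases h2 _ _ h1 with h3 | h3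
  · exact Or.inl (Pauli.ext h3 hx hz)
  · refine Or.inr (Pauli.ext ?_ (by simpa using hx) (by simpa using hz))
    simp [h3, dot_zero_left]

theorem sign_mul_comm (m : Bool) (p : Pauli Q) : Pauli.sign m * p = p * Pauli.sign m := by
  rw [mul_comm_iff]; simp [dot_zero_left, dot_zero_right]

theorem sign_mul_self (m : Bool) : (Pauli.sign m : Pauli Q) * Pauli.sign m = 1 := by
  refine Pauli.ext ?_ (by simp) (by simp)
  cases m
  · simp [dot_zero_left]
  · simp only [mul_phase, sign_phase, if_true, sign_z, dot_zero_left, sgn_zero, one_phase]; decide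

theorem mem_zpowers_of_mul_self {G : Type*} [Group G] {g x : G} (hg : g * g = 1) :
    x ∈ Subgroup.zpowers g ↔ x = 1 ∨ x = g := by
  constructor
  · rintro ⟨n, rfl⟩
    dsimp only
    rcases Int.even_or_odd' n with ⟨k, rfl | rfl⟩
    · left; rw [zpow_mul, zpow_two, hg, one_zpow]
    · right; rw [zpow_add, zpow_mul, zpow_two, hg, one_zpow, zpow_one, one_mul]
  · rintro (rfl | rfl)
    · exact Subgroup.one_mem _
    · exact Subgroup.mem_zpowers _

theorem mem_sup_span_singleton {M : Submodule (ZMod 2) ((Q →₀ ZMod 2) × (Q →₀ ZMod 2))}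
    {v w : (Q →₀ ZMod 2) × (Q →₀ ZMod 2)} :
    w ∈ M ⊔ Submodule.span (ZMod 2) {v} ↔ w ∈ M ∨ w + v ∈ M := by
  rw [Submodule.mem_sup]
  constructor
  · rintro ⟨y, hy, z, hz, rfl⟩
    obtain ⟨c, rfl⟩ := Submodule.mem_span_singleton.1 hz
    obtain rfl | rfl := zmod_two_cases c
    · left; simpa using hy
    · right; rw [one_smul, add_assoc, ZModModule.add_self, add_zero]; exact hy
  · rintro (h | h)
    · exact ⟨w, h, 0, Submodule.zero_mem _, add_zero _⟩
    · exact ⟨w + v, h, v, Submodule.mem_span_singleton_self v, by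
        rw [add_assoc, ZModModule.add_self, add_zero]⟩

/-- On symplectic vectors the deterministic and the random case obey one formula, and the outcome
drops out. In the deterministic case the formula changes nothing, because all of `S` commutes with
`p`. -/
theorem measure_spec {S : Subgroup (Pauli Q)} (hS : PhaseFree S) {p : Pauli Q} (hp : p * p = 1)
    (m : Bool) :
    PhaseFree (measure S p m) ∧ vecs (measure S p m) =
      (vecs S ⊓ sympPerp (Submodule.span (ZMod 2) {vec p})) ⊔
        Submodule.span (ZMod 2) {vec p} := by
  unfold measure
  split_ifs with h
  · refine ⟨hS, ?_⟩
    have hv : vec p ∈ vecs S := by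
      rcases h with h | h
      · exact ⟨p, h, rfl⟩
      · exact ⟨_, h, by simp⟩
    apply le_antisymm
    · intro v hv'
      refine Submodule.mem_sup_left ⟨hv', ?_⟩
      refine mem_sympPerp_span.2 ?_
      rintro _ rfl
      obtain ⟨a, ha, rfl⟩ := mem_vecs.1 hv'
      obtain ⟨c, hc, hc'⟩ := mem_vecs.1 hv
      rw [← hc', ← mul_comm_iff_symp]
      exact hS.commute ha hc
    · exact sup_le inf_le_left ((Submodule.span_singleton_le_iff_mem _ _).2 hv)
  · have hpm : (Pauli.sign m * p) * (Pauli.sign m * p) = 1 := by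
      rw [mul_assoc, ← mul_assoc p, ← sign_mul_comm, mul_assoc, hp, mul_one, sign_mul_self]
    -- As `± p` is an involution commuting with the surviving elements, the join consists of these
    -- elements and their products with `± p`.
    have hmem : ∀ x, x ∈ (S ⊓ Subgroup.centralizer {p}) ⊔ Subgroup.zpowers (Pauli.sign m * p) ↔
        ∃ a ∈ S, a * p = p * a ∧ (x = a ∨ x = a * (Pauli.sign m * p)) := by
      intro x
      constructor
      · intro hx
        refine Subgroup.closure_induction
          (p := fun x _ => ∃ a ∈ S, a * p = p * a ∧ (x = a ∨ x = a * (Pauli.sign m * p)))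
          ?_ ?_ ?_ ?_ (by rwa [← Subgroup.sup_eq_closure])
        · rintro y (hy | hy)
          · exact ⟨y, hy.1, Subgroup.mem_centralizer_singleton_iff.1 hy.2, Or.inl rfl⟩
          · rcases (mem_zpowers_of_mul_self hpm).1 hy with rfl | rfl
            · exact ⟨1, S.one_mem, by simp, Or.inl rfl⟩
            · exact ⟨1, S.one_mem, by simp, Or.inr (by simp)⟩
        · exact ⟨1, S.one_mem, by simp, Or.inl rfl⟩
        · rintro y z - - ⟨a, ha, hap, hy⟩ ⟨c, hc, hcp, hz⟩
          refine ⟨a * c, S.mul_mem ha hc, by rw [mul_assoc, hcp, ← mul_assoc, hap, mul_assoc], ?_⟩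
          have h1 : (Pauli.sign m * p) * c = c * (Pauli.sign m * p) := by
            rw [mul_assoc, ← hcp, ← mul_assoc, sign_mul_comm, mul_assoc]
          rcases hy with rfl | rfl <;> rcases hz with rfl | rfl
          · exact Or.inl rfl
          · exact Or.inr (mul_assoc _ _ _).symm
          · exact Or.inr (by rw [mul_assoc, h1, mul_assoc])
          · left
            rw [mul_assoc, ← mul_assoc _ c, h1, mul_assoc, hpm, mul_one]
        · rintro y - ⟨a, ha, hap, hy⟩
          have hai : a⁻¹ * p = p * a⁻¹ := by
            rw [inv_mul_eq_iff_eq_mul, ← mul_assoc, hap, mul_assoc, mul_inv_cancel, mul_one]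
          have h1 : (Pauli.sign m * p) * a⁻¹ = a⁻¹ * (Pauli.sign m * p) := by
            rw [mul_assoc, ← hai, ← mul_assoc, sign_mul_comm, mul_assoc]
          refine ⟨a⁻¹, S.inv_mem ha, hai, ?_⟩
          rcases hy with rfl | rfl
          · exact Or.inl rfl
          · right
            rw [mul_inv_rev, ← h1, inv_eq_of_mul_eq_one_left hpm]
      · rintro ⟨a, ha, hap, rfl | rfl⟩
        · exact Subgroup.mem_sup_left ⟨ha, Subgroup.mem_centralizer_singleton_iff.2 hap⟩
        · exact Subgroup.mul_mem _
            (Subgroup.mem_sup_left ⟨ha, Subgroup.mem_centralizer_singleton_iff.2 hap⟩)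
            (Subgroup.mem_sup_right (Subgroup.mem_zpowers _))
    constructor
    · intro x hx hv
      obtain ⟨a, ha, hap, rfl | rfl⟩ := (hmem x).1 hx
      · exact hS _ ha hv
      -- A multiple of the identity of the form `a * (± p)` would make `a` equal to `p` or `-p`, and
      -- then the outcome would have been deterministic.
      · exfalso
        rw [vec_mul, vec_mul, vec_sign, zero_add, zmod_two_add_eq_zero] at hv
        rcases eq_or_eq_sign_mul (hS.mul_self ha) hp hv with rfl | rfl
        · exact h (Or.inl ha)
        · exact h (Or.inr ha)
    · ext v
      rw [mem_sup_span_singleton, mem_vecs]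
      have key : ∀ w, w ∈ vecs S ⊓ sympPerp (Submodule.span (ZMod 2) {vec p}) ↔
          ∃ a ∈ S, a * p = p * a ∧ vec a = w := by
        intro w
        rw [Submodule.mem_inf, mem_vecs, mem_sympPerp_span]
        constructor
        · rintro ⟨⟨a, ha, rfl⟩, h2⟩
          exact ⟨a, ha, (mul_comm_iff_symp _ _).2 (h2 _ rfl), rfl⟩
        · rintro ⟨a, ha, hap, rfl⟩
          exact ⟨⟨a, ha, rfl⟩, by rintro _ rfl; exact (mul_comm_iff_symp _ _).1 hap⟩
      rw [key, key]
      constructor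
      · rintro ⟨x, hx, rfl⟩
        obtain ⟨a, ha, hap, rfl | rfl⟩ := (hmem x).1 hx
        · exact Or.inl ⟨_, ha, hap, rfl⟩
        · refine Or.inr ⟨a, ha, hap, ?_⟩
          rw [vec_mul, vec_mul, vec_sign, zero_add, add_assoc, ZModModule.add_self, add_zero]
      · rintro (⟨a, ha, hap, rfl⟩ | ⟨a, ha, hap, hav⟩)
        · exact ⟨a, (hmem a).2 ⟨a, ha, hap, Or.inl rfl⟩, rfl⟩
        · refine ⟨_, (hmem _).2 ⟨a, ha, hap, Or.inr rfl⟩, ?_⟩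
          rw [vec_mul, vec_mul, vec_sign, zero_add, hav, add_assoc, ZModModule.add_self, add_zero]

/-- Measuring a list of commuting Hermitian Paulis. -/
theorem foldl_measure_spec (f : Pauli Q → Bool) (l : List (Pauli Q))
    (hl : ∀ p ∈ l, p * p = 1) (hc : ∀ p ∈ l, ∀ r ∈ l, p * r = r * p)
    {S : Subgroup (Pauli Q)} (hS : PhaseFree S) :
    PhaseFree (l.foldl (fun S p => measure S p (f p)) S) ∧
      vecs (l.foldl (fun S p => measure S p (f p)) S) =
        (vecs S ⊓ sympPerp (Submodule.span (ZMod 2) (vec '' {p | p ∈ l}))) ⊔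
          Submodule.span (ZMod 2) (vec '' {p | p ∈ l}) := by
  induction l using List.reverseRecOn with
  | nil =>
    refine ⟨hS, ?_⟩
    ext v
    simp [mem_sympPerp, symp, dot_zero_left, dot_zero_right]
  | append_singleton l p ih =>
    obtain ⟨h1, h2⟩ := ih (fun r hr => hl r (by simp [hr]))
      (fun r hr s hs => hc r (by simp [hr]) s (by simp [hs]))
    rw [List.foldl_append, List.foldl_cons, List.foldl_nil]
    obtain ⟨h3, h4⟩ := measure_spec h1 (hl p (by simp)) (f p)
    refine ⟨h3, ?_⟩
    rw [h4, h2]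
    have hset : vec '' {r | r ∈ l ++ [p]} = vec '' {r | r ∈ l} ∪ {vec p} := by
      ext v; simp [or_and_right, exists_or, eq_comm, or_comm]
    rw [hset, Submodule.span_union]
    set M := Submodule.span (ZMod 2) (vec '' {r | r ∈ l})
    set N := Submodule.span (ZMod 2) {vec p}
    have hMN : M ≤ sympPerp N := by
      refine Submodule.span_le.2 ?_
      rintro _ ⟨r, hr, rfl⟩
      refine mem_sympPerp_span.2 ?_
      rintro _ rfl
      exact (mul_comm_iff_symp _ _).1 (hc r (by simp [show r ∈ l from hr]) p (by simp))
    have hperp : sympPerp (M ⊔ N) = sympPerp M ⊓ sympPerp N := by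
      rw [← Submodule.span_union]
      ext v
      simp only [Submodule.mem_inf, M, N, mem_sympPerp_span, Set.mem_union, or_imp, forall_and]
    -- This is the modular law: the earlier span `M` is orthogonal to `N`, so it passes through the
    -- intersection with `sympPerp N` unchanged.
    rw [hperp, sup_comm (vecs S ⊓ sympPerp M) M, sup_inf_assoc_of_le _ hMN, ← inf_assoc,
      ← sup_assoc, sup_comm M]

end Stabilizer

/-! ### Rank and logical Pauli group from dimensions -/

section Logical

variable {Q : Type}

theorem vecs_closure (T : Set (Pauli Q)) :
    vecs (Subgroup.closure T) = Submodule.span (ZMod 2) (vec '' T) := by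
  apply le_antisymm
  · rintro _ ⟨p, hp, rfl⟩
    induction hp using Subgroup.closure_induction with
    | mem p hp => exact Submodule.subset_span ⟨p, hp, rfl⟩
    | one => exact Submodule.zero_mem _
    | mul p r _ _ h1 h2 => exact Submodule.add_mem _ h1 h2
    | inv p _ h => rwa [vec_inv]
  · rw [Submodule.span_le]
    rintro _ ⟨p, hp, rfl⟩
    exact vec_mem_vecs (Subgroup.subset_closure hp)

/-- A phase-free group maps bijectively to its space of vectors, and generating sets correspond to
spanning sets. -/
theorem rank_eq_finrank [Finite Q] {S : Subgroup (Pauli Q)} (hS : PhaseFree S) :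
    rank S = Module.finrank (ZMod 2) (vecs S) := by
  classical
  have lower : ∀ s : Finset (Pauli Q), Subgroup.closure (s : Set (Pauli Q)) = S →
      Module.finrank (ZMod 2) (vecs S) ≤ s.card := by
    rintro s rfl
    rw [vecs_closure, ← Finset.coe_image]
    exact (finrank_span_finset_le_card _).trans Finset.card_image_le
  let bas := Module.finBasis (ZMod 2) (vecs S)
  choose g hg hgv using fun i => mem_vecs.1 (bas i).2
  let s : Finset (Pauli Q) := Finset.univ.image g
  have hs : Subgroup.closure (s : Set (Pauli Q)) = S := by
    apply le_antisymm
    · rw [Subgroup.closure_le]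
      intro p hp
      simp only [s, Finset.coe_image, Finset.coe_univ, Set.image_univ, Set.mem_range] at hp
      obtain ⟨i, rfl⟩ := hp
      exact hg i
    · intro p hp
      have h1 : vec p ∈ Submodule.span (ZMod 2) (vec '' (s : Set (Pauli Q))) := by
        have h2 : vec '' (s : Set (Pauli Q)) = (vecs S).subtype '' Set.range bas := by
          ext v
          simp [s, hgv]
        rw [h2, ← Submodule.map_span, bas.span_eq]
        exact ⟨⟨vec p, vec_mem_vecs hp⟩, trivial, rfl⟩
      rw [← vecs_closure] at h1
      obtain ⟨r, hr, hrp⟩ := mem_vecs.1 h1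
      have hle : Subgroup.closure (s : Set (Pauli Q)) ≤ S := by
        rw [Subgroup.closure_le]
        intro p hp
        simp only [s, Finset.coe_image, Finset.coe_univ, Set.image_univ, Set.mem_range] at hp
        obtain ⟨i, rfl⟩ := hp
        exact hg i
      rwa [← hS.eq_of_vec_eq (hle hr) hp hrp]
  apply le_antisymm
  · have h1 : rank S ≤ s.card := Nat.sInf_le ⟨s, rfl, hs⟩
    refine h1.trans (Finset.card_image_le.trans ?_)
    simp
  · refine le_csInf ⟨s.card, ⟨s, rfl, hs⟩⟩ ?_
    rintro _ ⟨s', rfl, hs'⟩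
    exact lower s' hs'

/-- Conjugation leaves the vector of a Pauli unchanged. In a phase-free group this means that a
conjugate which stays in the group equals the original, so the normalizer is the centralizer. -/
theorem mem_normalizer_iff {S : Subgroup (Pauli Q)} (hS : PhaseFree S) {g : Pauli Q} :
    g ∈ Subgroup.normalizer (S : Set (Pauli Q)) ↔ ∀ v ∈ vecs S, symp (vec g) v = 0 := by
  rw [Subgroup.mem_normalizer_iff]
  have hconj : ∀ h, vec (g * h * g⁻¹) = vec h := fun h => by
    rw [vec_mul, vec_mul, vec_inv, add_comm (vec g), add_assoc, ZModModule.add_self, add_zero]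
  constructor
  · rintro hn _ ⟨h, hh, rfl⟩
    have := hS.eq_of_vec_eq ((hn h).1 hh) hh (hconj h)
    exact (mul_comm_iff_symp _ _).1 (mul_inv_eq_iff_eq_mul.1 this)
  · intro hc h
    have key : ∀ h ∈ S, g * h * g⁻¹ = h := fun h hh =>
      mul_inv_eq_iff_eq_mul.2 ((mul_comm_iff_symp _ _).2 (hc _ (vec_mem_vecs hh)))
    constructor
    · intro hh
      rw [key h hh]; exact hh
    · intro hh
      have h1 : vec (g * h * g⁻¹) ∈ vecs S := vec_mem_vecs hh
      rw [hconj] at h1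
      have h2 : g * h = h * g := (mul_comm_iff_symp _ _).2 (hc _ h1)
      rwa [h2, mul_inv_cancel_right] at hh

theorem dotForm_nondegenerate : (dotForm Q).Nondegenerate := by
  classical
  have key : ∀ a : Q →₀ ZMod 2, (∀ q, dot (Finsupp.single q 1) a = 0) → a = 0 := by
    intro a ha
    ext q
    simpa [dot_single_left] using ha q
  constructor
  · intro a ha
    exact key a fun q => by rw [dot_comm]; exact ha _
  · intro a ha
    exact key a fun q => ha _

theorem dotForm_isRefl : (dotForm Q).IsRefl := by
  intro a b h
  rw [dotForm_apply, dot_comm]; exact h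

/-- The vectors orthogonal to a submodule. -/
noncomputable abbrev dotPerp (L : Submodule (ZMod 2) (Q →₀ ZMod 2)) :
    Submodule (ZMod 2) (Q →₀ ZMod 2) :=
  LinearMap.BilinForm.orthogonal (dotForm Q) L

theorem mem_dotPerp {L : Submodule (ZMod 2) (Q →₀ ZMod 2)} {v : Q →₀ ZMod 2} :
    v ∈ dotPerp L ↔ ∀ w ∈ L, dot w v = 0 := Iff.rfl

/-- The `c i` are logical X operators, a basis of a complement of `LX` in `dotPerp LZ`. The `d i`
are the dual logical Z operators. The last two clauses say that subtracting the logical part of an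
undetected Pauli leaves a stabilizer. -/
theorem exists_logical_basis [Finite Q] {LX LZ : Submodule (ZMod 2) (Q →₀ ZMod 2)}
    (hle : LX ≤ dotPerp LZ) {k : ℕ}
    (hk : Module.finrank (ZMod 2) LX + Module.finrank (ZMod 2) LZ + k = Nat.card Q) :
    ∃ c d : Fin k → (Q →₀ ZMod 2), (∀ i, c i ∈ dotPerp LZ) ∧ (∀ i, d i ∈ dotPerp LX) ∧
      (∀ i j, dot (d i) (c j) = if i = j then 1 else 0) ∧
      (∀ x ∈ dotPerp LZ, x + ∑ j, dot (d j) x • c j ∈ LX) ∧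
      (∀ z ∈ dotPerp LX, z + ∑ j, dot z (c j) • d j ∈ LZ) := by
  classical
  have := Fintype.ofFinite Q
  set W := dotPerp LZ with hW
  have hcardW : Module.finrank (ZMod 2) W = Nat.card Q - Module.finrank (ZMod 2) LZ := by
    rw [hW, dotPerp, LinearMap.BilinForm.finrank_orthogonal dotForm_nondegenerate,
      Module.finrank_finsupp_self, Nat.card_eq_fintype_card]
  let LX' : Submodule (ZMod 2) W := LX.comap W.subtype
  obtain ⟨C, hC⟩ := Submodule.exists_isCompl LX'
  have hLX' : Module.finrank (ZMod 2) LX' = Module.finrank (ZMod 2) LX :=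
    (Submodule.comapSubtypeEquivOfLe hle).finrank_eq
  have hCk : Module.finrank (ZMod 2) C = k := by
    have := Submodule.finrank_add_eq_of_isCompl hC
    omega
  let bas := Module.finBasisOfFinrankEq (ZMod 2) C hCk
  let pr : W →ₗ[ZMod 2] C := C.projectionOnto LX' hC.symm
  -- The coordinates of the projection along `LX` are extended arbitrarily from `W` to all qubits;
  -- nondegeneracy of the overlap form represents the extensions by vectors `d j`.
  choose φ hφ using fun j : Fin k => LinearMap.exists_extend ((bas.coord j).comp pr)
  let d : Fin k → (Q →₀ ZMod 2) := fun j =>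
    (LinearMap.BilinForm.toDual (dotForm Q) dotForm_nondegenerate).symm (φ j)
  have hd : ∀ j v, dot (d j) v = φ j v := fun j v => by
    rw [← dotForm_apply]
    exact LinearMap.BilinForm.apply_toDual_symm_apply (φ j) v
  have hdW : ∀ j (v : W), dot (d j) v = bas.coord j (pr v) := fun j v => by
    rw [hd]; exact LinearMap.congr_fun (hφ j) v
  have hdual : ∀ i j, dot (d i) ((bas j : W) : Q →₀ ZMod 2) = if i = j then 1 else 0 := by
    intro i j
    rw [hdW, Submodule.projectionOnto_apply_left, Module.Basis.coord_apply,
      Module.Basis.repr_self, Finsupp.single_apply]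
    simp [eq_comm]
  have hdLX : ∀ i, d i ∈ dotPerp LX := by
    intro i w hw
    change dotForm Q w (d i) = 0
    rw [dotForm_apply, dot_comm, hdW i ⟨w, hle hw⟩,
      (Submodule.projectionOnto_apply_eq_zero_iff hC.symm).2 (by exact hw), map_zero]
  have hx : ∀ x ∈ W, x + ∑ j, dot (d j) x • ((bas j : W) : Q →₀ ZMod 2) ∈ LX := by
    intro x hx
    have h1 : (pr ⟨x, hx⟩ : C) = ∑ j, dot (d j) x • bas j := by
      rw [← bas.sum_repr (pr ⟨x, hx⟩)]
      refine Finset.sum_congr rfl fun j _ => ?_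
      rw [hdW j ⟨x, hx⟩, Module.Basis.coord_apply]
    have h2 : (⟨x, hx⟩ : W) - (pr ⟨x, hx⟩ : C) ∈ LX' := by
      refine (Submodule.projectionOnto_apply_eq_zero_iff hC.symm).1 ?_
      change pr _ = 0
      rw [LinearMap.map_sub, sub_eq_zero]
      exact (Submodule.projectionOnto_apply_left hC.symm _).symm
    rw [h1] at h2
    have h3 : x - ∑ j, dot (d j) x • ((bas j : W) : Q →₀ ZMod 2) ∈ LX := by
      have h4 : x - ((∑ j, dot (d j) x • bas j : C) : W).1 ∈ LX := h2
      simpa using h4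
    rwa [ZModModule.sub_eq_add] at h3
  refine ⟨fun j => ((bas j : W) : Q →₀ ZMod 2), d, fun i => (bas i : W).2, hdLX, hdual, hx, ?_⟩
  intro z hz
  -- The corrected vector kills the complement by duality and kills `LX` by assumption. Hence it
  -- kills `W`, and the double orthogonal complement puts it into `LZ`.
  have hz' : z + ∑ j, dot z ((bas j : W) : Q →₀ ZMod 2) • d j ∈ dotPerp W := by
    intro w hw
    change dotForm Q w _ = 0
    set y := z + ∑ j, dot z ((bas j : W) : Q →₀ ZMod 2) • d j with hy
    have hy1 : y ∈ dotPerp LX :=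
      Submodule.add_mem _ hz (Submodule.sum_mem _ fun j _ => Submodule.smul_mem _ _ (hdLX j))
    have hy2 : ∀ i, dot ((bas i : W) : Q →₀ ZMod 2) y = 0 := by
      intro i
      rw [dot_comm, hy, dot_add_left, ← dotForm_apply (∑ j, _), map_sum, LinearMap.sum_apply]
      simp only [map_smul, LinearMap.smul_apply, dotForm_apply, hdual, smul_eq_mul, mul_ite,
        mul_one, mul_zero, Finset.sum_ite_eq', Finset.mem_univ, if_true]
      exact CharTwo.add_self_eq_zero _
    have hw' := hy1 _ (hx w hw)
    change dotForm Q _ y = 0 at hw'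
    rw [dotForm_apply, dot_add_left, ← dotForm_apply (∑ j, _), map_sum, LinearMap.sum_apply] at hw'
    simpa [hy2] using hw'
  have hWW : dotPerp W = LZ :=
    LinearMap.BilinForm.orthogonal_orthogonal dotForm_nondegenerate dotForm_isRefl LZ
  rwa [hWW] at hz'

/-- The logical Pauli group of a CSS stabilizer group. -/
theorem nonempty_logicalPauliGroup_equiv [Finite Q] {S : Subgroup (Pauli Q)} (hS : PhaseFree S)
    {LX LZ : Submodule (ZMod 2) (Q →₀ ZMod 2)} (hv : vecs S = LX.prod LZ) {k : ℕ}
    (hk : Module.finrank (ZMod 2) LX + Module.finrank (ZMod 2) LZ + k = Nat.card Q) :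
    Nonempty (LogicalPauliGroup S ≃* Pauli (Fin k)) := by
  classical
  have hmem : ∀ x z, (x, z) ∈ vecs S ↔ x ∈ LX ∧ z ∈ LZ := fun x z => by
    rw [hv, Submodule.mem_prod]
  have hle : LX ≤ dotPerp LZ := by
    intro x hx z hz
    obtain ⟨p, hp, hpx⟩ := mem_vecs.1 ((hmem x 0).2 ⟨hx, LZ.zero_mem⟩)
    obtain ⟨r, hr, hrz⟩ := mem_vecs.1 ((hmem 0 z).2 ⟨LX.zero_mem, hz⟩)
    have := (mul_comm_iff_symp _ _).1 (hS.commute hp hr)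
    rw [hpx, hrz] at this
    simpa [symp, dot_zero_left] using this
  obtain ⟨c, d, hc, hd, hdc, hx, hz⟩ := exists_logical_basis hle hk
  have hN : ∀ g : Pauli Q, g ∈ Subgroup.normalizer (S : Set (Pauli Q)) ↔
      g.x ∈ dotPerp LZ ∧ g.z ∈ dotPerp LX := by
    intro g
    rw [mem_normalizer_iff hS]
    constructor
    · intro h
      refine ⟨fun w hw => ?_, fun w hw => ?_⟩
      · simpa [symp, dot_zero_right, vec] using h (0, w) ((hmem _ _).2 ⟨LX.zero_mem, hw⟩)
      · change dotForm Q w g.z = 0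
        rw [dotForm_apply, dot_comm]
        simpa [symp, dot_zero_left, vec] using h (w, 0) ((hmem _ _).2 ⟨hw, LZ.zero_mem⟩)
    · rintro ⟨h1, h2⟩ ⟨x, z⟩ hxz
      have h3 : dot z g.x = 0 := h1 z ((hmem x z).1 hxz).2
      have h4 : dot x g.z = 0 := h2 x ((hmem x z).1 hxz).1
      simp [symp, vec, h3, dot_comm g.z x, h4]
  let A := Finsupp.linearCombination (ZMod 2) c
  let B := Finsupp.linearCombination (ZMod 2) d
  have hAd : ∀ j x, dot (d j) (A x) = x j := by
    intro j x
    rw [← dotForm_apply]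
    simp only [A, Finsupp.linearCombination_apply, Finsupp.sum_fintype, map_sum, map_smul, zero_smul,
      implies_true, dotForm_apply, hdc, smul_eq_mul, mul_ite, mul_one, mul_zero]
    simp
  have hBc : ∀ j z, dot (B z) (c j) = z j := by
    intro j z
    rw [← dotForm_apply]
    simp only [B, Finsupp.linearCombination_apply, Finsupp.sum_fintype, map_sum, map_smul, zero_smul,
      implies_true, LinearMap.sum_apply, LinearMap.smul_apply, dotForm_apply, hdc, smul_eq_mul,
      mul_ite, mul_one, mul_zero]
    simp
  have hBA : ∀ x z, dot (B z) (A x) = dot z x := by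
    intro x z
    have : ((dotForm Q).comp B).flip.comp A = (dotForm (Fin k)).flip := by
      ext j i
      simp [A, B, hdc, dot_single_left, Finsupp.single_apply, eq_comm]
    exact LinearMap.congr_fun (LinearMap.congr_fun this x) z
  have hAW : ∀ x, A x ∈ dotPerp LZ := fun x => by
    simp only [A, Finsupp.linearCombination_apply]
    exact Submodule.sum_mem _ fun i _ => Submodule.smul_mem _ _ (hc i)
  have hBW : ∀ x, B x ∈ dotPerp LX := fun x => by
    simp only [B, Finsupp.linearCombination_apply]
    exact Submodule.sum_mem _ fun i _ => Submodule.smul_mem _ _ (hd i)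
  -- Phases are kept as they are; the signs in products agree because `A` and `B` preserve the
  -- overlap form (`hBA`).
  let f : Pauli (Fin k) →* Subgroup.normalizer (S : Set (Pauli Q)) :=
    { toFun := fun p => ⟨⟨p.phase, A p.x, B p.z⟩, (hN _).2 ⟨hAW _, hBW _⟩⟩
      map_one' := by
        refine Subtype.ext (Pauli.ext rfl ?_ ?_)
        · exact map_zero A
        · exact map_zero B
      map_mul' := fun p r => by
        refine Subtype.ext (Pauli.ext ?_ ?_ ?_)
        · simp [hBA]
        · simp
        · simp }
  let g := (QuotientGroup.mk' (S.subgroupOf (Subgroup.normalizer (S : Set (Pauli Q))))).comp f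
  refine ⟨(MulEquiv.ofBijective g ⟨?_, ?_⟩).symm⟩
  · rw [injective_iff_map_eq_one]
    intro p hp
    have hpS : (f p : Pauli Q) ∈ S := by
      have := (QuotientGroup.eq_one_iff (f p)).1 hp
      exact Subgroup.mem_subgroupOf.1 this
    have hv1 := (hmem _ _).1 (vec_mem_vecs hpS)
    have hpx : p.x = 0 := by
      ext j
      rw [← hAd j, dot_comm]
      exact hd j _ hv1.1
    have hpz : p.z = 0 := by
      ext j
      rw [← hBc j]
      exact hc j _ hv1.2
    have h1 := hS _ hpS (by
      change (A p.x, B p.z) = 0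
      rw [hpx, hpz, map_zero, map_zero]; rfl)
    exact Pauli.ext (congrArg (fun r : Pauli Q => r.phase) h1) hpx hpz
  · intro y
    obtain ⟨⟨y, hy⟩, rfl⟩ := QuotientGroup.mk_surjective y
    obtain ⟨hyx, hyz⟩ := (hN y).1 hy
    obtain ⟨s, hs, hsv⟩ := mem_vecs.1 ((hmem _ _).2 ⟨hx _ hyx, hz _ hyz⟩)
    have hsx : s.x = _ := congrArg Prod.fst hsv
    have hsz : s.z = _ := congrArg Prod.snd hsv
    -- The logical coordinates of `y` are its pairings with the dual basis. The phase is that of `y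
    -- * s`, where `s` is the stabilizer that removes the rest of `y`.
    let p : Pauli (Fin k) := ⟨(y * s).phase, Finsupp.equivFunOnFinite.symm fun j => dot (d j) y.x,
      Finsupp.equivFunOnFinite.symm fun j => dot y.z (c j)⟩
    refine ⟨p, ?_⟩
    have hfp : (f p : Pauli Q) = y * s := by
      refine Pauli.ext rfl ?_ ?_
      · change A p.x = y.x + s.x
        rw [hsx, ← add_assoc, ZModModule.add_self, zero_add]
        simp [A, p, Finsupp.linearCombination_apply, Finsupp.sum_fintype]
      · change B p.z = y.z + s.z
        rw [hsz, ← add_assoc, ZModModule.add_self, zero_add]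
        simp [B, p, Finsupp.linearCombination_apply, Finsupp.sum_fintype]
    change (QuotientGroup.mk (f p) : LogicalPauliGroup S) = QuotientGroup.mk _
    rw [eq_comm, QuotientGroup.eq, Subgroup.mem_subgroupOf]
    rw [Subgroup.coe_mul, hfp, Subgroup.coe_inv, inv_mul_cancel_left]
    exact hs

end Logical

/-! ## CSS measurement schedules -/

section CSS

variable {Q : Type}

/-- The indicator vector of a finite set of qubits. -/
noncomputable def indic (s : Finset Q) : Q →₀ ZMod 2 := ∑ q ∈ s, Finsupp.single q 1

/-- The span of the supports of the measurements in the basis `b`. -/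
noncomputable def measSpan (R : Set (Measurement Q)) (b : PauliBasis) :
    Submodule (ZMod 2) (Q →₀ ZMod 2) :=
  Submodule.span (ZMod 2) {v | ∃ m ∈ R, m.basis = b ∧ v = indic m.support}

/-- The measurements of a round commute. -/
def CommutingRound (R : Set (Measurement Q)) : Prop :=
  ∀ m ∈ R, ∀ m' ∈ R, m.basis = .X → m'.basis = .Z → dot (indic m.support) (indic m'.support) = 0

theorem CommutingRound.dot_eq_zero {R : Set (Measurement Q)} (hR : CommutingRound R)
    {u v : Q →₀ ZMod 2} (hu : u ∈ measSpan R .X) (hv : v ∈ measSpan R .Z) : dot u v = 0 := by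
  induction hu using Submodule.span_induction with
  | mem u hu =>
    obtain ⟨m, hm, hmb, rfl⟩ := hu
    induction hv using Submodule.span_induction with
    | mem v hv => obtain ⟨m', hm', hmb', rfl⟩ := hv; exact hR m hm m' hm' hmb hmb'
    | zero => exact dot_zero_right _
    | add a b _ _ ha hb => rw [dot_add_right, ha, hb, add_zero]
    | smul c a _ ha => rw [← dotForm_apply, map_smul, dotForm_apply, ha, smul_zero]
  | zero => exact dot_zero_left _
  | add a b _ _ ha hb => rw [dot_add_left, ha, hb, add_zero]
  | smul c a _ ha => rw [← dotForm_apply, map_smul, LinearMap.smul_apply, dotForm_apply, ha, smul_zero]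

/-- In normal form every product of the measured Paulis has phase 0, because the signs come from
overlaps of X-parts with Z-parts, which vanish in a commuting round. -/
theorem measGroup_phaseFree {R : Set (Measurement Q)} (hR : CommutingRound R) :
    PhaseFree (measGroup R) := by
  have key : ∀ p ∈ measGroup R, p.phase = 0 ∧ p.x ∈ measSpan R .X ∧ p.z ∈ measSpan R .Z := by
    intro p hp
    induction hp using Subgroup.closure_induction with
    | mem p hp =>
      obtain ⟨⟨b, s⟩, hm, rfl⟩ := hp
      cases b
      · exact ⟨rfl, Submodule.subset_span ⟨_, hm, rfl, rfl⟩, Submodule.zero_mem _⟩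
      · exact ⟨rfl, Submodule.zero_mem _, Submodule.subset_span ⟨_, hm, rfl, rfl⟩⟩
    | one => exact ⟨rfl, Submodule.zero_mem _, Submodule.zero_mem _⟩
    | mul p r _ _ hp hr =>
      refine ⟨?_, Submodule.add_mem _ hp.2.1 hr.2.1, Submodule.add_mem _ hp.2.2 hr.2.2⟩
      rw [mul_phase, hp.1, hr.1, dot_comm, hR.dot_eq_zero hr.2.1 hp.2.2, sgn_zero]; rfl
    | inv p _ hp =>
      refine ⟨?_, by rw [inv_x]; exact hp.2.1, by rw [inv_z]; exact hp.2.2⟩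
      change -(p.phase + sgn (dot (-p.z) p.x)) = 0
      rw [ZModModule.neg_eq_self p.z, dot_comm, hR.dot_eq_zero hp.2.1 hp.2.2, hp.1]; rfl
  intro p hp hv
  exact Pauli.ext (key p hp).1 (congrArg Prod.fst hv) (congrArg Prod.snd hv)

theorem vecs_measGroup (R : Set (Measurement Q)) :
    vecs (measGroup R) = (measSpan R .X).prod (measSpan R .Z) := by
  rw [measGroup, vecs_closure]
  apply le_antisymm
  · rw [Submodule.span_le]
    rintro _ ⟨_, ⟨⟨b, s⟩, hm, rfl⟩, rfl⟩
    cases b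
    · exact ⟨Submodule.subset_span ⟨_, hm, rfl, rfl⟩, Submodule.zero_mem _⟩
    · exact ⟨Submodule.zero_mem _, Submodule.subset_span ⟨_, hm, rfl, rfl⟩⟩
  · have h1 : measSpan R .X ≤ (Submodule.span (ZMod 2) (vec '' (Measurement.pauli '' R))).comap
        (LinearMap.inl (ZMod 2) _ _) := by
      rw [measSpan, Submodule.span_le]
      rintro _ ⟨⟨b, s⟩, hm, rfl, rfl⟩
      exact Submodule.subset_span ⟨_, ⟨_, hm, rfl⟩, rfl⟩
    have h2 : measSpan R .Z ≤ (Submodule.span (ZMod 2) (vec '' (Measurement.pauli '' R))).comap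
        (LinearMap.inr (ZMod 2) _ _) := by
      rw [measSpan, Submodule.span_le]
      rintro _ ⟨⟨b, s⟩, hm, rfl, rfl⟩
      exact Submodule.subset_span ⟨_, ⟨_, hm, rfl⟩, rfl⟩
    rintro ⟨x, z⟩ ⟨hx, hz⟩
    have h3 := h1 hx
    have h4 := h2 hz
    have h5 : (x, z) = (x, 0) + (0, z) := by simp
    rw [h5]
    exact Submodule.add_mem _ h3 h4

theorem prod_inf_sympPerp_prod (LX LZ MX MZ : Submodule (ZMod 2) (Q →₀ ZMod 2)) :
    LX.prod LZ ⊓ sympPerp (MX.prod MZ) = (LX ⊓ dotPerp MZ).prod (LZ ⊓ dotPerp MX) := by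
  ext ⟨x, z⟩
  simp only [Submodule.mem_inf, Submodule.mem_prod, mem_sympPerp, Prod.forall, mem_dotPerp]
  constructor
  · rintro ⟨⟨h1, h2⟩, h⟩
    refine ⟨⟨h1, fun w hw => ?_⟩, h2, fun w hw => ?_⟩
    · simpa [symp, dot_zero_right] using h 0 w ⟨MX.zero_mem, hw⟩
    · have := h w 0 ⟨hw, MZ.zero_mem⟩
      rw [dot_comm]
      simpa [symp, dot_zero_left] using this
  · rintro ⟨⟨h1, h2⟩, h3, h4⟩
    refine ⟨⟨h1, h3⟩, fun u w ⟨hu, hw⟩ => ?_⟩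
    simp [symp, h2 w hw, dot_comm z u, h4 u hu]

/-- The part in the basis `b` of the unsigned instantaneous stabilizer group. -/
noncomputable def cssGroup (R : ℤ → Set (Measurement Q)) (b : PauliBasis) :
    ℕ → Submodule (ZMod 2) (Q →₀ ZMod 2)
  | 0 => measSpan (R 0) b
  | t + 1 => (cssGroup R b t ⊓ dotPerp (measSpan (R (t + 1 : ℕ)) b.swap)) ⊔
      measSpan (R (t + 1 : ℕ)) b

/-- Since the update of the vectors only involves spans of a round, the choice of generators and
outcomes disappears, and the CSS form splits the recursion into two. -/
theorem isg_spec {R : ℤ → Set (Measurement Q)} (hR : ∀ t, CommutingRound (R t))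
    {gens : ℕ → List (Pauli Q)} (outcome : ℕ → Pauli Q → Bool)
    (hg : ∀ t : ℕ, Subgroup.closure {p | p ∈ gens t} = measGroup (R t)) (t : ℕ) :
    PhaseFree (isg gens outcome t) ∧
      vecs (isg gens outcome t) = (cssGroup R .X t).prod (cssGroup R .Z t) := by
  have hmem : ∀ t : ℕ, ∀ p ∈ gens t, p ∈ measGroup (R t) := fun t p hp => by
    rw [← hg]; exact Subgroup.subset_closure hp
  have hsq : ∀ t : ℕ, ∀ p ∈ gens t, p * p = 1 := fun t p hp =>
    (measGroup_phaseFree (hR t)).mul_self (hmem t p hp)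
  have hcomm : ∀ t : ℕ, ∀ p ∈ gens t, ∀ r ∈ gens t, p * r = r * p := fun t p hp r hr =>
    (measGroup_phaseFree (hR t)).commute (hmem t p hp) (hmem t r hr)
  have hspan : ∀ t : ℕ, Submodule.span (ZMod 2) (vec '' {p | p ∈ gens t}) =
      (measSpan (R t) .X).prod (measSpan (R t) .Z) := fun t => by
    rw [← vecs_closure, hg, vecs_measGroup]
  induction t with
  | zero =>
    have hbot : PhaseFree (⊥ : Subgroup (Pauli Q)) := fun p hp _ => Subgroup.mem_bot.1 hp
    obtain ⟨h1, h2⟩ := foldl_measure_spec (outcome 0) (gens 0) (hsq 0) (hcomm 0) hbot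
    refine ⟨h1, ?_⟩
    change vecs ((gens 0).foldl _ _) = _
    rw [h2, hspan]
    have : vecs (⊥ : Subgroup (Pauli Q)) = ⊥ := by
      rw [← Subgroup.closure_empty, vecs_closure, Set.image_empty, Submodule.span_empty]
    rw [this, bot_inf_eq, bot_sup_eq]
    rfl
  | succ t ih =>
    obtain ⟨h1, h2⟩ := foldl_measure_spec (outcome (t + 1)) (gens (t + 1)) (hsq _) (hcomm _) ih.1
    refine ⟨h1, ?_⟩
    change vecs ((gens (t + 1)).foldl _ _) = _
    rw [h2, hspan, ih.2, prod_inf_sympPerp_prod, Submodule.prod_sup_prod]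
    rfl

theorem finrank_submodule_prod [Finite Q] (L M : Submodule (ZMod 2) (Q →₀ ZMod 2)) :
    Module.finrank (ZMod 2) (L.prod M) = Module.finrank (ZMod 2) L + Module.finrank (ZMod 2) M := by
  let e : (L.prod M) ≃ₗ[ZMod 2] L × M :=
    { toFun := fun v => (⟨v.1.1, v.2.1⟩, ⟨v.1.2, v.2.2⟩)
      invFun := fun v => ⟨(v.1, v.2), v.1.2, v.2.2⟩
      map_add' := fun _ _ => rfl
      map_smul' := fun _ _ => rfl }
  rw [e.finrank_eq, Module.finrank_prod]

/-- This reduces every claim about encoded qubits to computing the dimensions of `cssGroup` in the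
two bases. -/
theorem encodesFrom_of_finrank [Finite Q] {M : ℤ → Subgroup (Pauli Q)}
    {R : ℤ → Set (Measurement Q)} (hM : ∀ t, M t = measGroup (R t))
    (hR : ∀ t, CommutingRound (R t)) {T k : ℕ}
    (hk : ∀ t, T ≤ t → Module.finrank (ZMod 2) (cssGroup R .X t) +
      Module.finrank (ZMod 2) (cssGroup R .Z t) + k = Nat.card Q) :
    EncodesFrom M T k := by
  refine ⟨fun t p hp r hr => ?_, fun gens outcome hg t ht => ?_⟩
  · rw [hM] at hp hr
    exact (measGroup_phaseFree (hR t)).commute hp hr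
  · obtain ⟨h1, h2⟩ := isg_spec hR outcome (fun t => (hg t).trans (hM t)) t
    refine ⟨?_, nonempty_logicalPauliGroup_equiv h1 h2 (hk t ht)⟩
    rw [rank_eq_finrank h1, h2, ← hk t ht, finrank_submodule_prod]

end CSS

/-! ## The colour code on a torus -/

theorem indic_apply {Q : Type} [DecidableEq Q] (s : Finset Q) (v : Q) :
    indic s v = if v ∈ s then 1 else 0 := by
  simp [indic, Finsupp.finsetSum_apply, Finsupp.single_apply]

theorem dot_indic {Q : Type} (s : Finset Q) (w : Q →₀ ZMod 2) :
    dot (indic s) w = ∑ q ∈ s, w q := dot_sum_single s w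

theorem ccBasis_add_two (r : ℤ) : ccBasis (r + 2) = ccBasis r := by
  simp [ccBasis]

theorem ccBasis_add_one (r : ℤ) : ccBasis (r + 1) = (ccBasis r).swap := by
  unfold ccBasis
  by_cases h : Even r <;> simp [h, PauliBasis.swap]

@[simp] theorem PauliBasis.swap_swap (b : PauliBasis) : b.swap.swap = b := by cases b <;> rfl

theorem PauliBasis.swap_ne (b : PauliBasis) : b.swap ≠ b := by cases b <;> simp [PauliBasis.swap]

theorem PauliBasis.eq_swap_of_ne {b c : PauliBasis} (h : b ≠ c) : b = c.swap := by
  cases b <;> cases c <;> simp_all [PauliBasis.swap]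

theorem PauliBasis.ne_swap (b : PauliBasis) : b ≠ b.swap := b.swap_ne.symm

theorem zmod_two_add_self (a : ZMod 2) : a + a = 0 := CharTwo.add_self_eq_zero a

theorem int_induction {P : ℤ → Prop} (h0 : P 0) (hs : ∀ n, P n → P (n + 1))
    (hp : ∀ n, P n → P (n - 1)) (n : ℤ) : P n :=
  Int.induction_on n h0 (fun i => hs i) (fun i => hp (-i))

section ToricCC

variable {A : Type} [AddCommGroup A] (e₁ e₂ : A)

/-- All faces of a torus are measured in the basis of the timestep. -/
def ccRound (r : ℤ) : Set (Measurement (A × Bool)) :=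
  {m | ∃ f : A, m = ⟨ccBasis r, hexagon e₁ e₂ f⟩}

/-- The sum of the hexagons of a set of faces. -/
noncomputable def faceSum : (A →₀ ZMod 2) →ₗ[ZMod 2] (A × Bool →₀ ZMod 2) :=
  Finsupp.linearCombination (ZMod 2) fun f => indic (hexagon e₁ e₂ f)

variable {e₁ e₂}

theorem sum_hexagon (h1 : e₁ ≠ 0) (h2 : e₂ ≠ 0) (h12 : e₁ ≠ e₂) (f : A) (w : A × Bool → ZMod 2) :
    ∑ v ∈ hexagon e₁ e₂ f, w v = w (f, false) + w (f - e₁, false) + w (f - e₂, false) +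
      w (f - e₁, true) + w (f - e₂, true) + w (f - e₁ - e₂, true) := by
  classical
  have n1 : f ≠ f - e₁ := fun h => h1 (by simpa using h.symm)
  have n2 : f ≠ f - e₂ := fun h => h2 (by simpa using h.symm)
  unfold hexagon
  rw [Finset.sum_insert, Finset.sum_insert, Finset.sum_insert, Finset.sum_insert,
    Finset.sum_insert, Finset.sum_singleton]
  · ring
  all_goals simp [h1, h2, h12, h12.symm, n1, n2, sub_sub]

theorem faceSum_apply (h1 : e₁ ≠ 0) (h2 : e₂ ≠ 0) (h12 : e₁ ≠ e₂) (u : A →₀ ZMod 2) (p : A) :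
    faceSum e₁ e₂ u (p, false) = u p + u (p + e₁) + u (p + e₂) ∧
    faceSum e₁ e₂ u (p, true) = u (p + e₁) + u (p + e₂) + u (p + e₁ + e₂) := by
  classical
  induction u using Finsupp.induction_linear with
  | zero => simp
  | add f g hf hg =>
    simp only [map_add, Finsupp.add_apply, hf, hg]
    constructor <;> ring
  | single f c =>
    obtain rfl | rfl := zmod_two_cases c
    · simp
    · simp only [faceSum, Finsupp.linearCombination_single, one_smul, indic_apply, hexagon,
        Finset.mem_insert, Finset.mem_singleton, Prod.mk.injEq, Finsupp.single_apply]
      constructor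
      · by_cases ha : p = f
        · subst ha; simp [h1, h2]
        · by_cases hb : p = f - e₁
          · subst hb; simp [h1, h12, sub_eq_add_neg, add_assoc, neg_add_eq_zero]
          · by_cases hc : p = f - e₂
            · subst hc; simp [h2, sub_eq_add_neg, add_assoc, h12.symm, neg_add_eq_zero]
            · have hb' : f ≠ p + e₁ := fun h => hb (by rw [h, add_sub_cancel_right])
              have hc' : f ≠ p + e₂ := fun h => hc (by rw [h, add_sub_cancel_right])
              simp [ha, hb, hc, hb', hc', Ne.symm ha]
      · by_cases ha : p = f - e₁
        · subst ha; simp [h2, sub_eq_add_neg, add_assoc, h12, neg_add_eq_zero]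
        · by_cases hb : p = f - e₂
          · subst hb
            have h3 : f ≠ f - e₂ + e₁ := fun h => h12 (by
              have : f - e₂ + e₁ = f + (e₁ - e₂) := by abel
              rw [this, left_eq_add, sub_eq_zero] at h; exact h)
            have h4 : f - e₂ + e₁ + e₂ = f + e₁ := by abel
            simp [h3, h4, h1]
          · by_cases hc : p = f - e₁ - e₂
            · subst hc
              have h3 : f - e₁ - e₂ + e₁ = f - e₂ := by abel
              have n1 : f ≠ f - e₁ := fun h => h1 (by simpa using h.symm)
              have n2 : f ≠ f - e₂ := fun h => h2 (by simpa using h.symm)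
              simp [h1, h2, h3, n1, n2]
            · have ha' : f ≠ p + e₁ := fun h => ha (by rw [h, add_sub_cancel_right])
              have hb' : f ≠ p + e₂ := fun h => hb (by rw [h, add_sub_cancel_right])
              have hc' : f ≠ p + e₁ + e₂ := fun h => hc (by rw [h]; abel)
              simp [ha, hb, hc, ha', hb', hc']

/-- The vertices of a hexagon see the hexagon itself six times and each neighbouring face twice, so
all contributions cancel. No assumption on the size of the torus beyond distinctness of the steps is
needed, since the cancellation is formal. -/
theorem dot_hexagon_faceSum (h1 : e₁ ≠ 0) (h2 : e₂ ≠ 0) (h12 : e₁ ≠ e₂) (f : A)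
    (u : A →₀ ZMod 2) : dot (indic (hexagon e₁ e₂ f)) (faceSum e₁ e₂ u) = 0 := by
  rw [dot_indic, sum_hexagon h1 h2 h12]
  simp only [faceSum_apply h1 h2 h12]
  have a1 : f - e₁ + e₁ = f := by abel
  have a2 : f - e₂ + e₂ = f := by abel
  have a3 : f - e₁ - e₂ + e₁ = f - e₂ := by abel
  have a4 : f - e₁ - e₂ + e₂ = f - e₁ := by abel
  rw [a1, a2, a3, a4, a2]
  have : f - e₂ + e₁ + e₂ = f + e₁ := by abel
  rw [this]
  have two : (2 : ZMod 2) = 0 := rfl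
  linear_combination two * (3 * u f + u (f + e₁) + u (f + e₂) + u (f - e₁) + u (f - e₁ + e₂) +
    u (f - e₂) + u (f - e₂ + e₁))

theorem measSpan_ccRound (r : ℤ) :
    measSpan (ccRound e₁ e₂ r) (ccBasis r) = LinearMap.range (faceSum e₁ e₂) := by
  rw [faceSum, Finsupp.range_linearCombination, measSpan]
  congr 1
  ext v
  constructor
  · rintro ⟨_, ⟨f, rfl⟩, -, rfl⟩; exact ⟨f, rfl⟩
  · rintro ⟨f, rfl⟩; exact ⟨_, ⟨f, rfl⟩, rfl, rfl⟩

theorem measSpan_ccRound_swap (r : ℤ) :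
    measSpan (ccRound e₁ e₂ r) (ccBasis r).swap = ⊥ := by
  rw [measSpan, Submodule.span_eq_bot]
  rintro _ ⟨_, ⟨f, rfl⟩, h, -⟩
  exact absurd h.symm (PauliBasis.swap_ne _)

theorem commutingRound_ccRound (r : ℤ) : CommutingRound (ccRound e₁ e₂ r) := by
  rintro _ ⟨f, rfl⟩ _ ⟨f', rfl⟩ h h'
  exact absurd (h.symm.trans h') (by simp)

theorem range_faceSum_le_dotPerp (h1 : e₁ ≠ 0) (h2 : e₂ ≠ 0) (h12 : e₁ ≠ e₂) :
    LinearMap.range (faceSum e₁ e₂) ≤ dotPerp (LinearMap.range (faceSum e₁ e₂)) := by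
  rintro _ ⟨u, rfl⟩
  rw [mem_dotPerp]
  intro w hw
  rw [faceSum, Finsupp.range_linearCombination] at hw
  induction hw using Submodule.span_induction with
  | mem w hw => obtain ⟨f, rfl⟩ := hw; exact dot_hexagon_faceSum h1 h2 h12 f u
  | zero => exact dot_zero_left _
  | add a b _ _ ha hb => rw [dot_add_left, ha, hb, add_zero]
  | smul c a _ ha =>
    rw [← dotForm_apply, map_smul, LinearMap.smul_apply, dotForm_apply, ha, smul_zero]

theorem dotPerp_bot {Q : Type} : dotPerp (⊥ : Submodule (ZMod 2) (Q →₀ ZMod 2)) = ⊤ := by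
  rw [eq_top_iff]
  intro v _
  rw [mem_dotPerp]
  intro w hw
  rw [(Submodule.mem_bot _).1 hw, dot_zero_left]

/-- Because the span of the hexagons is orthogonal to itself, a round in one basis destroys nothing
in the other. The Z-part is complete at time 0 and the X-part at time 1. -/
theorem cssGroup_ccRound (h1 : e₁ ≠ 0) (h2 : e₂ ≠ 0) (h12 : e₁ ≠ e₂) (t : ℕ) :
    cssGroup (ccRound e₁ e₂) .Z t = LinearMap.range (faceSum e₁ e₂) ∧
    cssGroup (ccRound e₁ e₂) .X (t + 1) = LinearMap.range (faceSum e₁ e₂) := by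
  set F := LinearMap.range (faceSum e₁ e₂) with hF
  have hperp : F ≤ dotPerp F := range_faceSum_le_dotPerp h1 h2 h12
  have step : ∀ (b : PauliBasis) (t : ℕ), cssGroup (ccRound e₁ e₂) b t ≤ F →
      cssGroup (ccRound e₁ e₂) b (t + 1) =
        if ccBasis (t + 1 : ℕ) = b then F else cssGroup (ccRound e₁ e₂) b t := by
    intro b t ht
    split_ifs with h
    · subst h
      change (_ ⊓ dotPerp (measSpan _ (ccBasis _).swap)) ⊔ measSpan _ (ccBasis _) = _
      rw [measSpan_ccRound, measSpan_ccRound_swap, dotPerp_bot, inf_top_eq, ← hF,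
        sup_eq_right.2 ht]
    · obtain rfl : b = (ccBasis (t + 1 : ℕ)).swap := PauliBasis.eq_swap_of_ne (Ne.symm h)
      change (_ ⊓ dotPerp (measSpan _ (ccBasis _).swap.swap)) ⊔ measSpan _ (ccBasis _).swap = _
      rw [PauliBasis.swap_swap, measSpan_ccRound, measSpan_ccRound_swap, ← hF, sup_bot_eq,
        inf_eq_left.2 (ht.trans hperp)]
  have hZ0 : cssGroup (ccRound e₁ e₂) .Z 0 = F := measSpan_ccRound 0
  have hX0 : cssGroup (ccRound e₁ e₂) .X 0 = ⊥ := measSpan_ccRound_swap 0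
  induction t with
  | zero =>
    refine ⟨hZ0, ?_⟩
    rw [step .X 0 (by rw [hX0]; exact bot_le)]
    rfl
  | succ t ih =>
    refine ⟨?_, ?_⟩
    · rw [step .Z t ih.1.le, ih.1, ite_self]
    · rw [step .X (t + 1) ih.2.le, ih.2, ite_self]

/-- The relations between the hexagons form a plane if the torus is three-colourable. -/
theorem finrank_ker_faceSum [Finite A] (h1 : e₁ ≠ 0) (h2 : e₂ ≠ 0) (h12 : e₁ ≠ e₂)
    (hgen : ∀ a : A, ∃ m n : ℤ, a = m • e₁ + n • e₂) (χ : A →+ ZMod 3) (hχ1 : χ e₁ = 1)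
    (hχ2 : χ e₂ = 2) :
    Module.finrank (ZMod 2) (LinearMap.ker (faceSum e₁ e₂)) = 2 := by
  have hker : ∀ u, u ∈ LinearMap.ker (faceSum e₁ e₂) ↔
      ∀ p, u p + u (p + e₁) + u (p + e₂) = 0 ∧ u (p + e₁) + u (p + e₂) + u (p + e₁ + e₂) = 0 := by
    intro u
    rw [LinearMap.mem_ker]
    constructor
    · intro h p
      rw [← (faceSum_apply h1 h2 h12 u p).1, ← (faceSum_apply h1 h2 h12 u p).2, h]
      simp
    · intro h
      ext ⟨p, k⟩
      cases k
      · rw [(faceSum_apply h1 h2 h12 u p).1, (h p).1]; rfl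
      · rw [(faceSum_apply h1 h2 h12 u p).2, (h p).2]; rfl
  let ev : LinearMap.ker (faceSum e₁ e₂) →ₗ[ZMod 2] ZMod 2 × ZMod 2 :=
    { toFun := fun u => (u.1 0, u.1 e₁)
      map_add' := fun _ _ => rfl
      map_smul' := fun _ _ => rfl }
  have hbij : Function.Bijective ev := by
    constructor
    · rw [← LinearMap.ker_eq_bot, LinearMap.ker_eq_bot']
      rintro ⟨u, hu⟩ h
      have hu' := (hker u).1 hu
      have h0 : u 0 = 0 := congrArg Prod.fst h
      have he : u e₁ = 0 := congrArg Prod.snd h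
      -- The two triangles on a common edge have the same edge sum, so their opposite corners agree.
      -- Hence `u` is constant along `e₁ + e₂` and satisfies a three-term recursion along `e₁`, and
      -- `u 0` and `u e₁` determine it.
      have hper : ∀ p, u (p + e₁ + e₂) = u p := fun p => by
        linear_combination (hu' p).2 - (hu' p).1
      have htri : ∀ p, u p + u (p + e₁) + u (p + e₁ + e₁) = 0 := fun p => by
        have := (hu' (p + e₁)).1
        rw [hper] at this
        linear_combination this
      have hline : ∀ p, u p = 0 ∧ u (p + e₁) = 0 → ∀ m : ℤ,
          u (p + m • e₁) = 0 ∧ u (p + m • e₁ + e₁) = 0 := by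
        intro p hp m
        induction m using int_induction with
        | h0 => simpa using hp
        | hs n ih =>
          have := htri (p + n • e₁)
          rw [ih.1, ih.2, zero_add, zero_add] at this
          rw [add_smul, one_smul, ← add_assoc]
          exact ⟨ih.2, this⟩
        | hp n ih =>
          have h3 := htri (p + (n - 1) • e₁)
          have h4 : p + (n - 1) • e₁ + e₁ = p + n • e₁ := by rw [sub_smul, one_smul]; abel
          rw [h4, ih.1, ih.2, add_zero, add_zero] at h3
          exact ⟨h3, by rw [h4]; exact ih.1⟩
      have hdiag : ∀ (n : ℤ) p, u (p + n • (e₁ + e₂)) = u p := by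
        intro n
        induction n using int_induction with
        | h0 => simp
        | hs n ih =>
          intro p
          rw [add_smul, one_smul, ← add_assoc, ← add_assoc, hper, ih]
        | hp n ih =>
          intro p
          rw [← ih p, ← hper (p + (n - 1) • (e₁ + e₂)), sub_smul, one_smul]
          congr 1; abel
      refine Subtype.ext (Finsupp.ext fun a => ?_)
      obtain ⟨m, n, rfl⟩ := hgen a
      have h3 : m • e₁ + n • e₂ = 0 + (m - n) • e₁ + n • (e₁ + e₂) := by
        rw [sub_smul, smul_add]; abel
      rw [h3, hdiag]
      exact (hline 0 (by simp [h0, he]) _).1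
    · rintro ⟨α, β⟩
      -- A function of the colour only, whose values on the three colours sum to zero; every
      -- triangle contains each colour once.
      let f : ZMod 3 → ZMod 2 := ![α, β, α + β]
      have hf : ∀ x, f x + f (x + 1) + f (x + 2) = 0 := by
        intro x
        fin_cases x
        · change α + β + (α + β) = 0
          exact zmod_two_add_self _
        · change β + (α + β) + α = 0
          linear_combination zmod_two_add_self (α + β)
        · change α + β + α + β = 0
          linear_combination zmod_two_add_self (α + β)
      let u : A →₀ ZMod 2 := Finsupp.equivFunOnFinite.symm fun a => f (χ a)
      refine ⟨⟨u, (hker u).2 fun p => ?_⟩, ?_⟩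
      · have h3 : χ p + 1 + 2 = χ p := by
          rw [add_assoc, show (1 : ZMod 3) + 2 = 0 from rfl, add_zero]
        simp only [u, Finsupp.equivFunOnFinite_symm_apply_apply, map_add, hχ1, hχ2, h3]
        exact ⟨hf _, by rw [← hf (χ p)]; ring⟩
      · change (f (χ 0), f (χ e₁)) = (α, β)
        rw [map_zero, hχ1]
        rfl
  rw [(LinearEquiv.ofBijective ev hbij).finrank_eq]
  simp

theorem ccRound_hasPeriod_two :
    HasPeriod (fun r => measGroup (ccRound e₁ e₂ r)) 2 := by
  classical
  refine ⟨two_pos, fun t => ?_, fun p hp hp2 => ⟨0, fun h => ?_⟩⟩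
  · have : ccRound e₁ e₂ (t + (2 : ℕ)) = ccRound e₁ e₂ t := by
      unfold ccRound
      rw [Nat.cast_ofNat, ccBasis_add_two]
    simp only [this]
  · obtain rfl : p = 1 := by omega
    have h' := congrArg vecs h
    simp only [vecs_measGroup] at h'
    have hmem : ((0, indic (hexagon e₁ e₂ 0)) : (A × Bool →₀ ZMod 2) × (A × Bool →₀ ZMod 2)) ∈
        (measSpan (ccRound e₁ e₂ 0) .X).prod (measSpan (ccRound e₁ e₂ 0) .Z) :=
      ⟨Submodule.zero_mem _, Submodule.subset_span ⟨_, ⟨0, rfl⟩, rfl, rfl⟩⟩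
    rw [← h'] at hmem
    have h3 : measSpan (ccRound e₁ e₂ (0 + (1 : ℕ))) .Z = ⊥ := measSpan_ccRound_swap 1
    have h4 : indic (hexagon e₁ e₂ 0) ∈ measSpan (ccRound e₁ e₂ (0 + (1 : ℕ))) .Z := hmem.2
    rw [h3, Submodule.mem_bot] at h4
    have h5 := DFunLike.congr_fun h4 (0, false)
    rw [indic_apply] at h5
    simp [hexagon] at h5

/-- With `n` faces there are `2 n` qubits, and each basis contributes rank `n - 2`. -/
theorem toricCC_encodesFrom [Finite A] (h1 : e₁ ≠ 0) (h2 : e₂ ≠ 0) (h12 : e₁ ≠ e₂)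
    (hgen : ∀ a : A, ∃ m n : ℤ, a = m • e₁ + n • e₂) (χ : A →+ ZMod 3) (hχ1 : χ e₁ = 1)
    (hχ2 : χ e₂ = 2) :
    EncodesFrom (fun r => measGroup (ccRound e₁ e₂ r)) 1 4 := by
  have := Fintype.ofFinite A
  refine encodesFrom_of_finrank (R := ccRound e₁ e₂) (fun _ => rfl) commutingRound_ccRound
    fun t ht => ?_
  obtain ⟨t, rfl⟩ := Nat.exists_eq_add_of_le' ht
  rw [(cssGroup_ccRound h1 h2 h12 t).2, (cssGroup_ccRound h1 h2 h12 (t + 1)).1]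
  have h3 := LinearMap.finrank_range_add_finrank_ker (faceSum e₁ e₂)
  rw [finrank_ker_faceSum h1 h2 h12 hgen χ hχ1 hχ2, Module.finrank_finsupp_self] at h3
  rw [Nat.card_eq_fintype_card, Fintype.card_prod, Fintype.card_bool]
  omega

end ToricCC

theorem toricCC (Λ : AddSubgroup (ℤ × ℤ)) (hfin : Λ.FiniteIndex)
    (hΛ : ∀ p ∈ Λ, (3 : ℤ) ∣ p.1 - p.2) :
    HasPeriod (toricCCSchedule Λ) 2 ∧ EncodesFrom (toricCCSchedule Λ) 1 4 := by
  -- The three-colouring of the faces by `i - j`.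
  let φ : ℤ × ℤ →+ ZMod 3 :=
    (Int.castAddHom (ZMod 3)).comp (AddMonoidHom.fst ℤ ℤ - AddMonoidHom.snd ℤ ℤ)
  let χ : (ℤ × ℤ) ⧸ Λ →+ ZMod 3 := QuotientAddGroup.lift Λ φ fun p hp => by
    change ((p.1 - p.2 : ℤ) : ZMod 3) = 0
    exact (ZMod.intCast_zmod_eq_zero_iff_dvd _ 3).2 (hΛ p hp)
  have hχ1 : χ (((1, 0) : ℤ × ℤ) : (ℤ × ℤ) ⧸ Λ) = 1 := by
    change ((1 - 0 : ℤ) : ZMod 3) = 1; rfl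
  have hχ2 : χ (((0, 1) : ℤ × ℤ) : (ℤ × ℤ) ⧸ Λ) = 2 := by
    change ((0 - 1 : ℤ) : ZMod 3) = 2; rfl
  have h1 : (((1, 0) : ℤ × ℤ) : (ℤ × ℤ) ⧸ Λ) ≠ 0 := fun h => by
    rw [h, map_zero] at hχ1; exact absurd hχ1 (by decide)
  have h2 : (((0, 1) : ℤ × ℤ) : (ℤ × ℤ) ⧸ Λ) ≠ 0 := fun h => by
    rw [h, map_zero] at hχ2; exact absurd hχ2 (by decide)
  have h12 : (((1, 0) : ℤ × ℤ) : (ℤ × ℤ) ⧸ Λ) ≠ ((0, 1) : ℤ × ℤ) := fun h => by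
    rw [h, hχ2] at hχ1; exact absurd hχ1 (by decide)
  have := AddSubgroup.finite_quotient_of_finiteIndex (H := Λ)
  refine ⟨ccRound_hasPeriod_two, toricCC_encodesFrom h1 h2 h12 (fun a => ?_) χ hχ1 hχ2⟩
  obtain ⟨⟨m, n⟩, rfl⟩ := QuotientAddGroup.mk_surjective a
  refine ⟨m, n, ?_⟩
  rw [← QuotientAddGroup.mk_zsmul, ← QuotientAddGroup.mk_zsmul, ← QuotientAddGroup.mk_add]
  simp

/-! ## The schedule in the bulk -/

/-- The residue that governs a qubit of the square lattice. -/
def siteClass : Site →+ ZMod 26 where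
  toFun q := ((q.1 - 3 * q.2 : ℤ) : ZMod 26)
  map_zero' := by simp
  map_add' p q := by push_cast [Prod.fst_add, Prod.snd_add]; ring

/-- The residue that governs a qubit at time `t`. It determines its phase and its parity. -/
def stClass (q : Site) (t : ℤ) : ZMod 26 := siteClass q + ((-8 * t : ℤ) : ZMod 26)

/-- The phase of a residue. -/
def phaseK (k : ZMod 26) : ZMod 13 := ((8 * k.val : ℕ) : ZMod 13)

/-- The displacement to the partner, as a function of the residue. -/
def partnerK (k : ZMod 26) : Option Site := partnerAt (phaseK k)

/-- The basis, as a function of the residue. -/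
def basisK (k : ZMod 26) : PauliBasis :=
  if Even k.val then basisAt (phaseK k) else (basisAt (phaseK k)).swap

theorem phaseK_intCast (n : ℤ) : phaseK (n : ZMod 26) = ((8 * n : ℤ) : ZMod 13) := by
  have h1 : ((n : ZMod 26).val : ℤ) = n % 26 := ZMod.val_intCast (n := 26) n
  have h2 : (phaseK (n : ZMod 26)) = ((8 * (n % 26) : ℤ) : ZMod 13) := by
    rw [← h1, phaseK]; push_cast; rfl
  rw [h2, ZMod.intCast_eq_intCast_iff_dvd_sub]
  have := Int.emod_add_mul_ediv n 26
  exact ⟨16 * (n / 26), by push_cast; omega⟩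

theorem even_val_intCast (n : ℤ) : Even (n : ZMod 26).val ↔ Even n := by
  have h1 : ((n : ZMod 26).val : ℤ) = n % 26 := ZMod.val_intCast (n := 26) n
  rw [← Int.even_coe_nat, h1, Int.even_iff, Int.even_iff]
  omega

theorem stClass_eq_cast (q : Site) (t : ℤ) :
    stClass q t = ((q.1 - 3 * q.2 - 8 * t : ℤ) : ZMod 26) := by
  simp only [stClass, siteClass, AddMonoidHom.coe_mk, ZeroHom.coe_mk]
  push_cast; ring

/-- Modulo 13 one has `8 * (-3) = 2` and `8 * (-8) = 1`, so eight times the residue is `t + 8 x + 2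
y`. -/
theorem phaseOf_eq (q : Site) (t : ℤ) : phaseOf q t = phaseK (stClass q t) := by
  rw [stClass_eq_cast, phaseK_intCast, phaseOf, ZMod.intCast_eq_intCast_iff_dvd_sub]
  exact ⟨-2 * q.2 - 5 * t, by push_cast; ring⟩

theorem partner_eq (q : Site) (t : ℤ) : partner q t = partnerK (stClass q t) := by
  rw [partner, phaseOf_eq, partnerK]

theorem basis_eq (q : Site) (t : ℤ) : basis q t = basisK (stClass q t) := by
  rw [basis, phaseOf_eq, basisK]
  have : Even (q.1 + q.2) ↔ Even (stClass q t).val := by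
    rw [stClass_eq_cast, even_val_intCast]
    simp only [Int.even_iff]
    omega
  simp only [this]

theorem stClass_add (q d : Site) (t : ℤ) : stClass (q + d) t = stClass q t + siteClass d := by
  rw [stClass, map_add, stClass]; ring

theorem stClass_add_time (q d : Site) (t n : ℤ) :
    stClass (q + d) (t + n) = stClass q t + stClass d n := by
  simp only [stClass, map_add]; push_cast; ring

/-- Adding 13 keeps the residue modulo 13, hence the phase, and flips the parity. -/
theorem basisK_add_thirteen (k : ZMod 26) : basisK (k + 13) = (basisK k).swap := by
  revert k; decide

theorem partnerK_add_thirteen (k : ZMod 26) : partnerK (k + 13) = partnerK k := by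
  revert k; decide

/-- This is the consistency of the schedule: the partner points back and is measured in the same
basis. -/
theorem partnerK_spec (k : ZMod 26) (d : Site) (h : partnerK k = some d) :
    partnerK (k + siteClass d) = some (-d) ∧ basisK (k + siteClass d) = basisK k ∧
      (d = (1, 0) ∨ d = (-1, 0) ∨ d = (0, 1) ∨ d = (0, -1)) := by
  have key : ∀ k, ∀ d ∈ partnerK k, partnerK (k + siteClass d) = some (-d) ∧
      basisK (k + siteClass d) = basisK k ∧
      (d = (1, 0) ∨ d = (-1, 0) ∨ d = (0, 1) ∨ d = (0, -1)) := by decide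
  exact key k d h

theorem partner_spec {q d : Site} {t : ℤ} (h : partner q t = some d) :
    partner (q + d) t = some (-d) ∧ basis (q + d) t = basis q t ∧
      (d = (1, 0) ∨ d = (-1, 0) ∨ d = (0, 1) ∨ d = (0, -1)) := by
  rw [partner_eq] at h
  rw [partner_eq, basis_eq, basis_eq, stClass_add]
  exact partnerK_spec _ _ h

theorem measAt_of_none {q : Site} {t : ℤ} (h : partner q t = none) :
    measAt q t = ⟨basis q t, {q}⟩ := by
  simp only [measAt, h]

theorem measAt_of_some {q d : Site} {t : ℤ} (h : partner q t = some d) :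
    measAt q t = ⟨basis q t, {q, q + d}⟩ := by
  simp only [measAt, h]

theorem measAt_add_partner {q d : Site} {t : ℤ} (h : partner q t = some d) :
    measAt (q + d) t = measAt q t := by
  obtain ⟨h1, h2, -⟩ := partner_spec h
  rw [measAt_of_some h, measAt_of_some h1, h2, add_neg_cancel_right, Finset.pair_comm]

theorem basis_translate {d : Site} {n : ℤ} (h : stClass d n = 0) (q : Site) (t : ℤ) :
    basis (q + d) (t + n) = basis q t := by
  rw [basis_eq, basis_eq, stClass_add_time, h, add_zero]

theorem partner_translate {d : Site} {n : ℤ} (h : stClass d n = 0) (q : Site) (t : ℤ) :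
    partner (q + d) (t + n) = partner q t := by
  rw [partner_eq, partner_eq, stClass_add_time, h, add_zero]

theorem basis_translate_swap {d : Site} {n : ℤ} (h : stClass d n = 13) (q : Site) (t : ℤ) :
    basis (q + d) (t + n) = (basis q t).swap := by
  rw [basis_eq, basis_eq, stClass_add_time, h, basisK_add_thirteen]

theorem partner_translate_swap {d : Site} {n : ℤ} (h : stClass d n = 13) (q : Site) (t : ℤ) :
    partner (q + d) (t + n) = partner q t := by
  rw [partner_eq, partner_eq, stClass_add_time, h, partnerK_add_thirteen]

theorem measAt_translate {d : Site} {n : ℤ} (h : stClass d n = 0) (q : Site) (t : ℤ) :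
    measAt (q + d) (t + n) = (measAt q t).map (· + d) := by
  classical
  unfold measAt Measurement.map
  rw [basis_translate h, partner_translate h]
  ext1
  · rfl
  · rcases partner q t with _ | e
    · simp
    · simp only [Finset.image_insert, Finset.image_singleton, add_right_comm]
      congr!

theorem measAt_translate_swap {d : Site} {n : ℤ} (h : stClass d n = 13) (q : Site) (t : ℤ) :
    measAt (q + d) (t + n) = ((measAt q t).map (· + d)).swap := by
  classical
  unfold measAt Measurement.map Measurement.swap
  rw [basis_translate_swap h, partner_translate_swap h]
  ext1
  · rfl
  · rcases partner q t with _ | e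
    · simp
    · simp only [Finset.image_insert, Finset.image_singleton, add_right_comm]
      congr!

theorem bulkRound_translate {d : Site} {n : ℤ} (h : stClass d n = 0) (t : ℤ) :
    bulkRound (t + n) = (fun m => m.map (· + d)) '' bulkRound t := by
  unfold bulkRound
  rw [← Set.range_comp, ← (Equiv.addRight d).surjective.range_comp]
  congr 1
  funext q
  exact measAt_translate h q t

theorem bulkRound_translate_swap {d : Site} {n : ℤ} (h : stClass d n = 13) (t : ℤ) :
    bulkRound (t + n) = (fun m => (m.map (· + d)).swap) '' bulkRound t := by
  unfold bulkRound
  rw [← Set.range_comp, ← (Equiv.addRight d).surjective.range_comp]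
  congr 1
  funext q
  exact measAt_translate_swap h q t

theorem bulkRound_add_thirteen (t : ℤ) : bulkRound (t + 13) = bulkRound t := by
  unfold bulkRound
  congr 1
  funext q
  have h1 : stClass (0 : Site) 13 = 0 := by decide
  have h2 := basis_translate h1 q t
  have h3 := partner_translate h1 q t
  rw [add_zero] at h2 h3
  unfold measAt
  rw [h2, h3]

theorem partner_zero_ne_none (p : ℕ) (hp : 0 < p) (hp' : p < 13) : partner 0 p ≠ none := by
  interval_cases p <;> decide

/-- The origin is measured alone at time 0 and has a partner at each of the times 1 to 12, which
excludes every smaller period. -/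
theorem bulkRound_hasPeriod : HasPeriod bulkRound 13 := by
  refine ⟨by norm_num, bulkRound_add_thirteen, fun p hp hp' => ⟨0, fun h => ?_⟩⟩
  have h0 : partner 0 0 = none := by decide
  have hm : measAt 0 0 ∈ bulkRound (0 + p) := by rw [h]; exact ⟨0, rfl⟩
  obtain ⟨q, hq⟩ := hm
  rw [zero_add, measAt_of_none h0] at hq
  dsimp only at hq
  have hne := partner_zero_ne_none p hp hp'
  rcases hd : partner q p with _ | d
  · rw [measAt_of_none hd] at hq
    have h1 : q = 0 := Finset.singleton_injective (congrArg Measurement.support hq)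
    exact hne (h1 ▸ hd)
  · rw [measAt_of_some hd] at hq
    have h1 := congrArg Measurement.support hq
    dsimp only at h1
    have h2 : q ∈ ({0} : Finset Site) := h1 ▸ Finset.mem_insert_self _ _
    have h3 : q + d ∈ ({0} : Finset Site) :=
      h1 ▸ Finset.mem_insert_of_mem (Finset.mem_singleton_self _)
    rw [Finset.mem_singleton] at h2 h3
    rw [h2, zero_add] at h3
    have := (partner_spec hd).2.2
    rw [h3] at this
    exact absurd this (by decide)

theorem bulk_schedule :
    (∀ t, ∀ m ∈ bulkRound t,
      (∃ q, m.support = {q}) ∨ ∃ p q, Adjacent p q ∧ m.support = {p, q}) ∧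
    (∀ t q, ∃! m, m ∈ bulkRound t ∧ q ∈ m.support) ∧
    HasPeriod bulkRound 13 ∧
    (∀ t,
      bulkRound (t - 2) = (fun m => (m.map (· + (0, 1))).swap) '' bulkRound t ∧
      bulkRound (t - 8) = (fun m => (m.map (· + (1, 0))).swap) '' bulkRound t ∧
      bulkRound t = (fun m => m.map (· + (3, 1))) '' bulkRound t ∧
      bulkRound t = (fun m => m.map (· + (-2, 8))) '' bulkRound t ∧
      bulkRound (t + 1) = (fun m => m.map (· + (-1, -3))) '' bulkRound t) := by
  refine ⟨?_, ?_, bulkRound_hasPeriod, fun t => ⟨?_, ?_, ?_, ?_, ?_⟩⟩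
  · rintro t _ ⟨q, rfl⟩
    dsimp only
    rcases hd : partner q t with _ | d
    · exact Or.inl ⟨q, by rw [measAt_of_none hd]⟩
    · refine Or.inr ⟨q, q + d, ?_, by rw [measAt_of_some hd]⟩
      rw [Adjacent, add_sub_cancel_left]
      exact (partner_spec hd).2.2
  · intro t q
    refine ⟨measAt q t, ⟨⟨q, rfl⟩, ?_⟩, ?_⟩
    · rcases hd : partner q t with _ | d
      · rw [measAt_of_none hd]; simp
      · rw [measAt_of_some hd]; simp
    · rintro _ ⟨⟨q', rfl⟩, hq⟩
      dsimp only at hq ⊢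
      rcases hd : partner q' t with _ | d
      · rw [measAt_of_none hd] at hq
        rw [Finset.mem_singleton.1 hq]
      · rw [measAt_of_some hd] at hq
        rcases Finset.mem_insert.1 hq with rfl | hq
        · rfl
        · rw [Finset.mem_singleton.1 hq, measAt_add_partner hd]
  · exact bulkRound_translate_swap (d := (0, 1)) (n := -2) (by decide) t
  · exact bulkRound_translate_swap (d := (1, 0)) (n := -8) (by decide) t
  · simpa using bulkRound_translate (d := (3, 1)) (n := 0) (by decide) t
  · simpa using bulkRound_translate (d := (-2, 8)) (n := 0) (by decide) t
  · exact bulkRound_translate (d := (-1, -3)) (n := 1) (by decide) t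

/-! ## Stencils -/

/-- Every entry of the list occurs an even number of times. -/
def EvenList (L : List Site) : Prop := ∀ x ∈ L, Even (L.count x)

instance (L : List Site) : Decidable (EvenList L) :=
  inferInstanceAs (Decidable (∀ x ∈ L, Even (L.count x)))

/-- The stencils `T`, transported by the displacements in `V`, as seen from a qubit of class `k`. -/
def combine (T : ZMod 26 → List Site) (k : ZMod 26) (V : List Site) : List Site :=
  V.flatMap fun v => (T (k + siteClass v)).map (v + ·)

section Stencil

variable {Q : Type} [AddCommGroup Q] (mk : Site →+ Q) (cls : Q →+ ZMod 26)

/-- The sum of `f` over the displacements of `q` by the entries of a list. -/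
def lsum (L : List Site) (f : Q → ZMod 2) (q : Q) : ZMod 2 := (L.map fun d => f (q + mk d)).sum

@[simp] theorem lsum_nil (f : Q → ZMod 2) (q : Q) : lsum mk [] f q = 0 := rfl

@[simp] theorem lsum_cons (d : Site) (L : List Site) (f : Q → ZMod 2) (q : Q) :
    lsum mk (d :: L) f q = f (q + mk d) + lsum mk L f q := by
  simp [lsum]

theorem lsum_append (L L' : List Site) (f : Q → ZMod 2) (q : Q) :
    lsum mk (L ++ L') f q = lsum mk L f q + lsum mk L' f q := by
  simp [lsum]

theorem lsum_add (L : List Site) (f g : Q → ZMod 2) (q : Q) :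
    lsum mk L (f + g) q = lsum mk L f q + lsum mk L g q := by
  simp [lsum, List.sum_map_add]

theorem lsum_smul (L : List Site) (c : ZMod 2) (f : Q → ZMod 2) (q : Q) :
    lsum mk L (c • f) q = c • lsum mk L f q := by
  induction L with
  | nil => simp
  | cons d L ih => simp [ih, mul_add]

theorem lsum_congr {L : List Site} {f g : Q → ZMod 2} {q : Q}
    (h : ∀ d ∈ L, f (q + mk d) = g (q + mk d)) : lsum mk L f q = lsum mk L g q := by
  unfold lsum
  rw [List.map_congr_left h]

theorem lsum_filter (L : List Site) (P : Site → Prop) [DecidablePred P] {f g : Q → ZMod 2} {q : Q}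
    (h : ∀ d ∈ L, g (q + mk d) = if P d then f (q + mk d) else 0) :
    lsum mk (L.filter P) f q = lsum mk L g q := by
  induction L with
  | nil => rfl
  | cons d L ih =>
    have ih' := ih fun e he => h e (List.mem_cons_of_mem _ he)
    have hd := h d List.mem_cons_self
    by_cases hP : P d
    · rw [if_pos hP] at hd
      rw [List.filter_cons_of_pos (by simpa using hP), lsum_cons, lsum_cons, hd, ih']
    · rw [if_neg hP] at hd
      rw [List.filter_cons_of_neg (by simpa using hP), lsum_cons, hd, ih', zero_add]

theorem lsum_map_add (L : List Site) (v : Site) (f : Q → ZMod 2) (q : Q) :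
    lsum mk (L.map (v + ·)) f q = lsum mk L f (q + mk v) := by
  simp [lsum, Function.comp_def, add_assoc]

/-- The identity is formal in the displacements, so it also holds on quotients where different
displacements become equal. -/
theorem lsum_eq_zero {L : List Site} (h : EvenList L) (f : Q → ZMod 2) (q : Q) :
    lsum mk L f q = 0 := by
  unfold lsum
  rw [Finset.sum_list_map_count]
  refine Finset.sum_eq_zero fun x hx => ?_
  have hx' := h x (List.mem_toFinset.1 hx)
  rw [nsmul_eq_mul, (ZMod.natCast_eq_zero_iff_even).2 (by convert hx'), zero_mul]

variable {mk cls}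

/-- A combination of values of a stencil is the sum over the combined list. -/
theorem lsum_combine (hc : ∀ s, cls (mk s) = siteClass s) (T : ZMod 26 → List Site) (κ : ZMod 26)
    (V : List Site) (f : Q → ZMod 2) (q : Q) :
    lsum mk (combine T (cls q + κ) V) f q =
      lsum mk V (fun r => lsum mk (T (cls r + κ)) f r) q := by
  induction V with
  | nil => rfl
  | cons v V ih =>
    rw [lsum_cons, ← ih, combine, List.flatMap_cons, lsum_append, lsum_map_add, map_add, hc,
      add_right_comm]
    rfl

/-- Certificates work through this: adding up the equations of a stencil at the positions `V` yields
the equation `E` as soon as all other terms pair off. -/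
theorem lsum_eq_lsum_of_evenList (hc : ∀ s, cls (mk s) = siteClass s) {T : ZMod 26 → List Site}
    {κ : ZMod 26} {V E : List Site} {q : Q} (h : EvenList (combine T (cls q + κ) V ++ E))
    (f : Q → ZMod 2) :
    lsum mk V (fun r => lsum mk (T (cls r + κ)) f r) q = lsum mk E f q := by
  have := lsum_eq_zero mk h f q
  rw [lsum_append, lsum_combine hc] at this
  exact zmod_two_add_eq_zero.1 this

end Stencil

/-- The detecting regions that contain a world-line of the given class: the displacements to their
reference qubits. -/
def regionStencil (k : ZMod 26) : List Site :=
  match k.val with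
  | 1 => [(-2, 1), (0, -1), (1, 0)]
  | 2 => [(-1, -1), (0, 0), (2, 0)]
  | 3 => [(-2, -1), (-1, 0), (1, 0)]
  | 4 => [(-2, 0), (0, 0), (2, 0)]
  | 5 => [(-1, 0), (1, 0), (2, 1)]
  | 6 => [(-2, 0), (0, 0), (1, 1)]
  | 7 => [(-1, 0), (0, 1), (2, -1)]
  | 9 => [(0, -1), (0, 1)]
  | 10 => [(-1, -1), (-1, 1)]
  | 11 => [(-2, -1), (0, -1), (1, 0)]
  | 12 => [(-1, -1), (0, 0), (2, 0)]
  | 13 => [(-1, 0), (1, 0), (2, 1)]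
  | 14 => [(-2, 0), (0, 0), (1, 1)]
  | 15 => [(-1, 0), (0, 1), (2, 1)]
  | 16 => [(1, -1), (1, 1)]
  | 17 => [(0, -1), (0, 1)]
  | 18 => [(-1, -1), (-1, 1)]
  | 19 => [(-2, -1), (0, -1), (1, 0)]
  | 20 => [(-1, -1), (0, 0), (2, 0)]
  | 21 => [(-2, -1), (-1, 0), (1, 0)]
  | 22 => [(-2, 0), (0, 0), (1, 1)]
  | 23 => [(-1, 0), (0, 1), (2, 1)]
  | 24 => [(1, -1), (1, 1)]
  | 25 => [(0, -1), (0, 1)]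
  | _ => []

/-- The age of the region whose reference qubit has the given class (7 if there is none). -/
def regionAge (k : ZMod 26) : ℕ :=
  match k.val with
  | 2 => 0
  | 20 => 1
  | 12 => 2
  | 4 => 3
  | 22 => 4
  | 14 => 5
  | 6 => 6
  | _ => 7

/-- The displacement from a measured qubit to the qubit that labels its measurement. -/
def labelStencil (k : ZMod 26) : List Site :=
  match k.val with
  | 1 => [(0, 1)]
  | 2 => [(0, 0)]
  | 3 => [(0, 1)]
  | 4 => [(-1, 1)]
  | 7 => [(1, 0)]
  | 8 => [(0, 0)]
  | 13 => [(0, 1)]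
  | 18 => [(0, 0)]
  | 19 => [(-1, 0)]
  | 22 => [(0, 2)]
  | 23 => [(-1, 2)]
  | 24 => [(0, 0)]
  | 25 => [(0, -1)]
  | _ => []

/-- The displacement from a label to a qubit of the measurement that it labels. -/
def unlabel (k : ZMod 26) : Site :=
  match k.val with
  | 0 => (1, -1)
  | 16 => (0, -2)
  | 10 => (0, -1)
  | _ => 0

/-- The stencil of the parametrisation of the stabilizers by the qubits of even class. -/
def fullStencil (k : ZMod 26) : List Site :=
  (regionStencil k).filter (fun d => k + siteClass d ≠ 2) ++ labelStencil k

/-! ### Slices of detecting regions and their evolution through one round -/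

section Space

variable {Q : Type} [AddCommGroup Q] (mk : Site →+ Q) (cls : Q →+ ZMod 26) (κ : ZMod 26)

/-- A sum of measured Paulis. -/
def InMeas (m : Q → ZMod 2) : Prop :=
  ∀ q, (basisK (cls q + κ) = .X → m q = 0) ∧
    ∀ d, partnerK (cls q + κ) = some d → m q = m (q + mk d)

/-- A Pauli that commutes with the measurements in the other basis. -/
def CommMeas (p : Q → ZMod 2) : Prop :=
  ∀ q, basisK (cls q + κ) = .X → (partnerK (cls q + κ) = none → p q = 0) ∧
    ∀ d, partnerK (cls q + κ) = some d → p q = p (q + mk d)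

/-- The slice of a sum of detecting regions. -/
def slice (u : Q → ZMod 2) (q : Q) : ZMod 2 := lsum mk (regionStencil (cls q + κ)) u q

/-- The stabilizer with the given labels. -/
def full (c : Q → ZMod 2) (q : Q) : ZMod 2 := lsum mk (fullStencil (cls q + κ)) c q

variable {mk cls κ}

theorem InMeas.add {m m' : Q → ZMod 2} (h : InMeas mk cls κ m) (h' : InMeas mk cls κ m') :
    InMeas mk cls κ (m + m') := by
  refine fun q => ⟨fun hq => ?_, fun d hd => ?_⟩
  · rw [Pi.add_apply, (h q).1 hq, (h' q).1 hq, add_zero]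
  · rw [Pi.add_apply, (h q).2 d hd, (h' q).2 d hd]; rfl

theorem CommMeas.add {m m' : Q → ZMod 2} (h : CommMeas mk cls κ m) (h' : CommMeas mk cls κ m') :
    CommMeas mk cls κ (m + m') := by
  refine fun q hq => ⟨fun hd => ?_, fun d hd => ?_⟩
  · rw [Pi.add_apply, (h q hq).1 hd, (h' q hq).1 hd, add_zero]
  · rw [Pi.add_apply, (h q hq).2 d hd, (h' q hq).2 d hd]; rfl

theorem slice_add (u u' : Q → ZMod 2) :
    slice mk cls κ (u + u') = slice mk cls κ u + slice mk cls κ u' := by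
  funext q
  exact lsum_add mk _ u u' q

/-- Here `κ` belongs to a round and `κ + 8` to the round before it. A slice of a region meets every
measurement of the other basis in the next round evenly, so it is not destroyed. -/
theorem commMeas_slice (hc : ∀ s, cls (mk s) = siteClass s) (u : Q → ZMod 2) :
    CommMeas mk cls κ (slice mk cls (κ + 8) u) := by
  have h1 : ∀ k, basisK k = .X → partnerK k = none → EvenList (regionStencil (k + 8)) := by decide
  have h2 : ∀ k, basisK k = .X → ∀ d ∈ partnerK k,
      EvenList (combine regionStencil (k + 8) [0, d]) := by decide
  refine fun q hq => ⟨fun hd => ?_, fun d hd => ?_⟩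
  · rw [slice, ← add_assoc]
    exact lsum_eq_zero mk (h1 _ hq hd) u q
  · have := lsum_eq_zero mk (h2 _ hq d hd) u q
    rw [add_assoc, lsum_combine hc] at this
    simp only [lsum_cons, lsum_nil, map_zero, add_zero, zmod_two_add_eq_zero] at this
    exact this

/-- The defining property of a detecting region: the same reference qubits, read before and after a
round, give Paulis that differ by measured ones. -/
theorem inMeas_slice_add_slice (hc : ∀ s, cls (mk s) = siteClass s) (u : Q → ZMod 2) :
    InMeas mk cls κ (slice mk cls (κ + 8) u + slice mk cls κ u) := by
  have h1 : ∀ k, basisK k = .X → EvenList (regionStencil (k + 8) ++ regionStencil k) := by decide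
  have h2 : ∀ k, ∀ d ∈ partnerK k, EvenList
      (combine regionStencil (k + 8) [0, d] ++ combine regionStencil k [0, d]) := by decide
  refine fun q => ⟨fun hq => ?_, fun d hd => ?_⟩
  · have := lsum_eq_zero mk (h1 _ hq) u q
    rwa [add_assoc, lsum_append] at this
  · have := lsum_eq_zero mk (h2 _ d hd) u q
    rw [lsum_append, add_assoc, lsum_combine hc, lsum_combine hc] at this
    simp only [lsum_cons, lsum_nil, map_zero, add_zero] at this
    rw [← zmod_two_add_eq_zero]
    simp only [Pi.add_apply, slice]
    linear_combination this

/-- Only regions of ages 0 to 6 are visible at a given time; coefficients at all other qubits are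
irrelevant. -/
theorem slice_congr (hc : ∀ s, cls (mk s) = siteClass s) {u u' : Q → ZMod 2}
    (h : ∀ s, regionAge (cls s + κ) < 7 → u s = u' s) :
    slice mk cls κ u = slice mk cls κ u' := by
  have h1 : ∀ k, ∀ d ∈ regionStencil k, regionAge (k + siteClass d) < 7 := by decide
  funext q
  refine lsum_congr mk fun d hd => h _ ?_
  rw [map_add, hc, add_right_comm]
  exact h1 _ d hd

theorem slice_zero : slice mk cls κ (0 : Q → ZMod 2) = 0 := by
  funext q
  simp [slice, lsum]

/-- The measured Paulis of a round that survive the next one are sums of regions. -/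
theorem eq_slice_of_inMeas (hc : ∀ s, cls (mk s) = siteClass s) {m : Q → ZMod 2}
    (hm : InMeas mk cls (κ + 8) m) (hp : CommMeas mk cls κ m) :
    m = slice mk cls (κ + 8) (fun s => if cls s + (κ + 8) = 2 then m s else 0) := by
  -- Three stages of classes on which `m` must vanish: qubits not measured in this basis, then
  -- qubits forced to zero by a measurement of the next round, then their partners in the present
  -- round.
  let z0 : ZMod 26 → Prop := fun k => basisK k = .X
  let z1 : ZMod 26 → Prop := fun k => z0 k ∨ (basisK (k - 8) = .X ∧
    (partnerK (k - 8) = none ∨ ∃ d ∈ partnerK (k - 8), z0 (k + siteClass d)))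
  let z2 : ZMod 26 → Prop := fun k => z1 k ∨ ∃ d ∈ partnerK k, z1 (k + siteClass d)
  have hk : ∀ (q : Q) d, cls (q + mk d) + (κ + 8) = cls q + (κ + 8) + siteClass d := fun q d => by
    rw [map_add, hc, add_right_comm]
  have hk8 : ∀ q : Q, cls q + κ = cls q + (κ + 8) - 8 := fun q => by ring
  have m0 : ∀ q, z0 (cls q + (κ + 8)) → m q = 0 := fun q h => (hm q).1 h
  have m1 : ∀ q, z1 (cls q + (κ + 8)) → m q = 0 := by
    rintro q (h | ⟨h1, h2⟩)
    · exact m0 q h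
    · rw [← hk8] at h1 h2
      rcases h2 with h2 | ⟨d, hd, h2⟩
      · exact (hp q h1).1 h2
      · rw [(hp q h1).2 d hd]
        exact m0 _ (by rwa [hk])
  have m2 : ∀ q, z2 (cls q + (κ + 8)) → m q = 0 := by
    rintro q (h | ⟨d, hd, h⟩)
    · exact m1 q h
    · rw [(hm q).2 d hd]
      exact m1 _ (by rwa [hk])
  have hM : ∀ q (k : ZMod 26) (d : Site), cls q + (κ + 8) = k → partnerK k = some d →
      m q = m (q + mk d) := fun q k d h h' => (hm q).2 d (by rw [h]; exact h')
  have hX : ∀ q (k : ZMod 26) (d : Site), cls q + (κ + 8) = k → basisK (k - 8) = .X →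
      partnerK (k - 8) = some d → m q = m (q + mk d) := fun q k d h h1 h2 =>
    (hp q (by rw [hk8, h]; exact h1)).2 d (by rw [hk8, h]; exact h2)
  funext q
  set k := cls q + (κ + 8) with hkq
  have hs : slice mk cls (κ + 8) (fun s => if cls s + (κ + 8) = 2 then m s else 0) q =
      lsum mk ((regionStencil k).filter fun d => k + siteClass d = 2) m q :=
    (lsum_filter mk _ _ fun d _ => by rw [hk]).symm
  rw [hs]
  -- The remaining classes form the chain 1, 24, 25, 2, 3, 4, linked alternately by pairs of this
  -- round and pairs of the next. Thus `m` is constant on six-qubit pieces, the newborn regions, and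
  -- its value there is read off at class 2.
  have h1 : ∀ k, z2 k ∧ (regionStencil k).filter (fun d => k + siteClass d = 2) = [] ∨
      (k = 2 ∧ (regionStencil k).filter (fun d => k + siteClass d = 2) = [(0, 0)]) ∨
      (k = 25 ∧ (regionStencil k).filter (fun d => k + siteClass d = 2) = [(0, -1)]) ∨
      (k = 24 ∧ (regionStencil k).filter (fun d => k + siteClass d = 2) = [(1, -1)]) ∨
      (k = 1 ∧ (regionStencil k).filter (fun d => k + siteClass d = 2) = [(1, 0)]) ∨
      (k = 3 ∧ (regionStencil k).filter (fun d => k + siteClass d = 2) = [(-1, 0)]) ∨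
      (k = 4 ∧ (regionStencil k).filter (fun d => k + siteClass d = 2) = [(-2, 0)]) := by
    simp only [z2, z1, z0]
    decide
  have step : ∀ (r : Q) (d : Site) (c : ZMod 26), cls r + (κ + 8) = c →
      cls (r + mk d) + (κ + 8) = c + siteClass d := fun r d c h => by rw [hk, h]
  have s25 : ∀ r, cls r + (κ + 8) = 25 → m r = m (r + mk (0, -1)) := fun r h =>
    hM r 25 _ h (by decide)
  have s24 : ∀ r, cls r + (κ + 8) = 24 → m r = m (r + mk (1, -1)) := fun r h => by
    rw [hX r 24 (1, 0) h (by decide) (by decide), s25 _ (step r (1, 0) 24 h), add_assoc, ← map_add]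
    rfl
  have s1 : ∀ r, cls r + (κ + 8) = 1 → m r = m (r + mk (1, 0)) := fun r h => by
    rw [hM r 1 (0, 1) h (by decide), s24 _ (step r (0, 1) 1 h), add_assoc, ← map_add]
    rfl
  have s3 : ∀ r, cls r + (κ + 8) = 3 → m r = m (r + mk (-1, 0)) := fun r h =>
    hX r 3 _ h (by decide) (by decide)
  have s4 : ∀ r, cls r + (κ + 8) = 4 → m r = m (r + mk (-2, 0)) := fun r h => by
    rw [hM r 4 (-1, 0) h (by decide), s3 _ (step r (-1, 0) 4 h), add_assoc, ← map_add]
    rfl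
  rcases h1 k with ⟨h, h2⟩ | ⟨h, h2⟩ | ⟨h, h2⟩ | ⟨h, h2⟩ | ⟨h, h2⟩ | ⟨h, h2⟩ | ⟨h, h2⟩ <;> rw [h2]
  · rw [m2 q h, lsum_nil]
  · rw [lsum_cons, lsum_nil, add_zero, show ((0, 0) : Site) = 0 from rfl, map_zero, add_zero]
  · rw [lsum_cons, lsum_nil, add_zero, s25 q h]
  · rw [lsum_cons, lsum_nil, add_zero, s24 q h]
  · rw [lsum_cons, lsum_nil, add_zero, s1 q h]
  · rw [lsum_cons, lsum_nil, add_zero, s3 q h]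
  · rw [lsum_cons, lsum_nil, add_zero, s4 q h]

end Space

/-! ### The stabilizers as images of labels, and the relations between labels -/

section Full

variable {Q : Type} [AddCommGroup Q] {mk : Site →+ Q} {cls : Q →+ ZMod 26} {κ : ZMod 26}

/-- Class 2 is left out of the slice because a newborn region is a sum of measured Paulis and would
be counted twice; the label at class 2 belongs to a measurement instead. -/
theorem full_eq_add (c : Q → ZMod 2) (hc : ∀ s, cls (mk s) = siteClass s) :
    full mk cls κ c = slice mk cls κ (fun s => if cls s + κ ≠ 2 then c s else 0) +
      fun q => lsum mk (labelStencil (cls q + κ)) c q := by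
  funext q
  rw [full, fullStencil, lsum_append, Pi.add_apply, slice]
  congr 1
  refine lsum_filter mk _ _ fun d _ => ?_
  rw [map_add, hc, add_right_comm]

theorem inMeas_label (c : Q → ZMod 2) (hc : ∀ s, cls (mk s) = siteClass s) :
    InMeas mk cls κ fun q => lsum mk (labelStencil (cls q + κ)) c q := by
  have h1 : ∀ k, basisK k = .X → labelStencil k = [] := by decide
  have h2 : ∀ k, ∀ d ∈ partnerK k, EvenList (combine labelStencil k [0, d]) := by decide
  refine fun q => ⟨fun hq => ?_, fun d hd => ?_⟩
  · dsimp only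
    rw [h1 _ hq, lsum_nil]
  · have := lsum_eq_zero mk (h2 _ d hd) c q
    rw [lsum_combine hc] at this
    simp only [lsum_cons, lsum_nil, map_zero, add_zero, zmod_two_add_eq_zero] at this
    exact this

/-- The regions of age zero are sums of measured Paulis. -/
theorem inMeas_slice_new (u : Q → ZMod 2) (hc : ∀ s, cls (mk s) = siteClass s)
    (hu : ∀ s, regionAge (cls s + (κ + 8)) < 7 → u s = 0) :
    InMeas mk cls κ (slice mk cls κ u) := by
  have h := inMeas_slice_add_slice (κ := κ) hc u
  rwa [slice_congr hc (u' := 0) hu, slice_zero, zero_add] at h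

/-- Labels of ages 1 to 6 are the coefficients of the regions. Each remaining even class labels one
measurement, whose coefficient is a value of the measured part once the newborn regions have been
absorbed into it. -/
theorem exists_full_eq (hc : ∀ s, cls (mk s) = siteClass s) (u m : Q → ZMod 2)
    (hm : InMeas mk cls κ m) :
    ∃ c, full mk cls κ c = slice mk cls κ u + m ∧
      ∀ s, 0 < regionAge (cls s + κ) → regionAge (cls s + κ) < 7 → c s = u s := by
  let u0 : Q → ZMod 2 := fun s => if cls s + κ ≠ 2 then 0 else u s
  let u1 : Q → ZMod 2 := fun s => if cls s + κ ≠ 2 then u s else 0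
  have hu : u = u1 + u0 := by
    funext s
    simp only [Pi.add_apply, u0, u1]
    split_ifs <;> simp
  have hM : InMeas mk cls κ (slice mk cls κ u0 + m) := by
    refine (inMeas_slice_new u0 hc fun s hs => if_pos fun h => ?_).add hm
    rw [← add_assoc, h] at hs
    revert hs; decide
  set M := slice mk cls κ u0 + m with hMdef
  let c : Q → ZMod 2 := fun s => if 0 < regionAge (cls s + κ) ∧ regionAge (cls s + κ) < 7 then u s
    else M (s + mk (unlabel (cls s + κ)))
  refine ⟨c, ?_, fun s h1 h2 => if_pos ⟨h1, h2⟩⟩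
  have hk : ∀ (q : Q) d, cls (q + mk d) + κ = cls q + κ + siteClass d := fun q d => by
    rw [map_add, hc, add_right_comm]
  have t1 : ∀ k, ∀ d ∈ regionStencil k, k + siteClass d ≠ 2 →
      0 < regionAge (k + siteClass d) ∧ regionAge (k + siteClass d) < 7 := by decide
  -- Each qubit measured in the basis has exactly one label, it is not the reference of an older
  -- region, and `unlabel` leads from it back to the qubit or to its partner.
  have t2 : ∀ k, (basisK k = .X ∧ labelStencil k = []) ∨ ∃ e ∈ labelStencil k,
      labelStencil k = [e] ∧ ¬ (0 < regionAge (k + siteClass e) ∧ regionAge (k + siteClass e) < 7) ∧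
        (e + unlabel (k + siteClass e) = 0 ∨
          partnerK k = some (e + unlabel (k + siteClass e))) := by decide
  rw [hu, slice_add, add_assoc, ← hMdef]
  funext q
  rw [full, fullStencil, lsum_append, Pi.add_apply]
  congr 1
  · refine lsum_filter mk _ _ fun d hd => ?_
    simp only [u1, c, hk]
    split_ifs with h1 h2 h2
    · rfl
    · exact absurd (t1 _ d hd h1) h2
    · rfl
  · rcases t2 (cls q + κ) with ⟨h1, h2⟩ | ⟨e, -, h1, h2, h3⟩
    · rw [h2, lsum_nil, (hM q).1 h1]
    · rw [h1, lsum_cons, lsum_nil, add_zero]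
      simp only [c, hk]
      rw [if_neg h2, add_assoc, ← map_add]
      rcases h3 with h3 | h3
      · rw [h3, map_zero, add_zero]
      · exact ((hM q).2 _ h3).symm

/-- Nothing outside the parametrisation ever appears. Slices commute with the new round anyway, so
if a stabilizer survives then its measured part survives, and is a sum of newborn regions. The
survivor is therefore one slice, which the round advances modulo measured Paulis. -/
theorem exists_full_eq_of_step (hc : ∀ s, cls (mk s) = siteClass s) {c' p : Q → ZMod 2}
    (h1 : CommMeas mk cls κ (full mk cls (κ + 8) c'))
    (h2 : InMeas mk cls κ (full mk cls (κ + 8) c' + p)) : ∃ c, full mk cls κ c = p := by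
  set m' : Q → ZMod 2 := fun q => lsum mk (labelStencil (cls q + (κ + 8))) c' q with hm'
  have h3 := full_eq_add (κ := κ + 8) c' hc
  rw [← hm'] at h3
  set u' : Q → ZMod 2 := fun s => if cls s + (κ + 8) ≠ 2 then c' s else 0
  have h4 : m' = full mk cls (κ + 8) c' + slice mk cls (κ + 8) u' := by
    rw [h3, add_comm, ← add_assoc, ZModModule.add_self, zero_add]
  have h5 : CommMeas mk cls κ m' := by
    rw [h4]; exact h1.add (commMeas_slice hc u')
  have h6 := eq_slice_of_inMeas hc (inMeas_label c' hc) h5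
  rw [← hm'] at h6
  rw [h6, ← slice_add] at h3
  set w := u' + fun s => if cls s + (κ + 8) = 2 then m' s else 0
  obtain ⟨c, hcc, -⟩ := exists_full_eq hc w
    (slice mk cls (κ + 8) w + slice mk cls κ w + (full mk cls (κ + 8) c' + p))
    ((inMeas_slice_add_slice hc w).add h2)
  refine ⟨c, hcc.trans ?_⟩
  rw [h3]
  funext q
  simp only [Pi.add_apply]
  linear_combination zmod_two_add_self (slice mk cls κ w q) +
    zmod_two_add_self (slice mk cls (κ + 8) w q)

/-- Every sum of regions and measured Paulis is reached after seven rounds. -/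
theorem full_reached (hc : ∀ s, cls (mk s) = siteClass s) {P : ℕ → (Q → ZMod 2) → Prop}
    {κs : ℕ → ZMod 26} (hκ : ∀ t, κs t = κs (t + 1) + 8)
    (hM : ∀ t p m, InMeas mk cls (κs t) m → P t p → P t (p + m)) (h0 : ∀ t, P t 0)
    (hs : ∀ t p p', P t p' → CommMeas mk cls (κs (t + 1)) p' →
      InMeas mk cls (κs (t + 1)) (p' + p) → P (t + 1) p)
    (c : Q → ZMod 2) (t : ℕ) : P (t + 6) (full mk cls (κs (t + 6)) c) := by
  rw [full_eq_add c hc]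
  refine hM _ _ _ (inMeas_label c hc) ?_
  set u : Q → ZMod 2 := fun s => if cls s + κs (t + 6) ≠ 2 then c s else 0
  have hκ' : ∀ i : ℕ, i ≤ 6 → κs (t + i) = κs (t + 6) + 8 * (6 - i) := by
    intro i hi
    have key : ∀ n i, κs i = κs (i + n) + 8 * n := by
      intro n
      induction n with
      | zero => simp
      | succ n ih => intro i; rw [ih i, hκ (i + n), ← add_assoc]; push_cast; ring
    have := key (6 - i) (t + i)
    rw [show t + i + (6 - i) = t + 6 by omega] at this
    rw [this]; push_cast [hi]; ring
  -- The coefficients are fixed by the final time `t + 6`; after `i` steps exactly the regions of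
  -- final age at least `6 - i` have been born.
  have main : ∀ i : ℕ, i ≤ 6 → P (t + i) (slice mk cls (κs (t + i))
      fun s => if 6 - i ≤ regionAge (cls s + κs (t + 6)) ∧ regionAge (cls s + κs (t + 6)) < 7
        then u s else 0) := by
    intro i hi
    induction i with
    | zero =>
      have := hM t 0 _ (inMeas_slice_new (κ := κs t) (fun s =>
        if 6 - 0 ≤ regionAge (cls s + κs (t + 6)) ∧ regionAge (cls s + κs (t + 6)) < 7
        then u s else 0) hc fun s hs => if_neg fun h => ?_) (h0 t)
      · rwa [zero_add] at this
      · have h1 := hκ' 0 hi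
        rw [add_zero] at h1
        rw [h1] at hs
        have h2 : ∀ k : ZMod 26, regionAge (k + 8 * (6 - ((0 : ℕ) : ZMod 26)) + 8) < 7 →
          ¬ (6 - 0 ≤ regionAge k ∧ regionAge k < 7) := by decide
        exact h2 _ (by convert hs using 2; ring) h
    | succ i ih =>
      have ih' := ih (by omega)
      -- The regions newly admitted at this step have no effect on the previous slice, so the
      -- induction hypothesis applies to the enlarged coefficient function as well.
      refine hs (t + i) _ _ ?_ (commMeas_slice hc _) (inMeas_slice_add_slice hc _)
      have e : κs (t + i + 1) + 8 = κs (t + i) := (hκ (t + i)).symm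
      change P (t + i) (slice mk cls (κs (t + i + 1) + 8) _)
      rw [e]
      convert ih' using 1
      refine slice_congr hc fun s hs => ?_
      have h1 := hκ' i (by omega)
      rw [h1] at hs
      have h2 : ∀ i < 6, ∀ k : ZMod 26, regionAge (k + 8 * (6 - ((i : ℕ) : ZMod 26))) < 7 →
          ((6 - (i + 1) ≤ regionAge k ∧ regionAge k < 7) ↔
            (6 - i ≤ regionAge k ∧ regionAge k < 7)) := by decide
      have h3 := h2 i (by omega) (cls s + κs (t + 6)) (by rwa [add_assoc])
      simp only [h3]
  have h6 := main 6 le_rfl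
  convert h6 using 1
  refine slice_congr hc fun s hs => ?_
  rw [if_pos ⟨by omega, hs⟩]

theorem full_add (c c' : Q → ZMod 2) :
    full mk cls κ (c + c') = full mk cls κ c + full mk cls κ c' := by
  funext q
  exact lsum_add mk _ c c' q

/-- All displacements of the stencil end in even classes, so only half of the qubits carry labels.
-/
theorem full_congr (hc : ∀ s, cls (mk s) = siteClass s) {c c' : Q → ZMod 2}
    (h : ∀ s, Even (cls s + κ).val → c s = c' s) : full mk cls κ c = full mk cls κ c' := by
  have h1 : ∀ k, ∀ d ∈ fullStencil k, Even (k + siteClass d).val := by decide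
  funext q
  refine lsum_congr mk fun d hd => h _ ?_
  rw [map_add, hc, add_right_comm]
  exact h1 _ d hd

/-- Combinations of the parametrisation that isolate a label of even class. -/
def isolate (k : ZMod 26) : List Site :=
  match k.val with
  | 0 => [(0, -1)]
  | 2 => [(0, 0)]
  | 6 => [(-1, 0)]
  | 8 => [(0, 0)]
  | 10 => [(0, -1), (1, -1)]
  | 12 => [(-1, 2), (0, 1)]
  | 14 => [(-2, 1), (-1, 2), (0, 0), (0, 2)]
  | 16 => [(-2, -1), (-1, -1), (0, -2), (0, -1)]
  | 18 => [(-2, 0), (0, 0)]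
  | 20 => [(0, 0), (1, -2), (1, -1)]
  | 22 => [(0, -2), (0, -1)]
  | 24 => [(-2, -2), (-2, -1), (0, -1)]
  | _ => []

/-- The labels of class 4 on which an isolated label depends. -/
def isolateRest (k : ZMod 26) : List Site :=
  match k.val with
  | 0 => [(-2, -2), (1, -1)]
  | 2 => [(-1, -1), (2, 0)]
  | 6 => [(-2, 0), (1, 1)]
  | 10 => []
  | 12 => [(-2, 2), (1, 3)]
  | 14 => [(-1, 3)]
  | 20 => [(1, -3)]
  | 22 => [(-1, -3), (2, -2)]
  | 24 => [(-3, -3)]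
  | 4 => [(0, 0)]
  | _ => []

theorem full_eq_zero_iff_aux (hc : ∀ s, cls (mk s) = siteClass s) {c : Q → ZMod 2}
    (h : full mk cls κ c = 0) {V E : List Site} {s : Q}
    (hE : EvenList (combine fullStencil (cls s + κ) V ++ E)) : lsum mk E c s = 0 := by
  rw [← lsum_eq_lsum_of_evenList hc hE c]
  change lsum mk V (full mk cls κ c) s = 0
  rw [h]
  simp [lsum]

/-- The list `V` is a certificate: these three equations of the relation add up to the stated one.
-/
theorem full_eq_zero_tri (hc : ∀ s, cls (mk s) = siteClass s) {c : Q → ZMod 2}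
    (h : full mk cls κ c = 0) {s : Q} (hs : cls s + κ = 4) :
    c s + c (s + mk (3, 1)) + c (s + mk (6, 2)) = 0 := by
  have := full_eq_zero_iff_aux hc h (s := s) (V := [(2, 1), (3, 1), (4, 1)])
    (E := [0, (3, 1), (6, 2)]) (by rw [hs]; decide)
  simpa [add_assoc] using this

/-- Again a certificate, now with fourteen equations; only the evenness of multiplicities has to be
checked. -/
theorem full_eq_zero_shift (hc : ∀ s, cls (mk s) = siteClass s) {c : Q → ZMod 2}
    (h : full mk cls κ c = 0) {s : Q} (hs : cls s + κ = 4) : c (s + mk (-2, 8)) = c s := by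
  have := full_eq_zero_iff_aux hc h (s := s)
    (V := [(-7, 6), (-6, 2), (-6, 3), (-6, 5), (-6, 7), (-5, -1), (-5, 0), (-5, 2), (-5, 3),
      (-5, 7), (-4, -1), (-4, 7), (-3, -1), (-2, -1)])
    (E := [(-2, 8), 0]) (by rw [hs]; decide)
  simpa [zmod_two_add_eq_zero] using this

/-- For every even class other than 4, the equations listed in `isolate` express the label through
labels of class 4. -/
theorem full_eq_zero_even (hc : ∀ s, cls (mk s) = siteClass s) {c : Q → ZMod 2}
    (h : full mk cls κ c = 0) (h4 : ∀ s, cls s + κ = 4 → c s = 0) {s : Q}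
    (hs : Even (cls s + κ).val) : c s = 0 := by
  by_cases hs4 : cls s + κ = 4
  · exact h4 s hs4
  have t : ∀ k : ZMod 26, Even k.val → k ≠ 4 →
      EvenList (combine fullStencil k (isolate k) ++ (0 :: isolateRest k)) ∧
        ∀ d ∈ isolateRest k, k + siteClass d = 4 := by decide
  obtain ⟨t1, t2⟩ := t _ hs hs4
  have := full_eq_zero_iff_aux hc h t1
  rw [lsum_cons, map_zero, add_zero, lsum_congr mk (g := 0)] at this
  · simpa [lsum] using this
  · intro d hd
    refine h4 _ ?_
    rw [map_add, hc, add_right_comm]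
    exact t2 d hd

/-- The three-colourings of the regions give relations. -/
theorem slice_colouring (hc : ∀ s, cls (mk s) = siteClass s) (col : Q →+ ZMod 3)
    (hcol : ∀ s, col (mk s) = ((s.1 + s.2 : ℤ) : ZMod 3)) (α β : ZMod 2) :
    slice mk cls κ (fun s => (![α, β, α + β] : ZMod 3 → ZMod 2)
      (col s + (regionAge (cls s + κ) : ZMod 3))) = 0 := by
  -- A qubit touched by three regions sees each colour once, one touched by two regions sees the
  -- same colour twice, and the values on the three colours sum to zero. Advancing the colour with
  -- the age makes this uniform in time.
  have t : ∀ (α β : ZMod 2) (x : ZMod 3) (k : ZMod 26),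
      ((regionStencil k).map fun d => (![α, β, α + β] : ZMod 3 → ZMod 2)
        (x + ((d.1 + d.2 : ℤ) : ZMod 3) + (regionAge (k + siteClass d) : ZMod 3))).sum = 0 := by
    decide
  funext q
  rw [slice, lsum, Pi.zero_apply, ← t α β (col q) (cls q + κ)]
  congr 1
  refine List.map_congr_left fun d _ => ?_
  rw [map_add, map_add, hc, hcol, add_right_comm (cls q)]

end Full

/-! ## Finite quotients of the square lattice -/

/-- The residue that has to be added to the class of a qubit at time `t`, for stabilizers in the
basis `b`. -/
def offset (b : PauliBasis) (t : ℤ) : ZMod 26 :=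
  (if b = .Z then 0 else 13) + ((-8 * t : ℤ) : ZMod 26)

theorem offset_succ (b : PauliBasis) (t : ℤ) : offset b t = offset b (t + 1) + 8 := by
  unfold offset; push_cast; ring

/-- The two bases differ by a shift of 13 in the class. So all statements are proved for basis `Z`
and the labels of the two bases occupy complementary sets of qubits. -/
theorem offset_swap (b : PauliBasis) (t : ℤ) : offset b.swap t = offset b t + 13 := by
  have h : (13 : ZMod 26) + 13 = 0 := rfl
  cases b
  · simp only [offset, PauliBasis.swap, if_true, reduceCtorEq, if_false]
    linear_combination -h
  · simp only [offset, PauliBasis.swap, if_true, reduceCtorEq, if_false]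
    ring

theorem even_val_add_thirteen (k : ZMod 26) : Even (k + 13).val ↔ ¬ Even k.val := by
  revert k; decide

theorem siteClass_add_offset (q : Site) (b : PauliBasis) (t : ℤ) :
    basisK (siteClass q + offset b t) = .Z ↔ basis q t = b := by
  cases b
  · rw [show siteClass q + offset .X t = stClass q t + 13 by simp [offset, stClass]; ring,
      basisK_add_thirteen, basis_eq]
    cases basisK (stClass q t) <;> simp [PauliBasis.swap]
  · rw [show siteClass q + offset .Z t = stClass q t by simp [offset, stClass], basis_eq]

theorem partnerK_siteClass_add_offset (q : Site) (b : PauliBasis) (t : ℤ) :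
    partnerK (siteClass q + offset b t) = partner q t := by
  cases b
  · rw [show siteClass q + offset .X t = stClass q t + 13 by simp [offset, stClass]; ring,
      partnerK_add_thirteen, partner_eq]
  · rw [show siteClass q + offset .Z t = stClass q t by simp [offset, stClass], partner_eq]

section Quotient

variable {Q : Type} [AddCommGroup Q] {mk : Site →+ Q} {cls : Q →+ ZMod 26} {κ : ZMod 26}

variable (mk cls κ) in
/-- The other qubit of the measurement of `q`, or `q` itself if there is none. -/
def mate (q : Q) : Q := ((partnerK (cls q + κ)).map fun d => q + mk d).getD q

theorem mate_of_none {q : Q} (h : partnerK (cls q + κ) = none) : mate mk cls κ q = q := by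
  simp [mate, h]

theorem mate_of_some {q : Q} {d : Site} (h : partnerK (cls q + κ) = some d) :
    mate mk cls κ q = q + mk d := by
  simp [mate, h]

theorem mk_ne_zero (hc : ∀ s, cls (mk s) = siteClass s) {k : ZMod 26} {d : Site}
    (h : partnerK k = some d) : mk d ≠ 0 := fun h0 => by
  have h1 : ∀ k, ∀ d ∈ partnerK k, siteClass d ≠ 0 := by decide
  exact h1 k d h (by rw [← hc, h0, map_zero])

theorem mate_mate (hc : ∀ s, cls (mk s) = siteClass s) (q : Q) :
    mate mk cls κ (mate mk cls κ q) = q := by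
  rcases h : partnerK (cls q + κ) with _ | d
  · rw [mate_of_none h, mate_of_none h]
  · rw [mate_of_some h, mate_of_some (d := -d)]
    · simp
    · rw [map_add, hc, add_right_comm]
      exact (partnerK_spec _ _ h).1

theorem basisK_mate (hc : ∀ s, cls (mk s) = siteClass s) (q : Q) :
    basisK (cls (mate mk cls κ q) + κ) = basisK (cls q + κ) := by
  rcases h : partnerK (cls q + κ) with _ | d
  · rw [mate_of_none h]
  · rw [mate_of_some h, map_add, hc, add_right_comm]
    exact (partnerK_spec _ _ h).2.1

theorem inMeas_iff (m : Q → ZMod 2) : InMeas mk cls κ m ↔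
    ∀ q, (basisK (cls q + κ) = .X → m q = 0) ∧ m q = m (mate mk cls κ q) := by
  refine forall_congr' fun q => and_congr_right fun _ => ?_
  rcases h : partnerK (cls q + κ) with _ | d
  · simp [mate_of_none h]
  · simp [mate_of_some h]

open Classical in
theorem indic_pair_apply {Q : Type} (q r p : Q) : indic {q, r} p = if p = q ∨ p = r then 1 else 0 := by
  rw [indic_apply]; simp

open Classical in
theorem inMeas_indic (hc : ∀ s, cls (mk s) = siteClass s) {q : Q}
    (hq : basisK (cls q + κ) = .Z) : InMeas mk cls κ (indic {q, mate mk cls κ q}) := by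
  refine (inMeas_iff _).2 fun p => ⟨fun hp => ?_, ?_⟩
  · rw [indic_pair_apply, if_neg]
    rintro (rfl | rfl)
    · rw [hp] at hq; cases hq
    · rw [basisK_mate hc, hq] at hp; cases hp
  · rw [indic_pair_apply, indic_pair_apply]
    congr 1
    rw [eq_iff_iff, or_comm (a := mate mk cls κ p = q)]
    refine or_congr ⟨fun h => h ▸ rfl, fun h => ?_⟩ ⟨fun h => ?_, fun h => ?_⟩
    · rw [← mate_mate hc p, h, mate_mate hc]
    · rw [h, mate_mate hc]
    · rw [← h, mate_mate hc]

open Classical in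
-- A function supported on the measured qubits and constant on the pairs is peeled off one
-- measurement at a time, by induction on the size of its support.
theorem mem_span_indic_iff (hc : ∀ s, cls (mk s) = siteClass s) (v : Q →₀ ZMod 2) :
    v ∈ Submodule.span (ZMod 2)
      {v | ∃ q, basisK (cls q + κ) = .Z ∧ v = indic {q, mate mk cls κ q}} ↔
      InMeas mk cls κ v := by
  constructor
  · intro h
    induction h using Submodule.span_induction with
    | mem v hv => obtain ⟨q, hq, rfl⟩ := hv; exact inMeas_indic hc hq
    | zero => exact fun _ => ⟨fun _ => rfl, fun _ _ => rfl⟩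
    | add a b _ _ ha hb => exact ha.add hb
    | smul c a _ ha =>
      exact fun q => ⟨fun h => by simp [(ha q).1 h], fun d hd => by simp [(ha q).2 d hd]⟩
  · intro h
    induction hn : v.support.card using Nat.strong_induction_on generalizing v with
    | _ n ih =>
      rcases eq_or_ne v 0 with rfl | hv
      · exact Submodule.zero_mem _
      obtain ⟨q, hq⟩ := Finsupp.ne_iff.1 hv
      rw [Finsupp.coe_zero, Pi.zero_apply] at hq
      have hqZ : basisK (cls q + κ) = .Z := by
        rcases hb : basisK (cls q + κ) with _ | _
        · exact absurd ((h q).1 hb) hq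
        · rfl
      have hvq : v q = 1 := (zmod_two_cases _).resolve_left hq
      have hvm : v (mate mk cls κ q) = 1 := by rw [← ((inMeas_iff _).1 h q).2, hvq]
      set w := v + indic {q, mate mk cls κ q} with hw
      have hwv : v = w + indic {q, mate mk cls κ q} := by
        rw [hw, add_assoc, ZModModule.add_self, add_zero]
      have hwa : ∀ p, w p = if p = q ∨ p = mate mk cls κ q then 0 else v p := fun p => by
        rw [hw, Finsupp.add_apply, indic_pair_apply]
        split_ifs with hp
        · rcases hp with rfl | rfl
          · rw [hvq]; rfl
          · rw [hvm]; rfl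
        · rw [add_zero]
      rw [hwv]
      refine Submodule.add_mem _ (ih _ ?_ w ?_ rfl) (Submodule.subset_span ⟨q, hqZ, rfl⟩)
      · rw [← hn]
        refine Finset.card_lt_card (Finset.ssubset_iff_of_subset ?_ |>.2 ⟨q, by simp [hq], ?_⟩)
        · intro p hp
          rw [Finsupp.mem_support_iff, hwa] at hp
          rw [Finsupp.mem_support_iff]
          split_ifs at hp
          · exact absurd rfl hp
          · exact hp
        · rw [Finsupp.mem_support_iff, hwa]; simp
      · exact h.add (inMeas_indic hc hqZ)

open Classical in
theorem map_measAt (hc : ∀ s, cls (mk s) = siteClass s) (s : Site) (b : PauliBasis) (t : ℤ) :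
    (measAt s t).map mk = ⟨basis s t, {mk s, mate mk cls (offset b t) (mk s)}⟩ := by
  have h1 := partnerK_siteClass_add_offset s b t
  rw [← hc] at h1
  rcases h : partner s t with _ | d
  · rw [measAt_of_none h, mate_of_none (h1.trans h)]
    ext1 <;> simp [Measurement.map]
  · rw [measAt_of_some h, mate_of_some (h1.trans h)]
    ext1
    · rfl
    · simp only [Measurement.map, Finset.image_insert, Finset.image_singleton, map_add]

variable (mk) in
/-- The measurements at time `t` on a quotient of the square lattice. -/
def quotRound (t : ℤ) : Set (Measurement Q) := Measurement.map mk '' bulkRound t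

open Classical in
theorem mem_quotRound (hc : ∀ s, cls (mk s) = siteClass s) (hmk : Function.Surjective mk)
    (b : PauliBasis) {t : ℤ} {m : Measurement Q} : m ∈ quotRound mk t ∧ m.basis = b ↔
      ∃ q, basisK (cls q + offset b t) = .Z ∧ m = ⟨b, {q, mate mk cls (offset b t) q}⟩ := by
  constructor
  · rintro ⟨⟨_, ⟨s, rfl⟩, rfl⟩, rfl⟩
    refine ⟨mk s, ?_, map_measAt hc s _ t⟩
    rw [hc, siteClass_add_offset]; rfl
  · rintro ⟨q, hq, rfl⟩
    obtain ⟨s, rfl⟩ := hmk q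
    rw [hc, siteClass_add_offset] at hq
    exact ⟨⟨_, ⟨s, rfl⟩, by rw [map_measAt hc s b t, hq]⟩, rfl⟩

theorem mem_measSpan_quotRound (hc : ∀ s, cls (mk s) = siteClass s)
    (hmk : Function.Surjective mk) {b : PauliBasis} {t : ℤ} {v : Q →₀ ZMod 2} :
    v ∈ measSpan (quotRound mk t) b ↔ InMeas mk cls (offset b t) v := by
  classical
  rw [← mem_span_indic_iff hc, measSpan]
  congr! 4 with w
  constructor
  · rintro ⟨m, hm, hb, rfl⟩
    obtain ⟨q, hq, rfl⟩ := (mem_quotRound hc hmk b).1 ⟨hm, hb⟩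
    exact ⟨q, hq, rfl⟩
  · rintro ⟨q, hq, rfl⟩
    obtain ⟨h1, h2⟩ := (mem_quotRound hc hmk b).2 ⟨q, hq, rfl⟩
    exact ⟨_, h1, h2, rfl⟩

theorem commutingRound_quotRound (hc : ∀ s, cls (mk s) = siteClass s)
    (hmk : Function.Surjective mk) (t : ℤ) : CommutingRound (quotRound mk t) := by
  classical
  intro m hm m' hm' hb hb'
  obtain ⟨q, hq, rfl⟩ := (mem_quotRound hc hmk _).1 ⟨hm, hb⟩
  have h := (inMeas_iff _).1 ((mem_measSpan_quotRound hc hmk).1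
    (Submodule.subset_span ⟨m', hm', hb', rfl⟩ : indic m'.support ∈ measSpan _ .Z))
  have hq' : basisK (cls q + offset .Z t) = .X := by
    have h3 : offset .Z t = offset .X t + 13 := offset_swap .X t
    rw [h3, ← add_assoc, basisK_add_thirteen, hq]; rfl
  rw [dot_indic, Finset.sum_eq_zero]
  intro p hp
  rw [Finset.mem_insert, Finset.mem_singleton] at hp
  rcases hp with rfl | rfl
  · exact (h _).1 hq'
  · have h3 : offset .Z t = offset .X t + 13 := offset_swap .X t
    refine (h _).1 ?_
    rw [h3, ← add_assoc, basisK_add_thirteen, basisK_mate hc, hq]; rfl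

/-- Orthogonality to a singleton says that the value vanishes, and to a pair that the two values
agree. The two qubits of a pair stay distinct in the quotient, since their classes differ. -/
theorem mem_dotPerp_quotRound (hc : ∀ s, cls (mk s) = siteClass s)
    (hmk : Function.Surjective mk) {b : PauliBasis} {t : ℤ} {v : Q →₀ ZMod 2} :
    v ∈ dotPerp (measSpan (quotRound mk t) b.swap) ↔ CommMeas mk cls (offset b t) v := by
  classical
  have key : v ∈ dotPerp (measSpan (quotRound mk t) b.swap) ↔
      ∀ q, basisK (cls q + offset b t) = .X → dot (indic {q, mate mk cls (offset b t) q}) v = 0 := by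
    have hsw : ∀ q, basisK (cls q + offset b.swap t) = .Z ↔ basisK (cls q + offset b t) = .X := by
      intro q
      rw [offset_swap, ← add_assoc, basisK_add_thirteen]
      cases basisK (cls q + offset b t) <;> simp [PauliBasis.swap]
    have hmate : ∀ q, mate mk cls (offset b.swap t) q = mate mk cls (offset b t) q := by
      intro q
      rw [mate, mate, offset_swap, ← add_assoc, partnerK_add_thirteen]
    rw [mem_dotPerp]
    constructor
    · intro h q hq
      obtain ⟨h1, h2⟩ := (mem_quotRound hc hmk b.swap).2 ⟨q, (hsw q).2 hq, rfl⟩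
      have := h _ (Submodule.subset_span ⟨_, h1, h2, rfl⟩)
      rwa [hmate] at this
    · intro h w hw
      induction hw using Submodule.span_induction with
      | mem w hw =>
        obtain ⟨m, hm, hb, rfl⟩ := hw
        obtain ⟨q, hq, rfl⟩ := (mem_quotRound hc hmk _).1 ⟨hm, hb⟩
        rw [hmate]
        exact h q ((hsw q).1 hq)
      | zero => exact dot_zero_left _
      | add a b _ _ ha hb => rw [dot_add_left, ha, hb, add_zero]
      | smul c a _ ha =>
        rw [← dotForm_apply, map_smul, LinearMap.smul_apply, dotForm_apply, ha, smul_zero]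
  rw [key]
  refine forall_congr' fun q => forall_congr' fun _ => ?_
  rcases h : partnerK (cls q + offset b t) with _ | d
  · rw [mate_of_none h, dot_indic]
    simp
  · have hne : q ∉ ({q + mk d} : Finset Q) := by simpa using mk_ne_zero hc h
    rw [mate_of_some h, dot_indic, Finset.sum_insert hne, Finset.sum_singleton,
      zmod_two_add_eq_zero]
    simp

/-- This inclusion holds at all times: round 0 consists of measured Paulis, and
`exists_full_eq_of_step` is the induction step. -/
theorem exists_full_of_mem_cssGroup [Finite Q] (hc : ∀ s, cls (mk s) = siteClass s)
    (hmk : Function.Surjective mk) (b : PauliBasis) (t : ℕ) (v : Q →₀ ZMod 2)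
    (hv : v ∈ cssGroup (quotRound mk) b t) : ∃ c, full mk cls (offset b t) c = v := by
  induction t generalizing v with
  | zero =>
    obtain ⟨c, h, -⟩ := exists_full_eq hc 0 v ((mem_measSpan_quotRound hc hmk).1 hv)
    exact ⟨c, by rw [Nat.cast_zero, h, slice_zero, zero_add]⟩
  | succ t ih =>
    obtain ⟨p, ⟨hp, hp'⟩, m, hm, rfl⟩ := Submodule.mem_sup.1 hv
    rw [Finsupp.coe_add]
    obtain ⟨c', hc'⟩ := ih p hp
    rw [offset_succ] at hc'
    push_cast at hp' hm ⊢
    have h1 := (mem_dotPerp_quotRound hc hmk).1 hp'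
    have h2 := (mem_measSpan_quotRound hc hmk).1 hm
    refine exists_full_eq_of_step hc (c' := c') (by rwa [hc']) ?_
    rwa [hc', ← add_assoc, ZModModule.add_self, zero_add]

theorem full_mem_cssGroup [Finite Q] (hc : ∀ s, cls (mk s) = siteClass s)
    (hmk : Function.Surjective mk) (b : PauliBasis) (t : ℕ) (c : Q → ZMod 2) :
    Finsupp.equivFunOnFinite.symm (full mk cls (offset b (t + 6 : ℕ)) c) ∈
      cssGroup (quotRound mk) b (t + 6) := by
  refine full_reached hc
    (P := fun t p => Finsupp.equivFunOnFinite.symm p ∈ cssGroup (quotRound mk) b t)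
    (κs := fun t => offset b (t : ℕ)) (fun t => ?_) ?_ (fun t => ?_) ?_ c t
  · push_cast; exact offset_succ b t
  · intro t p m hm hp
    have h1 : Finsupp.equivFunOnFinite.symm m ∈ measSpan (quotRound mk t) b :=
      (mem_measSpan_quotRound hc hmk).2 hm
    have h2 : measSpan (quotRound mk t) b ≤ cssGroup (quotRound mk) b t := by
      cases t with
      | zero => exact le_rfl
      | succ t => exact le_sup_right
    have h3 : Finsupp.equivFunOnFinite.symm (p + m) =
        Finsupp.equivFunOnFinite.symm p + Finsupp.equivFunOnFinite.symm m := Finsupp.ext fun _ => rfl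
    rw [h3]
    exact Submodule.add_mem _ hp (h2 h1)
  · have h3 : Finsupp.equivFunOnFinite.symm (0 : Q → ZMod 2) = 0 := Finsupp.ext fun _ => rfl
    rw [h3]
    exact Submodule.zero_mem _
  · intro t p p' hp' h1 h2
    have h3 : Finsupp.equivFunOnFinite.symm (p' + p) ∈ measSpan (quotRound mk (t + 1 : ℕ)) b :=
      (mem_measSpan_quotRound hc hmk).2 h2
    have h4 : Finsupp.equivFunOnFinite.symm p' ∈
        dotPerp (measSpan (quotRound mk (t + 1 : ℕ)) b.swap) :=
      (mem_dotPerp_quotRound hc hmk).2 h1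
    refine Submodule.mem_sup.2 ⟨_, ⟨hp', h4⟩, _, h3, ?_⟩
    ext q
    change p' q + (p' q + p q) = p q
    rw [← add_assoc, zmod_two_add_self, zero_add]

variable (mk cls κ) in
/-- The parametrisation of the stabilizers by the qubits of even class. -/
noncomputable def fullMap :
    ({q : Q // Even (cls q + κ).val} → ZMod 2) →ₗ[ZMod 2] (Q → ZMod 2) where
  toFun c := full mk cls κ fun q => if h : Even (cls q + κ).val then c ⟨q, h⟩ else 0
  map_add' c c' := by
    rw [← full_add]
    congr 1
    funext q
    rw [Pi.add_apply]
    split_ifs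
    · rfl
    · rw [add_zero]
  map_smul' a c := by
    funext q
    refine Eq.trans ?_ (lsum_smul mk _ a _ q)
    refine lsum_congr mk fun d _ => ?_
    rw [Pi.smul_apply]
    split_ifs
    · rfl
    · rw [smul_zero]

theorem fullMap_apply (c : {q : Q // Even (cls q + κ).val} → ZMod 2) : fullMap mk cls κ c =
    full mk cls κ fun q => if h : Even (cls q + κ).val then c ⟨q, h⟩ else 0 := rfl

theorem fullMap_restrict (hc : ∀ s, cls (mk s) = siteClass s) (c : Q → ZMod 2) :
    fullMap mk cls κ (fun q => c q) = full mk cls κ c := by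
  change full mk cls κ (fun q => if Even (cls q + κ).val then c q else 0) = _
  exact full_congr hc fun s hs => if_pos hs

theorem cssGroup_quotRound [Finite Q] (hc : ∀ s, cls (mk s) = siteClass s)
    (hmk : Function.Surjective mk) (b : PauliBasis) (t : ℕ) (ht : 6 ≤ t) :
    cssGroup (quotRound mk) b t = (LinearMap.range (fullMap mk cls (offset b t))).map
      (Finsupp.linearEquivFunOnFinite (ZMod 2) (ZMod 2) Q).symm.toLinearMap := by
  obtain ⟨t, rfl⟩ := Nat.exists_eq_add_of_le' ht
  apply le_antisymm
  · intro v hv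
    obtain ⟨c, h⟩ := exists_full_of_mem_cssGroup hc hmk b _ v hv
    refine ⟨v, ⟨fun q => c q, by rw [fullMap_restrict hc, h]⟩,
      (Finsupp.linearEquivFunOnFinite (ZMod 2) (ZMod 2) Q).symm_apply_apply v⟩
  · rintro _ ⟨_, ⟨c, rfl⟩, rfl⟩
    rw [fullMap_apply]
    exact full_mem_cssGroup hc hmk b t _

/-- The labels of basis `X` are the qubits of even shifted class and those of basis `Z` the others.
Together there are as many labels as qubits, so the missing rank is the total dimension `k + k` of
the relations. -/
theorem encodesFrom_quotRound [Finite Q] (hc : ∀ s, cls (mk s) = siteClass s)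
    (hmk : Function.Surjective mk) {k : ℕ}
    (hk : ∀ κ, Module.finrank (ZMod 2) (LinearMap.ker (fullMap mk cls κ)) = k) (T : ℕ)
    (hT : 6 ≤ T) : EncodesFrom (fun t => measGroup (quotRound mk t)) T (k + k) := by
  have := Fintype.ofFinite Q
  refine encodesFrom_of_finrank (fun _ => rfl) (commutingRound_quotRound hc hmk) fun t ht => ?_
  rw [cssGroup_quotRound hc hmk _ _ (hT.trans ht), cssGroup_quotRound hc hmk _ _ (hT.trans ht),
    LinearEquiv.finrank_map_eq, LinearEquiv.finrank_map_eq]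
  have h1 := LinearMap.finrank_range_add_finrank_ker (fullMap mk cls (offset .X t))
  have h2 := LinearMap.finrank_range_add_finrank_ker (fullMap mk cls (offset .Z t))
  rw [hk, Module.finrank_fintype_fun_eq_card] at h1 h2
  have h3 := Fintype.card_subtype_compl fun q : Q => Even (cls q + offset .X t).val
  have h4 : Fintype.card {q : Q // Even (cls q + offset .Z t).val} =
      Fintype.card {q : Q // ¬ Even (cls q + offset .X t).val} := by
    refine Fintype.card_congr (Equiv.subtypeEquivRight fun q => ?_)
    have h3 : offset .Z t = offset .X t + 13 := offset_swap .X t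
    rw [h3, ← add_assoc, even_val_add_thirteen]
  have h5 := Fintype.card_subtype_le fun q : Q => Even (cls q + offset .X t).val
  rw [Nat.card_eq_fintype_card]
  omega

/-! ### The dimension of the space of relations -/

theorem exists_eq_add_of_cls_eq (hc : ∀ s, cls (mk s) = siteClass s)
    (hmk : Function.Surjective mk) {q r : Q} (h : cls q = cls r) :
    ∃ i j : ℤ, r = q + i • mk (3, 1) + j • mk (-2, 8) := by
  obtain ⟨s, hs⟩ := hmk (r - q)
  have h0 : siteClass s = 0 := by rw [← hc, hs, map_sub, h, sub_self]
  obtain ⟨m, hm⟩ := (ZMod.intCast_zmod_eq_zero_iff_dvd _ 26).1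
    (h0 : ((s.1 - 3 * s.2 : ℤ) : ZMod 26) = 0)
  refine ⟨s.2 + 8 * m, -m, ?_⟩
  have h1 : s = (s.2 + 8 * m) • ((3, 1) : Site) + (-m) • ((-2, 8) : Site) := by
    ext
    · simp; push_cast at hm; omega
    · simp; ring
  rw [← map_zsmul, ← map_zsmul, add_assoc, ← map_add, ← h1, hs, add_sub_cancel]

/-- The labels in the kernel of the parametrisation, along the orbit of a label of class 4. -/
theorem full_eq_zero_orbit (hc : ∀ s, cls (mk s) = siteClass s) {c : Q → ZMod 2}
    (h : full mk cls κ c = 0) {s : Q} (hs : cls s + κ = 4) (i j : ℤ) :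
    c (s + i • mk (3, 1) + j • mk (-2, 8)) = c (s + i • mk (3, 1)) ∧
      c (s + i • mk (3, 1)) + c (s + (i + 1) • mk (3, 1)) + c (s + (i + 2) • mk (3, 1)) = 0 := by
  have hcl : ∀ i j : ℤ, cls (s + i • mk (3, 1) + j • mk (-2, 8)) + κ = 4 := fun i j => by
    have h1 : siteClass (3, 1) = 0 := rfl
    have h2 : siteClass (-2, 8) = 0 := rfl
    rw [map_add, map_add, map_zsmul, map_zsmul, hc, hc, h1, h2, smul_zero, smul_zero, add_zero,
      add_zero, hs]
  constructor
  · induction j using int_induction with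
    | h0 => simp
    | hs n ih =>
      rw [← ih, ← full_eq_zero_shift hc h (hcl i n), add_smul, one_smul, add_assoc]
      simp only [add_assoc]
    | hp n ih =>
      rw [← ih, ← full_eq_zero_shift hc h (hcl i (n - 1)), add_assoc _ _ (mk (-2, 8)), sub_smul,
        one_smul, sub_add_cancel]
  · have h0 := hcl i 0
    rw [zero_smul, add_zero] at h0
    have := full_eq_zero_tri hc h h0
    rw [show (6, 2) = (2 : ℤ) • ((3, 1) : Site) from rfl, map_zsmul, add_assoc s, add_assoc s,
      ← add_smul] at this
    rwa [add_smul i 1, one_smul]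

/-- The qubits of class 4 form one orbit under `(3, 1)` and `(-2, 8)`. Invariance under the latter
and the three-term recursion along the former propagate two zeros to the whole orbit, and class 4
determines the other labels. -/
theorem full_eq_zero_of_two (hc : ∀ s, cls (mk s) = siteClass s) (hmk : Function.Surjective mk)
    {c : Q → ZMod 2} (h : full mk cls κ c = 0) {s : Q} (hs : cls s + κ = 4) (h0 : c s = 0)
    (h1 : c (s + mk (3, 1)) = 0) {r : Q} (hr : Even (cls r + κ).val) : c r = 0 := by
  have key : ∀ i : ℤ, c (s + i • mk (3, 1)) = 0 ∧ c (s + (i + 1) • mk (3, 1)) = 0 := by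
    intro i
    induction i using int_induction with
    | h0 => simpa using ⟨h0, h1⟩
    | hs n ih =>
      have h2 := (full_eq_zero_orbit hc h hs n 0).2
      rw [ih.1, ih.2, zero_add, zero_add] at h2
      exact ⟨ih.2, by rwa [add_assoc]⟩
    | hp n ih =>
      have h2 := (full_eq_zero_orbit hc h hs (n - 1) 0).2
      rw [sub_add_cancel, show n - 1 + 2 = n + 1 by ring, ih.1, ih.2, add_zero, add_zero] at h2
      exact ⟨h2, by rw [sub_add_cancel]; exact ih.1⟩
  refine full_eq_zero_even hc h (fun r hr => ?_) hr
  obtain ⟨i, j, rfl⟩ := exists_eq_add_of_cls_eq hc hmk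
    (add_right_cancel (hs.trans hr.symm) : cls s = cls r)
  rw [(full_eq_zero_orbit hc h hs i j).1]
  exact (key i).1

theorem exists_cls_add_eq_four (hc : ∀ s, cls (mk s) = siteClass s) (κ : ZMod 26) :
    ∃ s, cls s + κ = 4 := by
  refine ⟨mk (((4 - κ).val : ℤ), 0), ?_⟩
  rw [hc, siteClass, AddMonoidHom.coe_mk, ZeroHom.coe_mk]
  simp

theorem finrank_ker_fullMap_eq_zero (hc : ∀ s, cls (mk s) = siteClass s)
    (hmk : Function.Surjective mk) {a : ℕ} (ha : ¬ 3 ∣ a) {c : ℤ}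
    (h0 : mk ((a : ℤ) • (3, 1) + c • (-2, 8)) = 0) (κ : ZMod 26) :
    Module.finrank (ZMod 2) (LinearMap.ker (fullMap mk cls κ)) = 0 := by
  suffices h : LinearMap.ker (fullMap mk cls κ) = ⊥ by rw [h, finrank_bot]
  rw [LinearMap.ker_eq_bot']
  intro u hu
  set u' : Q → ZMod 2 := fun q => if h : Even (cls q + κ).val then u ⟨q, h⟩ else 0 with hu'
  have hz : full mk cls κ u' = 0 := hu
  obtain ⟨s, hs⟩ := exists_cls_add_eq_four hc κ
  have hz' := full_eq_zero_orbit hc hz hs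
  let f : ℤ → ZMod 2 := fun i => u' (s + i • mk (3, 1))
  have htri : ∀ i, f i + f (i + 1) + f (i + 2) = 0 := fun i => (hz' i 0).2
  -- Two consecutive three-term relations differ by `f i + f (i + 3)`.
  have h3 : Function.Periodic f 3 := fun i => by
    have e1 := htri i
    have e2 := htri (i + 1)
    rw [show i + 1 + 1 = i + 2 by ring, show i + 1 + 2 = i + 3 by ring] at e2
    linear_combination e2 - e1 + zmod_two_add_self (f i) - zmod_two_add_self (f i)
  have h4 : Function.Periodic f a := fun i => by
    -- On the torus `a` steps along `(3, 1)` amount to `-c` steps along `(-2, 8)`, which do not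
    -- change the label.
    change u' (s + (i + a) • mk (3, 1)) = u' (s + i • mk (3, 1))
    rw [← (hz' (i + a) c).1, add_smul]
    congr 1
    rw [map_add, map_zsmul, map_zsmul] at h0
    rw [add_assoc, add_assoc, h0, add_zero]
  have h1 : Function.Periodic f 1 := by
    have hcop : IsCoprime (3 : ℤ) a := by
      rw [show (3 : ℤ) = (3 : ℕ) from rfl, Nat.isCoprime_iff_coprime]
      exact (Nat.Prime.coprime_iff_not_dvd Nat.prime_three).2 ha
    obtain ⟨x, y, hxy⟩ := hcop
    rw [← hxy]
    exact (h3.int_mul x).add_period (h4.int_mul y)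
  -- By coprimality `f` is constant, and the relation reads `f i + f i + f i = 0`.
  have hf : ∀ i, f i = 0 := fun i => by
    have := htri i
    rw [h1, show i + 2 = i + 1 + 1 by ring, h1, h1, zmod_two_add_self, zero_add] at this
    exact this
  funext ⟨q, hq⟩
  have := full_eq_zero_of_two hc hmk hz hs (by simpa [f] using hf 0) (by simpa [f] using hf 1) hq
  simpa [hu', hq] using this

theorem finrank_ker_fullMap_eq_two (hc : ∀ s, cls (mk s) = siteClass s)
    (hmk : Function.Surjective mk) (col : Q →+ ZMod 3)
    (hcol : ∀ s, col (mk s) = ((s.1 + s.2 : ℤ) : ZMod 3)) (κ : ZMod 26) :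
    Module.finrank (ZMod 2) (LinearMap.ker (fullMap mk cls κ)) = 2 := by
  obtain ⟨s, hs, hs0⟩ : ∃ s, cls s + κ = 4 ∧ col s = 0 := by
    obtain ⟨s, hs⟩ := exists_cls_add_eq_four hc κ
    -- A step along `(3, 1)` keeps the class and raises the colour by one, as `3 + 1` is 1 modulo 3.
    -- So the starting point can be given colour 0.
    refine ⟨s + (-((col s).val : ℤ)) • mk (3, 1), ?_, ?_⟩
    · have h1 : siteClass (3, 1) = 0 := rfl
      rw [map_add, map_zsmul, hc, h1, smul_zero, add_zero, hs]
    · have h1 : ((3 + 1 : ℤ) : ZMod 3) = 1 := rfl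
      rw [map_add, map_zsmul, hcol, h1]
      simp
  have hs' : cls (s + mk (3, 1)) + κ = 4 := by
    have h1 : siteClass (3, 1) = 0 := rfl
    rw [map_add, hc, h1, add_zero, hs]
  have h4 : Even (cls s + κ).val := by rw [hs]; decide
  have h4' : Even (cls (s + mk (3, 1)) + κ).val := by rw [hs']; decide
  let ev : LinearMap.ker (fullMap mk cls κ) →ₗ[ZMod 2] ZMod 2 × ZMod 2 :=
    { toFun := fun u => (u.1 ⟨s, h4⟩, u.1 ⟨s + mk (3, 1), h4'⟩)
      map_add' := fun _ _ => rfl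
      map_smul' := fun _ _ => rfl }
  have hbij : Function.Bijective ev := by
    constructor
    · rw [injective_iff_map_eq_zero]
      rintro ⟨u, hu⟩ h
      have h1 : u ⟨s, h4⟩ = 0 := congrArg Prod.fst h
      have h2 : u ⟨s + mk (3, 1), h4'⟩ = 0 := congrArg Prod.snd h
      refine Subtype.ext (funext fun ⟨q, hq⟩ => ?_)
      have := full_eq_zero_of_two (κ := κ)
        (c := fun q => if h : Even (cls q + κ).val then u ⟨q, h⟩ else 0) hc hmk hu hs ((dif_pos h4).trans h1)
        ((dif_pos h4').trans h2) hq
      simpa [hq] using this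
    · rintro ⟨α, β⟩
      -- The coloured sum of regions vanishes. Its labels agree with the colouring at class 4, which
      -- has age 3, so that `α` and `β` are recovered there; in particular different pairs give
      -- different relations.
      obtain ⟨c, hc1, hc2⟩ := exists_full_eq (κ := κ) hc (fun s =>
        (![α, β, α + β] : ZMod 3 → ZMod 2) (col s + (regionAge (cls s + κ) : ZMod 3))) 0
        fun _ => ⟨fun _ => rfl, fun _ _ => rfl⟩
      rw [slice_colouring hc col hcol, add_zero] at hc1
      refine ⟨⟨fun q => c q, ?_⟩, ?_⟩
      · rw [LinearMap.mem_ker, fullMap_restrict hc, hc1]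
      · have e1 := hc2 s (by rw [hs]; decide) (by rw [hs]; decide)
        have e2 := hc2 (s + mk (3, 1)) (by rw [hs']; decide) (by rw [hs']; decide)
        refine Prod.ext (e1.trans ?_) (e2.trans ?_)
        · simp only [hs, hs0]; rfl
        · rw [hs', map_add, hs0, hcol]; rfl
  rw [(LinearEquiv.ofBijective ev hbij).finrank_eq]
  simp

end Quotient

/-! ## The Floquetified code on a torus -/

section Torus

variable {a b : ℕ} {c : ℤ}

theorem mem_tileLattice {p : Site} : p ∈ tileLattice a b c ↔
    ∃ u v : ℤ, p = (u * a) • ((3, 1) : Site) + (u * c + v * b) • ((-2, 8) : Site) := by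
  rw [tileLattice, AddSubgroup.mem_closure_pair]
  refine exists_congr fun u => exists_congr fun v => ?_
  rw [eq_comm, smul_add, smul_smul, smul_smul, smul_smul, add_assoc, ← add_smul]

theorem siteClass_of_mem_tileLattice {p : Site} (hp : p ∈ tileLattice a b c) : siteClass p = 0 := by
  obtain ⟨u, v, rfl⟩ := mem_tileLattice.1 hp
  have h1 : siteClass (3, 1) = 0 := rfl
  have h2 : siteClass (-2, 8) = 0 := rfl
  rw [map_add, map_zsmul, map_zsmul, h1, h2, smul_zero, smul_zero, add_zero]

/-- The determinant of `(3, 1)` and `(-2, 8)` is 26, and the residue of `x - 3 y` enumerates the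
tile. -/
theorem exists_tile_coordinates (s : Site) :
    ∃ n i j : ℤ, (0 ≤ n ∧ n < 26) ∧ s = (n, 0) + i • ((3, 1) : Site) + j • ((-2, 8) : Site) := by
  refine ⟨(s.1 - 3 * s.2) % 26, s.2 + 8 * ((s.1 - 3 * s.2) / 26), -((s.1 - 3 * s.2) / 26),
    ⟨by omega, by omega⟩, ?_⟩
  ext
  · simp; omega
  · simp; omega

theorem card_torus (ha : 0 < a) (hb : 0 < b) : Nat.card (Site ⧸ tileLattice a b c) = 26 * a * b := by
  let f : Fin 26 × Fin a × Fin b → Site ⧸ tileLattice a b c := fun x =>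
    QuotientAddGroup.mk ((((x.1 : ℕ) : ℤ), (0 : ℤ)) + ((x.2.1 : ℕ) : ℤ) • ((3, 1) : Site) +
      ((x.2.2 : ℕ) : ℤ) • ((-2, 8) : Site))
  have hf : Function.Bijective f := by
    constructor
    · rintro ⟨⟨n, hn⟩, ⟨i, hi⟩, ⟨j, hj⟩⟩ ⟨⟨n', hn'⟩, ⟨i', hi'⟩, ⟨j', hj'⟩⟩ h
      obtain ⟨u, v, huv⟩ := mem_tileLattice.1 (QuotientAddGroup.eq.1 h)
      have h1 := congrArg Prod.fst huv
      have h2 := congrArg Prod.snd huv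
      simp only [Prod.fst_add, Prod.snd_add, Prod.fst_neg, Prod.snd_neg, Prod.smul_fst,
        Prod.smul_snd, smul_eq_mul] at h1 h2
      obtain rfl : n = n' := by omega
      have h3 : (i' : ℤ) - i = u * a := by linarith
      have h4 : (j' : ℤ) - j = u * c + v * b := by linarith
      have hu : u = 0 := by
        by_contra hu
        have : (a : ℤ) ≤ |u * a| := by
          rw [abs_mul, Nat.abs_cast]
          exact le_mul_of_one_le_left (by positivity) (Int.one_le_abs hu)
        rw [← h3] at this
        rcases abs_cases ((i' : ℤ) - i) with h | h <;> omega
      have hv : v = 0 := by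
        by_contra hv
        have : (b : ℤ) ≤ |v * b| := by
          rw [abs_mul, Nat.abs_cast]
          exact le_mul_of_one_le_left (by positivity) (Int.one_le_abs hv)
        rw [hu, zero_mul, zero_add] at h4
        rw [← h4] at this
        rcases abs_cases ((j' : ℤ) - j) with h | h <;> omega
      rw [hu, zero_mul] at h3
      rw [hu, hv, zero_mul, zero_mul] at h4
      obtain rfl : i = i' := by omega
      obtain rfl : j = j' := by omega
      rfl
    · intro q
      obtain ⟨s, rfl⟩ := QuotientAddGroup.mk_surjective q
      obtain ⟨n, I, J, ⟨hn0, hn⟩, rfl⟩ := exists_tile_coordinates s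
      have ha' : (0 : ℤ) < a := by exact_mod_cast ha
      have hb' : (0 : ℤ) < b := by exact_mod_cast hb
      have e1 := Int.emod_nonneg I ha'.ne'
      have e2 := Int.emod_lt_of_pos I ha'
      have e3 := Int.emod_nonneg (J - I / a * c) hb'.ne'
      have e4 := Int.emod_lt_of_pos (J - I / a * c) hb'
      refine ⟨⟨⟨n.toNat, by omega⟩, ⟨(I % a).toNat, by omega⟩,
        ⟨((J - I / a * c) % b).toNat, by omega⟩⟩, QuotientAddGroup.eq.2 (mem_tileLattice.2
          ⟨I / a, (J - I / a * c) / b, ?_⟩)⟩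
      dsimp only
      rw [Int.toNat_of_nonneg hn0, Int.toNat_of_nonneg e1, Int.toNat_of_nonneg e3]
      have h1 := Int.emod_add_mul_ediv I a
      have h2 := Int.emod_add_mul_ediv (J - I / a * c) b
      have h3 : I / a * a = I - I % a := by linarith
      have h4 : I / a * c + (J - I / a * c) / b * b = J - (J - I / a * c) % b := by linarith
      rw [h3, h4, sub_smul, sub_smul]
      abel
  rw [← Nat.card_eq_of_bijective f hf]
  simp [mul_assoc]

/-- The residue of a qubit of the torus. -/
noncomputable def torusClass (a b : ℕ) (c : ℤ) : Site ⧸ tileLattice a b c →+ ZMod 26 :=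
  QuotientAddGroup.lift _ siteClass fun _ hp => siteClass_of_mem_tileLattice hp

theorem torusClass_mk (s : Site) :
    torusClass a b c (QuotientAddGroup.mk' (tileLattice a b c) s) = siteClass s := rfl

theorem torusRound_eq (t : ℤ) : torusRound (tileLattice a b c) t =
    quotRound (QuotientAddGroup.mk' (tileLattice a b c)) t := rfl

/-- The dimension count is valid from timestep 6 on, so in particular once a full period is
complete. -/
theorem torus_encodesFrom_zero (ha : 0 < a) (hb : 0 < b) (h : ¬ 3 ∣ a) :
    EncodesFrom (torusSchedule (tileLattice a b c)) 12 0 := by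
  have : Finite (Site ⧸ tileLattice a b c) :=
    Nat.finite_of_card_ne_zero (by rw [card_torus ha hb]; positivity)
  refine encodesFrom_quotRound (k := 0) torusClass_mk (QuotientAddGroup.mk'_surjective _)
    (finrank_ker_fullMap_eq_zero torusClass_mk (QuotientAddGroup.mk'_surjective _) h (c := c) ?_)
    12 (by norm_num)
  exact (QuotientAddGroup.eq_zero_iff _).2 (AddSubgroup.subset_closure (Set.mem_insert _ _))

theorem torus_encodesFrom_four (ha : 0 < a) (hb : 0 < b) (h : 3 ∣ a) :
    EncodesFrom (torusSchedule (tileLattice a b c)) 6 4 := by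
  have : Finite (Site ⧸ tileLattice a b c) :=
    Nat.finite_of_card_ne_zero (by rw [card_torus ha hb]; positivity)
  let φ : Site →+ ZMod 3 :=
    (Int.castAddHom (ZMod 3)).comp (AddMonoidHom.fst ℤ ℤ + AddMonoidHom.snd ℤ ℤ)
  -- The colour `x + y` changes by 4 along `(3, 1)` and by 6 along `(-2, 8)`, so it descends to the
  -- torus when `3 ∣ a`.
  let col : Site ⧸ tileLattice a b c →+ ZMod 3 := QuotientAddGroup.lift _ φ fun p hp => by
    obtain ⟨u, v, rfl⟩ := mem_tileLattice.1 hp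
    change ((_ : ℤ) : ZMod 3) = 0
    rw [ZMod.intCast_zmod_eq_zero_iff_dvd]
    obtain ⟨k, rfl⟩ := h
    simp only [AddMonoidHom.add_apply, AddMonoidHom.coe_fst, AddMonoidHom.coe_snd, Prod.fst_add,
      Prod.snd_add, Prod.smul_fst, Prod.smul_snd, smul_eq_mul]
    exact ⟨4 * u * k + 2 * (u * c + v * b), by push_cast; ring⟩
  exact encodesFrom_quotRound (k := 2) torusClass_mk (QuotientAddGroup.mk'_surjective _)
    (finrank_ker_fullMap_eq_two torusClass_mk (QuotientAddGroup.mk'_surjective _) col fun _ => rfl)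
    6 le_rfl

theorem torus_weight (t : ℤ) (m : Measurement (Site ⧸ tileLattice a b c))
    (hm : m ∈ torusRound (tileLattice a b c) t) : (∃ q, m.support = {q}) ∨
      ∃ p q : Site, Adjacent p q ∧ (p : Site ⧸ tileLattice a b c) ≠ q ∧
        (m.support : Set (Site ⧸ tileLattice a b c)) = {↑p, ↑q} := by
  classical
  obtain ⟨_, ⟨s, rfl⟩, rfl⟩ := hm
  dsimp only
  rcases h : partner s t with _ | d
  · exact Or.inl ⟨s, by rw [measAt_of_none h]; simp [Measurement.map]⟩
  · refine Or.inr ⟨s, s + d, ?_, fun he => ?_, by rw [measAt_of_some h]; simp [Measurement.map]⟩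
    · rw [Adjacent, add_sub_cancel_left]
      exact (partner_spec h).2.2
    · rw [partner_eq] at h
      refine mk_ne_zero (mk := QuotientAddGroup.mk' (tileLattice a b c)) torusClass_mk h ?_
      rw [QuotientAddGroup.mk_add] at he
      exact left_eq_add.1 he

/-- Comparing groups rather than sets of measurements requires an invariant: at time 0 the
single-qubit `X` at the origin is measured, while at times 1 to 12 every X-type element takes equal
values at the origin and its partner. -/
theorem torus_hasPeriod : HasPeriod (torusSchedule (tileLattice a b c)) 13 := by
  classical
  refine ⟨by norm_num, fun t => ?_, fun p hp hp' => ⟨0, fun h => ?_⟩⟩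
  · rw [torusSchedule, torusSchedule, torusRound, torusRound, Nat.cast_ofNat, bulkRound_add_thirteen]
  · have hs := QuotientAddGroup.mk'_surjective (tileLattice a b c)
    have h' := congrArg vecs h
    rw [torusSchedule, torusSchedule, vecs_measGroup, vecs_measGroup, torusRound_eq,
      torusRound_eq, zero_add] at h'
    have h1 : partner 0 0 = none := by decide
    have h2 : ((indic {0}, 0) : (Site ⧸ tileLattice a b c →₀ ZMod 2) × _) ∈
        (measSpan (quotRound (QuotientAddGroup.mk' (tileLattice a b c)) 0) .X).prod
          (measSpan (quotRound (QuotientAddGroup.mk' (tileLattice a b c)) 0) .Z) := by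
      refine ⟨Submodule.subset_span ⟨_, ⟨_, ⟨0, rfl⟩, rfl⟩, ?_, ?_⟩, Submodule.zero_mem _⟩
      · change basis 0 0 = _; decide
      · dsimp only
        rw [measAt_of_none h1]
        simp [Measurement.map]
    rw [← h'] at h2
    have h3 := (mem_measSpan_quotRound torusClass_mk hs).1 h2.1
    obtain ⟨d, hd⟩ := Option.ne_none_iff_exists'.1 (partner_zero_ne_none p hp hp')
    have h4 : partnerK (torusClass a b c 0 + offset .X p) = some d := by
      rw [← map_zero (QuotientAddGroup.mk' (tileLattice a b c)), torusClass_mk,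
        partnerK_siteClass_add_offset, hd]
    have h5 := (h3 0).2 d h4
    rw [indic_apply, indic_apply, if_pos (Finset.mem_singleton_self _), if_neg] at h5
    · exact one_ne_zero h5
    · rw [Finset.mem_singleton, zero_add]
      exact mk_ne_zero torusClass_mk h4

end Torus

theorem torus (a b : ℕ) (c : ℤ) (ha : 0 < a) (hb : 0 < b) :
    Nat.card (Site ⧸ tileLattice a b c) = 26 * a * b ∧
    HasPeriod (torusSchedule (tileLattice a b c)) 13 ∧
    (∀ t, ∀ m ∈ torusRound (tileLattice a b c) t,
      (∃ q, m.support = {q}) ∨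
        ∃ p q : Site, Adjacent p q ∧ (p : Site ⧸ tileLattice a b c) ≠ q ∧
          (m.support : Set (Site ⧸ tileLattice a b c)) = {↑p, ↑q}) ∧
    (3 ∣ a → ∃ T, EncodesFrom (torusSchedule (tileLattice a b c)) T 4) ∧
    (¬ 3 ∣ a → EncodesFrom (torusSchedule (tileLattice a b c)) 12 0) :=
  ⟨card_torus ha hb, torus_hasPeriod, torus_weight,
    fun h => ⟨6, torus_encodesFrom_four ha hb h⟩, torus_encodesFrom_zero ha hb⟩

/-! ## Webs of one colour -/

/-- A connected graph on `n + 1` vertices with at most `n` edges is a tree. -/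
theorem pathGraph_isTree (n : ℕ) : (SimpleGraph.pathGraph (n + 1)).IsTree := by
  have hconn := SimpleGraph.pathGraph_connected n
  rw [SimpleGraph.isTree_iff_connected_and_card]
  refine ⟨hconn, le_antisymm ?_ hconn.card_vert_le_card_edgeSet_add_one⟩
  let f : Fin n → (SimpleGraph.pathGraph (n + 1)).edgeSet := fun i =>
    ⟨s(i.castSucc, i.succ), by
      rw [SimpleGraph.mem_edgeSet, SimpleGraph.pathGraph_adj]; exact Or.inl rfl⟩
  have hf : Function.Surjective f := by
    rintro ⟨e, he⟩
    induction e using Sym2.ind with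
    | _ u v =>
      rw [SimpleGraph.mem_edgeSet, SimpleGraph.pathGraph_adj] at he
      rcases he with h | h
      · refine ⟨⟨u, by omega⟩, Subtype.ext ?_⟩
        exact congrArg₂ (fun a b => s(a, b)) (Fin.ext rfl) (Fin.ext h)
      · refine ⟨⟨v, by omega⟩, Subtype.ext (Eq.trans ?_ Sym2.eq_swap)⟩
        exact congrArg₂ (fun a b => s(a, b)) (Fin.ext rfl) (Fin.ext h)
  have := Nat.card_le_card_of_surjective f hf
  simpa using this

section Web

variable {σ : Type} {D : ZXDiagram σ} {b : PauliBasis} {E : Set (Sym2 σ)}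

/-- The condition on the wires of one colour in a Pauli web. -/
def IsWeb (D : ZXDiagram σ) (b : PauliBasis) (E : Set (Sym2 σ)) : Prop :=
  E ⊆ D.wires.edgeSet ∧ ∀ s,
    (D.colour s = b → Even {e | e ∈ E ∧ s ∈ e}.ncard) ∧
    (D.colour s = b.swap → (∀ e ∈ D.wires.edgeSet, s ∈ e → e ∈ E) ∨
      (∀ e ∈ D.wires.edgeSet, s ∈ e → e ∉ E))

theorem isPauliWeb_iff {h : PauliBasis → Set (Sym2 σ)} :
    IsPauliWeb D h ↔ ∀ b, IsWeb D b (h b) := by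
  constructor
  · rintro ⟨h1, h2⟩ b
    refine ⟨h1 b, fun s => ⟨fun hs => hs ▸ (h2 s).1, fun hs => ?_⟩⟩
    have := (h2 s).2
    rwa [hs, PauliBasis.swap_swap] at this
  · intro h'
    exact ⟨fun b => (h' b).1, fun s => ⟨((h' _).2 s).1 rfl,
      ((h' _).2 s).2 (PauliBasis.swap_swap _).symm⟩⟩

open Classical in
/-- Whether the wire between two spiders is highlighted. -/
noncomputable def ind (E : Set (Sym2 σ)) (s s' : σ) : ZMod 2 := if s(s, s') ∈ E then 1 else 0

theorem ind_eq_one : ∀ {s s' : σ}, ind E s s' = 1 ↔ s(s, s') ∈ E := by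
  intro s s'
  unfold ind
  split_ifs with h <;> simp [h]

theorem ind_eq_zero {s s' : σ} : ind E s s' = 0 ↔ s(s, s') ∉ E := by
  unfold ind
  split_ifs with h <;> simp [h]

theorem ind_comm (s s' : σ) : ind E s s' = ind E s' s := by
  rw [ind, ind, Sym2.eq_swap]

theorem ind_congr {τ : Type} {E' : Set (Sym2 τ)} {s s' : σ} {y y' : τ}
    (h : s(s, s') ∈ E ↔ s(y, y') ∈ E') : ind E s s' = ind E' y y' := by
  classical
  rw [ind, ind]
  simp only [h]

/-- With `all_or_none_iff`, this turns the web conditions into linear equations for `ind`. -/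
theorem even_ncard_iff {s : σ} {nb : List σ} (hn : nb.Nodup)
    (hnb : ∀ s', D.wires.Adj s s' ↔ s' ∈ nb) (hE : E ⊆ D.wires.edgeSet) :
    Even {e | e ∈ E ∧ s ∈ e}.ncard ↔ (nb.map (ind E s)).sum = 0 := by
  classical
  have h1 : {e | e ∈ E ∧ s ∈ e} =
      (fun s' => s(s, s')) '' ((nb.filter fun s' => s(s, s') ∈ E).toFinset : Set σ) := by
    ext e
    simp only [Set.mem_ofPred_eq, Set.mem_image, Finset.mem_coe, List.mem_toFinset, List.mem_filter,
      decide_eq_true_eq]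
    constructor
    · rintro ⟨h1, h2⟩
      obtain ⟨s', rfl⟩ := Sym2.mem_iff_exists.1 h2
      exact ⟨s', ⟨(hnb s').1 (hE h1), h1⟩, rfl⟩
    · rintro ⟨s', ⟨-, h⟩, rfl⟩
      exact ⟨h, Sym2.mem_mk_left _ _⟩
  have h2 : ∀ l : List σ, (l.map (ind E s)).sum =
      ((l.filter fun s' => s(s, s') ∈ E).length : ZMod 2) := by
    intro l
    induction l with
    | nil => rfl
    | cons a l ih =>
      rw [List.map_cons, List.sum_cons, ih, List.filter_cons]
      by_cases h : s(s, a) ∈ E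
      · simp [ind, h, add_comm]
      · simp [ind, h]
  rw [h1, Set.ncard_image_of_injective _ fun a b h => Sym2.congr_right.1 h, Set.ncard_coe_finset,
    List.toFinset_card_of_nodup (hn.filter _), h2, ZMod.natCast_eq_zero_iff_even]

theorem all_or_none_iff {s : σ} (hE : E ⊆ D.wires.edgeSet) :
    ((∀ e ∈ D.wires.edgeSet, s ∈ e → e ∈ E) ∨ (∀ e ∈ D.wires.edgeSet, s ∈ e → e ∉ E)) ↔
      ∀ s' s'', D.wires.Adj s s' → D.wires.Adj s s'' → ind E s s' = ind E s s'' := by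
  constructor
  · rintro (h | h) s' s'' h1 h2
    · rw [ind_eq_one.2 (h _ h1 (Sym2.mem_mk_left _ _)), ind_eq_one.2 (h _ h2 (Sym2.mem_mk_left _ _))]
    · rw [ind_eq_zero.2 (h _ h1 (Sym2.mem_mk_left _ _)), ind_eq_zero.2 (h _ h2 (Sym2.mem_mk_left _ _))]
  · intro h
    by_cases h0 : ∃ e ∈ E, s ∈ e
    · obtain ⟨e, he, hs⟩ := h0
      obtain ⟨s', rfl⟩ := Sym2.mem_iff_exists.1 hs
      refine Or.inl fun e' he' hs' => ?_
      obtain ⟨s'', rfl⟩ := Sym2.mem_iff_exists.1 hs'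
      rw [← ind_eq_one, ← h s' s'' (hE he) he', ind_eq_one]
      exact he
    · push Not at h0
      exact Or.inr fun e _ hs he => h0 e he hs

end Web

/-! ## Unfusing spiders into paths -/

/-- Every spider `y` of `D'` is unfused into the path `sp y 0, …, sp y (len y - 1)`. The entries of
`link y` describe the wires at `y`: the position on the path of `y`, the other spider, and the
position on the path of the latter. -/
structure PathUnfusion {σ τ : Type} (D : ZXDiagram σ) (D' : ZXDiagram τ) where
  π : σ → τ
  pos : σ → ℕ
  len : τ → ℕ
  sp : τ → ℕ → σ
  link : τ → List (ℕ × τ × ℕ)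
  pos_lt : ∀ s, pos s < len (π s)
  sp_pos : ∀ s, sp (π s) (pos s) = s
  π_sp : ∀ y m, m < len y → π (sp y m) = y
  pos_sp : ∀ y m, m < len y → pos (sp y m) = m
  colour_eq : ∀ s, D.colour s = D'.colour (π s)
  two_le_len : ∀ y, 2 ≤ len y
  adj_link : ∀ y y', D'.wires.Adj y y' ↔ y' ∈ (link y).map fun l => l.2.1
  nodup_link : ∀ y, ((link y).map fun l => l.2.1).Nodup
  link_ne_nil : ∀ y, link y ≠ []
  link_lt : ∀ y, ∀ l ∈ link y, l.1 < len y
  link_symm : ∀ y, ∀ l ∈ link y, (l.2.2, y, l.1) ∈ link l.2.1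
  adj_sp : ∀ y m, m < len y → ∀ s, D.wires.Adj (sp y m) s ↔
    (m + 1 < len y ∧ s = sp y (m + 1)) ∨ (0 < m ∧ s = sp y (m - 1)) ∨
      ∃ l ∈ link y, l.1 = m ∧ s = sp l.2.1 l.2.2

namespace PathUnfusion

variable {σ τ : Type} {D : ZXDiagram σ} {D' : ZXDiagram τ} (U : PathUnfusion D D')
variable {b : PauliBasis} {E : Set (Sym2 σ)} {E' : Set (Sym2 τ)}

theorem link_lt' {y : τ} {l : ℕ × τ × ℕ} (hl : l ∈ U.link y) : l.2.2 < U.len l.2.1 :=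
  U.link_lt _ _ (U.link_symm y l hl)

theorem adj_of_link {y : τ} {l : ℕ × τ × ℕ} (hl : l ∈ U.link y) : D'.wires.Adj y l.2.1 :=
  (U.adj_link _ _).2 (List.mem_map.2 ⟨l, hl, rfl⟩)

theorem adj_sp_of_link {y : τ} {l : ℕ × τ × ℕ} (hl : l ∈ U.link y) :
    D.wires.Adj (U.sp y l.1) (U.sp l.2.1 l.2.2) :=
  (U.adj_sp _ _ (U.link_lt _ _ hl) _).2 (Or.inr (Or.inr ⟨l, hl, rfl, rfl⟩))

theorem adj_sp_succ {y : τ} {m : ℕ} (hm : m + 1 < U.len y) :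
    D.wires.Adj (U.sp y m) (U.sp y (m + 1)) :=
  (U.adj_sp _ _ (by omega) _).2 (Or.inl ⟨hm, rfl⟩)

theorem link_eq {y : τ} {l l' : ℕ × τ × ℕ} (hl : l ∈ U.link y) (hl' : l' ∈ U.link y)
    (h : l.2.1 = l'.2.1) : l = l' :=
  List.inj_on_of_nodup_map (U.nodup_link y) hl hl' h

theorem sp_inj {y y' : τ} {m m' : ℕ} (hm : m < U.len y) (hm' : m' < U.len y')
    (h : U.sp y m = U.sp y' m') : y = y' ∧ m = m' :=
  ⟨by rw [← U.π_sp y m hm, h, U.π_sp y' m' hm'], by rw [← U.pos_sp y m hm, h, U.pos_sp y' m' hm']⟩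

theorem fibre_eq (y : τ) : U.π ⁻¹' {y} = U.sp y '' Set.Iio (U.len y) := by
  ext s
  constructor
  · rintro rfl
    exact ⟨U.pos s, U.pos_lt s, U.sp_pos s⟩
  · rintro ⟨m, hm, rfl⟩
    exact U.π_sp y m hm

theorem ncard_fibre (y : τ) : (U.π ⁻¹' {y}).ncard = U.len y := by
  have h : Set.InjOn (U.sp y) (Set.Iio (U.len y)) := fun m hm m' hm' h => (U.sp_inj hm hm' h).2
  rw [fibre_eq, h.ncard_image,
    ← Finset.coe_Iio, Set.ncard_coe_finset, Nat.card_Iio]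

theorem exists_link {s s' : σ} (h : D.wires.Adj s s') (hne : U.π s ≠ U.π s') :
    ∃ l ∈ U.link (U.π s), s = U.sp (U.π s) l.1 ∧ s' = U.sp l.2.1 l.2.2 ∧ U.π s' = l.2.1 := by
  rw [← U.sp_pos s, U.adj_sp _ _ (U.pos_lt s)] at h
  rcases h with ⟨h1, h2⟩ | ⟨h1, h2⟩ | ⟨l, hl, h1, h2⟩
  · exact absurd (by rw [h2, U.π_sp _ _ h1]) hne
  · exact absurd (by rw [h2, U.π_sp _ _ ((Nat.sub_le _ _).trans_lt (U.pos_lt s))]) hne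
  · exact ⟨l, hl, by rw [h1, U.sp_pos], h2, by rw [h2, U.π_sp _ _ (U.link_lt' hl)]⟩

theorem isUnfusion : IsUnfusion D D' U.π := by
  refine ⟨U.colour_eq, fun y => ?_, fun y => ?_, fun y y' h => ?_, fun s s' h hne => ?_⟩
  · rw [fibre_eq]
    exact (Set.finite_Iio _).image _
  · obtain ⟨n, hn⟩ : ∃ n, U.len y = n + 1 :=
      ⟨U.len y - 1, by have := U.two_le_len y; omega⟩
    let e : SimpleGraph.pathGraph (n + 1) ≃g D.wires.induce (U.π ⁻¹' {y}) :=
      { toFun := fun m => ⟨U.sp y m, U.π_sp y m (by omega)⟩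
        invFun := fun s => ⟨U.pos s.1, by
          have h1 := U.pos_lt s.1
          have h2 : U.π s.1 = y := s.2
          rwa [h2, hn] at h1⟩
        left_inv := fun m => Fin.ext (U.pos_sp y m (by omega))
        right_inv := fun s => Subtype.ext (by
          have h2 : U.π s.1 = y := s.2
          change U.sp y (U.pos s.1) = s.1
          have h3 := U.sp_pos s.1
          rwa [h2] at h3)
        map_rel_iff' := by
          intro m m'
          change D.wires.Adj (U.sp y m) (U.sp y m') ↔ _
          rw [U.adj_sp _ _ (by omega), SimpleGraph.pathGraph_adj]
          constructor
          · rintro (⟨h1, h2⟩ | ⟨h1, h2⟩ | ⟨l, hl, h1, h2⟩)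
            · have := (U.sp_inj (by omega) h1 h2).2; omega
            · have := (U.sp_inj (by omega) (by omega) h2).2; omega
            · have := (U.sp_inj (by omega) (U.link_lt' hl) h2).1
              exact absurd (this ▸ U.adj_of_link hl) (D'.wires.loopless.irrefl _)
          · rintro (h | h)
            · exact Or.inl ⟨by omega, by rw [h]⟩
            · exact Or.inr (Or.inl ⟨by omega, by rw [← h]; rfl⟩) }
    exact e.isTree_iff.1 (pathGraph_isTree n)
  · obtain ⟨l, hl, rfl⟩ := List.mem_map.1 ((U.adj_link _ _).1 h)
    refine ⟨(U.sp y l.1, U.sp l.2.1 l.2.2), ⟨U.π_sp _ _ (U.link_lt _ _ hl),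
      U.π_sp _ _ (U.link_lt' hl), U.adj_sp_of_link hl⟩, ?_⟩
    rintro ⟨s, s'⟩ ⟨h1, h2, h3⟩
    dsimp only at h1 h2 h3
    subst h1
    obtain ⟨l', hl', h4, h5, h6⟩ := U.exists_link h3 (by rw [h2]; exact h.ne)
    obtain rfl := U.link_eq hl hl' (by rw [← h2, h6])
    rw [h5, ← h4]
  · obtain ⟨l, hl, -, -, h6⟩ := U.exists_link h hne
    rw [h6]
    exact U.adj_of_link hl

/-- The wires of the unfused diagram. -/
theorem edge_cases {e : Sym2 σ} (he : e ∈ D.wires.edgeSet) :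
    (∃ y, ∃ l ∈ U.link y, e = s(U.sp y l.1, U.sp l.2.1 l.2.2)) ∨
      ∃ y m, m + 1 < U.len y ∧ e = s(U.sp y m, U.sp y (m + 1)) := by
  induction e using Sym2.ind with
  | _ s s' =>
    rw [SimpleGraph.mem_edgeSet, ← U.sp_pos s, U.adj_sp _ _ (U.pos_lt s)] at he
    have hp := U.pos_lt s
    rcases he with ⟨h1, h2⟩ | ⟨h1, h2⟩ | ⟨l, hl, h1, h2⟩
    · exact Or.inr ⟨_, _, h1, by rw [← h2, U.sp_pos]⟩
    · refine Or.inr ⟨U.π s, U.pos s - 1, by omega, ?_⟩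
      rw [← h2, Nat.sub_add_cancel h1, U.sp_pos, Sym2.eq_swap]
    · exact Or.inl ⟨_, l, hl, by rw [h1, U.sp_pos, ← h2]⟩

/-- The web on the original diagram. -/
def push (E : Set (Sym2 σ)) : Set (Sym2 τ) :=
  {e | ∃ y, ∃ l ∈ U.link y, e = s(y, l.2.1) ∧ s(U.sp y l.1, U.sp l.2.1 l.2.2) ∈ E}

theorem mem_push {y : τ} {l : ℕ × τ × ℕ} (hl : l ∈ U.link y) :
    s(y, l.2.1) ∈ U.push E ↔ s(U.sp y l.1, U.sp l.2.1 l.2.2) ∈ E := by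
  constructor
  · rintro ⟨y', l', hl', h1, h2⟩
    rcases Sym2.eq_iff.1 h1 with ⟨rfl, h⟩ | ⟨rfl, h⟩
    · rwa [U.link_eq hl hl' h]
    · have h3 := U.link_symm _ _ hl'
      rw [Sym2.eq_swap] at h2
      have := U.link_eq hl h3 h
      rw [this]
      exact h2
  · exact fun h => ⟨y, l, hl, rfl, h⟩

theorem push_subset : U.push E ⊆ D'.wires.edgeSet := by
  rintro _ ⟨y, l, hl, rfl, -⟩
  exact U.adj_of_link hl

theorem finite_push (hE : E.Finite) : (U.push E).Finite := by
  refine (hE.image (Sym2.map U.π)).subset ?_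
  rintro _ ⟨y, l, hl, rfl, h⟩
  refine ⟨_, h, ?_⟩
  rw [Sym2.map_mk, U.π_sp _ _ (U.link_lt _ _ hl), U.π_sp _ _ (U.link_lt' hl)]

/-- The sum of the highlightings of the wires at `y` that satisfy `P`. -/
noncomputable def legSum (E' : Set (Sym2 τ)) (y : τ) (P : ℕ → Prop) [DecidablePred P] : ZMod 2 :=
  ((U.link y).map fun l => if P l.1 then ind E' y l.2.1 else 0).sum

theorem legSum_le_zero (E' : Set (Sym2 τ)) (y : τ) :
    U.legSum E' y (· ≤ 0) = U.legSum E' y (· = 0) := by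
  unfold legSum
  simp only [Nat.le_zero]

/-- Partial leg sums grow by the legs at the next position; this recursion solves the parity
conditions along a path. -/
theorem legSum_le_succ (E' : Set (Sym2 τ)) (y : τ) (m : ℕ) :
    U.legSum E' y (· ≤ m + 1) = U.legSum E' y (· ≤ m) + U.legSum E' y (· = m + 1) := by
  rw [legSum, legSum, legSum, ← List.sum_map_add]
  congr 1
  refine List.map_congr_left fun l _ => ?_
  rcases lt_trichotomy l.1 (m + 1) with h | h | h
  · rw [if_pos h.le, if_pos (by omega), if_neg h.ne, add_zero]
  · rw [if_pos h.le, if_neg (by omega), if_pos h, zero_add]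
  · rw [if_neg (by omega), if_neg (by omega), if_neg (by omega), add_zero]

theorem isWeb_iff : IsWeb D' b E' ↔ E' ⊆ D'.wires.edgeSet ∧ ∀ y,
    (D'.colour y = b → U.legSum E' y (fun _ => True) = 0) ∧
    (D'.colour y = b.swap → ∀ l ∈ U.link y, ∀ l' ∈ U.link y,
      ind E' y l.2.1 = ind E' y l'.2.1) := by
  refine and_congr_right fun hE => forall_congr' fun y => and_congr ?_ ?_
  · rw [even_ncard_iff (U.nodup_link y) (U.adj_link y) hE]
    simp [legSum, Function.comp_def]
  · rw [all_or_none_iff hE]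
    simp only [U.adj_link, List.mem_map]
    refine imp_congr_right fun _ => ⟨fun h l hl l' hl' => h _ _ ⟨l, hl, rfl⟩ ⟨l', hl', rfl⟩, ?_⟩
    rintro h _ _ ⟨l, hl, rfl⟩ ⟨l', hl', rfl⟩
    exact h l hl l' hl'

/-- The neighbours of a spider on a path. -/
def nbrs (y : τ) (m : ℕ) : List σ :=
  (if m + 1 < U.len y then [U.sp y (m + 1)] else []) ++
    ((if 0 < m then [U.sp y (m - 1)] else []) ++
      ((U.link y).filter fun l => l.1 = m).map fun l => U.sp l.2.1 l.2.2)

theorem mem_nbrs {y : τ} {m : ℕ} (hm : m < U.len y) (s : σ) :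
    D.wires.Adj (U.sp y m) s ↔ s ∈ U.nbrs y m := by
  rw [U.adj_sp y m hm, nbrs, List.mem_append, List.mem_append]
  refine or_congr ?_ (or_congr ?_ ?_)
  · split_ifs with h <;> simp [h]
  · split_ifs with h <;> simp [h]
  · simp only [List.mem_map, List.mem_filter, decide_eq_true_eq, and_assoc, eq_comm (a := s)]

theorem nodup_nbrs {y : τ} {m : ℕ} (hm : m < U.len y) : (U.nbrs y m).Nodup := by
  have hne : ∀ l ∈ U.link y, ∀ n < U.len y, U.sp y n ≠ U.sp l.2.1 l.2.2 := fun l hl n hn h =>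
    (U.adj_of_link hl).ne (U.sp_inj hn (U.link_lt' hl) h).1
  have h1 : (((U.link y).filter fun l => l.1 = m).map fun l => U.sp l.2.1 l.2.2).Nodup := by
    refine List.Nodup.map_on (fun l hl l' hl' h => ?_)
      ((List.Nodup.of_map _ (U.nodup_link y)).filter _)
    have hl := List.mem_of_mem_filter hl
    have hl' := List.mem_of_mem_filter hl'
    exact U.link_eq hl hl' (U.sp_inj (U.link_lt' hl) (U.link_lt' hl') h).1
  have h2 : ((if 0 < m then [U.sp y (m - 1)] else []) ++
      ((U.link y).filter fun l => l.1 = m).map fun l => U.sp l.2.1 l.2.2).Nodup := by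
    split_ifs
    · refine List.nodup_cons.2 ⟨fun h => ?_, h1⟩
      obtain ⟨l, hl, h⟩ := List.mem_map.1 h
      exact hne l (List.mem_of_mem_filter hl) (m - 1) (by omega) h.symm
    · exact h1
  rw [nbrs]
  by_cases hm1 : m + 1 < U.len y
  · rw [if_pos hm1, List.singleton_append]
    refine List.nodup_cons.2 ⟨fun h => ?_, h2⟩
    rw [List.mem_append] at h
    rcases h with h | h
    · split_ifs at h with h0
      · have := (U.sp_inj hm1 (by omega) (List.mem_singleton.1 h)).2
        omega
      · simp at h
    · obtain ⟨l, hl, h⟩ := List.mem_map.1 h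
      exact hne l (List.mem_of_mem_filter hl) (m + 1) hm1 h.symm
  · rwa [if_neg hm1, List.nil_append]

theorem sum_nbrs (hE : ∀ l y, l ∈ U.link y → ind E (U.sp y l.1) (U.sp l.2.1 l.2.2) =
      ind E' y l.2.1) (y : τ) (m : ℕ) :
    ((U.nbrs y m).map (ind E (U.sp y m))).sum =
      (if m + 1 < U.len y then ind E (U.sp y m) (U.sp y (m + 1)) else 0) +
      ((if 0 < m then ind E (U.sp y m) (U.sp y (m - 1)) else 0) +
        U.legSum E' y (· = m)) := by
  rw [nbrs, List.map_append, List.map_append, List.sum_append, List.sum_append]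
  congr 1
  · split_ifs <;> simp
  congr 1
  · split_ifs <;> simp
  · have : ∀ L ⊆ U.link y, (((L.filter fun l => l.1 = m).map fun l => U.sp l.2.1 l.2.2).map
        (ind E (U.sp y m))).sum = (L.map fun l => if l.1 = m then ind E' y l.2.1 else 0).sum := by
      intro L hL
      induction L with
      | nil => rfl
      | cons l L ih =>
        rw [List.cons_subset] at hL
        rw [List.map_cons, List.sum_cons, ← ih hL.2]
        by_cases h : l.1 = m
        · rw [List.filter_cons_of_pos (by simpa using h), List.map_cons, List.map_cons,
            List.sum_cons, if_pos h, ← hE l y hL.1, h]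
        · rw [List.filter_cons_of_neg (by simpa using h), if_neg h, zero_add]
    exact this _ fun _ h => h

theorem ind_push (l : ℕ × τ × ℕ) (y : τ) (hl : l ∈ U.link y) :
    ind E (U.sp y l.1) (U.sp l.2.1 l.2.2) = ind (U.push E) y l.2.1 :=
  ind_congr (U.mem_push hl).symm

/-- All-or-none at each spider propagates one value along the whole path and into its legs. A leg at
the last position is compared with the preceding path wire, which exists because paths have at least
two spiders. -/
theorem eq_of_adj_comm {f : σ → σ → ZMod 2} {y : τ} (hf : ∀ s s', f s s' = f s' s)
    (h : ∀ m < U.len y, ∀ s' s'', D.wires.Adj (U.sp y m) s' → D.wires.Adj (U.sp y m) s'' →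
      f (U.sp y m) s' = f (U.sp y m) s'') :
    (∀ m, m + 1 < U.len y → f (U.sp y m) (U.sp y (m + 1)) = f (U.sp y 0) (U.sp y 1)) ∧
    ∀ l ∈ U.link y, f (U.sp y l.1) (U.sp l.2.1 l.2.2) = f (U.sp y 0) (U.sp y 1) := by
  have h1 : ∀ m, m + 1 < U.len y → f (U.sp y m) (U.sp y (m + 1)) = f (U.sp y 0) (U.sp y 1) := by
    intro m hm
    induction m with
    | zero => rfl
    | succ m ih =>
      rw [← ih (by omega), hf (U.sp y m)]
      exact h (m + 1) (by omega) _ _ (U.adj_sp_succ hm) (U.adj_sp_succ (by omega)).symm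
  refine ⟨h1, fun l hl => ?_⟩
  have h2 := U.link_lt y l hl
  have h3 := U.two_le_len y
  by_cases h4 : l.1 + 1 < U.len y
  · rw [← h1 _ h4]
    exact h _ h2 _ _ (U.adj_sp_of_link hl) (U.adj_sp_succ h4)
  · obtain ⟨m, hm⟩ : ∃ m, l.1 = m + 1 := ⟨l.1 - 1, by omega⟩
    have h5 := h1 m (by omega)
    rw [hf] at h5
    rw [← h5, ← hm]
    exact h _ h2 _ _ (U.adj_sp_of_link hl) (hm ▸ (U.adj_sp_succ (by omega)).symm)

/-- In the colour of a path, the parity condition at each spider determines the next wire as a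
partial leg sum, and the condition at the last spider is the parity condition of the unfused spider.
In the other colour everything at the path agrees. -/
theorem isWeb_spec (h : IsWeb D b E) :
    IsWeb D' b (U.push E) ∧ ∀ y m, m + 1 < U.len y →
      (D'.colour y = b → ind E (U.sp y m) (U.sp y (m + 1)) = U.legSum (U.push E) y (· ≤ m)) ∧
      (D'.colour y = b.swap → ∀ l ∈ U.link y,
        ind E (U.sp y m) (U.sp y (m + 1)) = ind (U.push E) y l.2.1) := by
  have hown : ∀ y, D'.colour y = b → ∀ m < U.len y,
      (if m + 1 < U.len y then ind E (U.sp y m) (U.sp y (m + 1)) else 0) +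
      ((if 0 < m then ind E (U.sp y m) (U.sp y (m - 1)) else 0) +
        U.legSum (U.push E) y (· = m)) = 0 := by
    intro y hy m hm
    rw [← U.sum_nbrs U.ind_push, ← even_ncard_iff (U.nodup_nbrs hm) (U.mem_nbrs hm) h.1]
    exact (h.2 _).1 (by rw [U.colour_eq, U.π_sp _ _ hm, hy])
  have hoth : ∀ y, D'.colour y = b.swap → _ := fun y hy =>
    U.eq_of_adj_comm (f := ind E) (y := y) ind_comm fun m hm =>
      (all_or_none_iff h.1).1 ((h.2 _).2 (by rw [U.colour_eq, U.π_sp _ _ hm, hy]))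
  have hin : ∀ y, D'.colour y = b → ∀ m, m + 1 < U.len y →
      ind E (U.sp y m) (U.sp y (m + 1)) = U.legSum (U.push E) y (· ≤ m) := by
    intro y hy m hm
    induction m with
    | zero =>
      have := hown y hy 0 (by omega)
      rw [if_pos hm, if_neg (lt_irrefl 0), zmod_two_add_eq_zero] at this
      rw [this, legSum_le_zero, zero_add]
    | succ m ih =>
      have := hown y hy (m + 1) (by omega)
      rw [if_pos hm, if_pos (Nat.succ_pos m), zmod_two_add_eq_zero, Nat.add_sub_cancel,
        ind_comm (U.sp y (m + 1)) (U.sp y m), ih (by omega)] at this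
      rw [this, legSum_le_succ]
  refine ⟨U.isWeb_iff.2 ⟨U.push_subset, fun y => ⟨fun hy => ?_, fun hy l hl l' hl' => ?_⟩⟩,
    fun y m hm => ⟨fun hy => hin y hy m hm, fun hy l hl => ?_⟩⟩
  · obtain ⟨m, hm⟩ : ∃ m, U.len y = m + 1 + 1 :=
      ⟨U.len y - 2, by have := U.two_le_len y; omega⟩
    have := hown y hy (m + 1) (by omega)
    rw [if_neg (by omega), if_pos (Nat.succ_pos m), Nat.add_sub_cancel,
      ind_comm (U.sp y (m + 1)) (U.sp y m), hin y hy m (by omega), zero_add,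
      ← legSum_le_succ] at this
    rw [← this, legSum, legSum]
    congr 1
    refine List.map_congr_left fun l hl => ?_
    have := U.link_lt y l hl
    rw [if_pos trivial, if_pos (by omega)]
  · rw [← U.ind_push l y hl, ← U.ind_push l' y hl', (hoth y hy).2 l hl, (hoth y hy).2 l' hl']
  · rw [← U.ind_push l y hl, (hoth y hy).1 m hm, (hoth y hy).2 l hl]

/-- The highlighting of a wire on a path. -/
def inner (b : PauliBasis) (E' : Set (Sym2 τ)) (y : τ) (m : ℕ) : Prop :=
  (D'.colour y = b ∧ U.legSum E' y (· ≤ m) = 1) ∨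
    (D'.colour y = b.swap ∧ ∃ l ∈ U.link y, s(y, l.2.1) ∈ E')

/-- The extension of a web to the unfused diagram. -/
def ext (b : PauliBasis) (E' : Set (Sym2 τ)) : Set (Sym2 σ) :=
  {e | (∃ y, ∃ l ∈ U.link y, s(y, l.2.1) ∈ E' ∧ e = s(U.sp y l.1, U.sp l.2.1 l.2.2)) ∨
    ∃ y m, m + 1 < U.len y ∧ U.inner b E' y m ∧ e = s(U.sp y m, U.sp y (m + 1))}

theorem mem_ext_link {y : τ} {l : ℕ × τ × ℕ} (hl : l ∈ U.link y) :
    s(U.sp y l.1, U.sp l.2.1 l.2.2) ∈ U.ext b E' ↔ s(y, l.2.1) ∈ E' := by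
  constructor
  · rintro (⟨y', l', hl', h1, h2⟩ | ⟨y', m, hm, h1, h2⟩)
    · have := congrArg (Sym2.map U.π) h2
      rw [Sym2.map_mk, Sym2.map_mk, U.π_sp _ _ (U.link_lt _ _ hl), U.π_sp _ _ (U.link_lt _ _ hl'),
        U.π_sp _ _ (U.link_lt' hl), U.π_sp _ _ (U.link_lt' hl')] at this
      rwa [this]
    · have := congrArg (Sym2.map U.π) h2
      rw [Sym2.map_mk, Sym2.map_mk, U.π_sp _ _ (U.link_lt _ _ hl), U.π_sp _ _ (U.link_lt' hl),
        U.π_sp _ _ hm, U.π_sp _ _ (by omega)] at this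
      exfalso
      rcases Sym2.eq_iff.1 this with ⟨h3, h4⟩ | ⟨h3, h4⟩ <;>
        exact (U.adj_of_link hl).ne (h3.trans h4.symm)
  · exact fun h => Or.inl ⟨y, l, hl, h, rfl⟩

theorem mem_ext_succ {y : τ} {m : ℕ} (hm : m + 1 < U.len y) :
    s(U.sp y m, U.sp y (m + 1)) ∈ U.ext b E' ↔ U.inner b E' y m := by
  constructor
  · rintro (⟨y', l', hl', h1, h2⟩ | ⟨y', n, hn, h1, h2⟩)
    · have := congrArg (Sym2.map U.π) h2
      rw [Sym2.map_mk, Sym2.map_mk, U.π_sp _ _ (U.link_lt _ _ hl'), U.π_sp _ _ (U.link_lt' hl'),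
        U.π_sp _ _ hm, U.π_sp _ _ (by omega)] at this
      exfalso
      rcases Sym2.eq_iff.1 this with ⟨h3, h4⟩ | ⟨h3, h4⟩
      · exact (U.adj_of_link hl').ne (h3.symm.trans h4)
      · exact (U.adj_of_link hl').ne (h4.symm.trans h3)
    · rcases Sym2.eq_iff.1 h2 with ⟨h3, h4⟩ | ⟨h3, h4⟩
      · obtain ⟨rfl, rfl⟩ := U.sp_inj (by omega) (by omega) h3
        exact h1
      · have h5 := (U.sp_inj (by omega) (by omega) h3).2
        have h6 := (U.sp_inj (by omega) (by omega) h4).2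
        omega
  · exact fun h => Or.inr ⟨y, m, hm, h, rfl⟩

theorem ext_subset : U.ext b E' ⊆ D.wires.edgeSet := by
  rintro _ (⟨y, l, hl, -, rfl⟩ | ⟨y, m, hm, -, rfl⟩)
  · exact U.adj_sp_of_link hl
  · exact U.adj_sp_succ hm

/-- The inner wires are forced by the legs, so a web is recovered from its restriction. This gives
the uniqueness of extensions. -/
theorem ext_push (h : IsWeb D b E) : U.ext b (U.push E) = E := by
  obtain ⟨h1, h2⟩ := U.isWeb_spec h
  have key : ∀ y m, m + 1 < U.len y →
      (U.inner b (U.push E) y m ↔ s(U.sp y m, U.sp y (m + 1)) ∈ E) := by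
    intro y m hm
    rw [← ind_eq_one, inner]
    by_cases hy : D'.colour y = b
    · rw [(h2 y m hm).1 hy]
      simp [hy, b.ne_swap]
    · replace hy := PauliBasis.eq_swap_of_ne hy
      simp only [hy, PauliBasis.swap_ne, false_and, true_and, false_or]
      constructor
      · rintro ⟨l, hl, h3⟩
        rw [(h2 y m hm).2 hy l hl, ind_eq_one.2 h3]
      · intro h3
        obtain ⟨l, hl⟩ := List.exists_mem_of_ne_nil _ (U.link_ne_nil y)
        exact ⟨l, hl, ind_eq_one.1 (by rw [← (h2 y m hm).2 hy l hl, h3])⟩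
  ext e
  constructor
  · rintro (⟨y, l, hl, h, rfl⟩ | ⟨y, m, hm, h, rfl⟩)
    · exact (U.mem_push hl).1 h
    · exact (key y m hm).1 h
  · intro he
    rcases U.edge_cases (h.1 he) with ⟨y, l, hl, rfl⟩ | ⟨y, m, hm, rfl⟩
    · exact (U.mem_ext_link hl).2 ((U.mem_push hl).2 he)
    · exact (U.mem_ext_succ hm).2 ((key y m hm).2 he)

/-- Differences of consecutive partial sums are the legs in between, and the total sum vanishes
because `E'` is a web. So parity holds at every spider of the path, including its end. -/
theorem isWeb_ext (h : IsWeb D' b E') : IsWeb D b (U.ext b E') := by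
  have h' := (U.isWeb_iff.1 h).2
  have hext : ∀ l y, l ∈ U.link y →
      ind (U.ext b E') (U.sp y l.1) (U.sp l.2.1 l.2.2) = ind E' y l.2.1 := fun l y hl =>
    ind_congr (U.mem_ext_link hl)
  have hown : ∀ y, D'.colour y = b → ∀ m, m + 1 < U.len y →
      ind (U.ext b E') (U.sp y m) (U.sp y (m + 1)) = U.legSum E' y (· ≤ m) := by
    intro y hy m hm
    rcases zmod_two_cases (U.legSum E' y (· ≤ m)) with h0 | h0
    · rw [h0, ind_eq_zero, U.mem_ext_succ hm, inner, h0]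
      simp [hy, b.ne_swap]
    · rw [h0, ind_eq_one, U.mem_ext_succ hm]
      exact Or.inl ⟨hy, h0⟩
  refine ⟨U.ext_subset, fun s => ?_⟩
  have hp := U.pos_lt s
  rw [U.colour_eq, ← U.sp_pos s, U.π_sp _ _ hp]
  generalize U.π s = y at hp ⊢
  generalize U.pos s = m at hp ⊢
  refine ⟨fun hy => ?_, fun hy => ?_⟩
  · rw [even_ncard_iff (U.nodup_nbrs hp) (U.mem_nbrs hp) U.ext_subset, U.sum_nbrs hext,
      zmod_two_add_eq_zero]
    have h1 : (if 0 < m then ind (U.ext b E') (U.sp y m) (U.sp y (m - 1)) else 0) +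
        U.legSum E' y (· = m) = U.legSum E' y (· ≤ m) := by
      rcases Nat.eq_zero_or_pos m with rfl | hm
      · rw [if_neg (lt_irrefl 0), zero_add, legSum_le_zero]
      · obtain ⟨n, rfl⟩ := Nat.exists_eq_succ_of_ne_zero hm.ne'
        rw [if_pos hm, Nat.succ_eq_add_one, Nat.add_sub_cancel,
          ind_comm (U.sp y (n + 1)) (U.sp y n), hown y hy n hp, legSum_le_succ]
    rw [h1]
    split_ifs with hm
    · exact hown y hy m hm
    · rw [← (h' y).1 hy, legSum, legSum]
      congr 1
      refine List.map_congr_left fun l hl => ?_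
      have := U.link_lt y l hl
      rw [if_pos trivial, if_pos (by omega)]
  · rw [all_or_none_iff U.ext_subset]
    obtain ⟨l₀, hl₀⟩ := List.exists_mem_of_ne_nil _ (U.link_ne_nil y)
    have hl : ∀ l ∈ U.link y, ind E' y l.2.1 = ind E' y l₀.2.1 := fun l hl =>
      (h' y).2 hy l hl l₀ hl₀
    have hi : ∀ n, n + 1 < U.len y →
        ind (U.ext b E') (U.sp y n) (U.sp y (n + 1)) = ind E' y l₀.2.1 := by
      intro n hn
      refine ind_congr ?_
      rw [U.mem_ext_succ hn, inner]
      simp only [hy, PauliBasis.swap_ne, false_and, true_and, false_or]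
      constructor
      · rintro ⟨l, hl', h3⟩
        rwa [← ind_eq_one, ← hl l hl', ind_eq_one]
      · exact fun h3 => ⟨l₀, hl₀, h3⟩
    suffices ∀ s, D.wires.Adj (U.sp y m) s → ind (U.ext b E') (U.sp y m) s = ind E' y l₀.2.1 from
      fun s' s'' h1 h2 => by rw [this s' h1, this s'' h2]
    intro s hs
    rcases (U.adj_sp y m hp s).1 hs with ⟨h1, rfl⟩ | ⟨h1, rfl⟩ | ⟨l, hl', rfl, rfl⟩
    · exact hi m h1
    · rw [ind_comm, ← hi (m - 1) (by omega), Nat.sub_add_cancel h1]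
    · rw [hext l y hl', hl l hl']

/-- An inner wire can be highlighted only on a path with a highlighted leg; there are finitely many
such paths, each of finite length. -/
theorem finite_ext (hE' : E'.Finite) : (U.ext b E').Finite := by
  have hY : {y | ∃ e ∈ E', y ∈ e}.Finite := by
    have : {y | ∃ e ∈ E', y ∈ e} = ⋃ e ∈ E', {y | y ∈ e} := by ext y; simp
    rw [this]
    refine hE'.biUnion fun e _ => ?_
    induction e using Sym2.ind with
    | _ a b => exact (Set.toFinite {a, b}).subset fun y hy => by simpa using hy
  have h1 : (⋃ y ∈ {y | ∃ e ∈ E', y ∈ e}, (fun l : ℕ × τ × ℕ =>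
      s(U.sp y l.1, U.sp l.2.1 l.2.2)) '' {l | l ∈ U.link y}).Finite :=
    hY.biUnion fun y _ => (List.finite_toSet _).image _
  have h2 : (⋃ y ∈ {y | ∃ e ∈ E', y ∈ e}, (fun m : ℕ =>
      s(U.sp y m, U.sp y (m + 1))) '' Set.Iio (U.len y)).Finite :=
    hY.biUnion fun y _ => (Set.finite_Iio _).image _
  refine (h1.union h2).subset ?_
  rintro _ (⟨y, l, hl, h, rfl⟩ | ⟨y, m, hm, h, rfl⟩)
  · refine Or.inl (Set.mem_biUnion ⟨_, h, Sym2.mem_mk_left _ _⟩ ⟨l, hl, rfl⟩)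
  · refine Or.inr (Set.mem_biUnion ?_ ⟨m, Set.mem_Iio.2 (by omega), rfl⟩)
    rcases h with ⟨-, h⟩ | ⟨-, l, -, h⟩
    · by_contra hy
      have : U.legSum E' y (· ≤ m) = 0 := by
        rw [legSum]
        refine List.sum_eq_zero fun x hx => ?_
        obtain ⟨l, -, rfl⟩ := List.mem_map.1 hx
        rw [ind_eq_zero.2 fun h => hy ⟨_, h, Sym2.mem_mk_left _ _⟩, ite_self]
      rw [this] at h
      exact zero_ne_one h
    · exact ⟨_, h, Sym2.mem_mk_left _ _⟩

end PathUnfusion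

/-! ## The Floquetified diagram as an unfusion -/

/-- The space-time position of the cell of the honeycomb lattice at the face `p` and time `r`. -/
def anchor (p : ℤ × ℤ) (r : ℤ) : Site × ℤ :=
  ((3 * p.1 + p.2, p.1 + p.2 - r + 1), 3 * p.2 + 2 * r - 2)

/-- The positions of the spiders into which a face spider is unfused. -/
def faceOffset : ℕ → Site × ℤ
  | 0 => ((-1, 0), 6)
  | 1 => ((0, 0), 6)
  | 2 => ((0, 0), 7)
  | _ => ((1, 0), 7)

/-- The positions of the spiders into which a vertex spider is unfused. -/
def vertexOffset : Bool → ℕ → Site × ℤ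
  | false, 0 => ((1, 0), 8)
  | false, 1 => ((1, 1), 8)
  | false, 2 => ((1, 1), 7)
  | false, 3 => ((2, 1), 7)
  | false, _ => ((2, 1), 8)
  | true, 0 => ((2, 1), 8)
  | true, 1 => ((2, 1), 9)
  | true, 2 => ((3, 1), 9)
  | true, 3 => ((3, 1), 8)
  | true, _ => ((3, 2), 8)

/-- The position of the `m`-th spider on the path of a spider of the colour code. -/
def place : CCSpider → ℕ → Site × ℤ
  | .inr (p, r), m => anchor p r + faceOffset m
  | .inl ((p, k), r), m => anchor p r + vertexOffset k m

/-- The flag of the `m`-th spider on the path of a spider of the colour code. -/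
def placeFlag : CCSpider → ℕ → Bool
  | .inl ((_, true), _), 0 => true
  | _, _ => false

/-- The number of spiders into which a spider of the colour code is unfused. -/
def pathLen : CCSpider → ℕ
  | .inr _ => 4
  | .inl _ => 5

/-- The wires at a spider of the colour code, with the positions of their ends on the paths. -/
def link : CCSpider → List (ℕ × CCSpider × ℕ)
  | .inr ((i, j), r) =>
    [(0, .inl (((i - 1, j), false), r), 3), (0, .inl (((i - 1, j - 1), true), r), 4),
      (1, .inl (((i, j - 1), false), r), 1), (2, .inl (((i - 1, j), true), r), 3),
      (3, .inl (((i, j), false), r), 0), (3, .inl (((i, j - 1), true), r), 1)]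
  | .inl (((i, j), false), r) =>
    [(0, .inl (((i, j), false), r + 1), 2), (0, .inr ((i, j), r), 3), (1, .inr ((i, j + 1), r), 1),
      (2, .inl (((i, j), false), r - 1), 0), (3, .inr ((i + 1, j), r), 0)]
  | .inl (((i, j), true), r) =>
    [(1, .inr ((i, j + 1), r), 3), (2, .inl (((i, j), true), r + 1), 4),
      (3, .inr ((i + 1, j), r), 2), (4, .inl (((i, j), true), r - 1), 2),
      (4, .inr ((i + 1, j + 1), r), 0)]

/-- The class of an anchor is 13 times an integer of the opposite parity of `r`. So all cells look
alike up to the exchange of bases with the timestep of the colour code. -/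
theorem stClass_anchor (p : ℤ × ℤ) (r : ℤ) (o : Site × ℤ) :
    stClass (anchor p r + o).1 (anchor p r + o).2 =
      stClass o.1 o.2 + if Even r then 13 else 0 := by
  rw [stClass_eq_cast, stClass_eq_cast]
  have h : ∀ n : ℤ, ((13 * (2 * n + 1) : ℤ) : ZMod 26) = 13 := fun n => by
    have : ((26 * n : ℤ) : ZMod 26) = 0 := (ZMod.intCast_zmod_eq_zero_iff_dvd _ 26).2 ⟨n, rfl⟩
    push_cast at this ⊢
    linear_combination this
  have h' : ∀ n : ℤ, ((13 * (2 * n) : ℤ) : ZMod 26) = 0 := fun n =>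
    (ZMod.intCast_zmod_eq_zero_iff_dvd _ 26).2 ⟨n, by push_cast; ring⟩
  have e : (anchor p r + o).1.1 - 3 * (anchor p r + o).1.2 - 8 * (anchor p r + o).2 =
      (o.1.1 - 3 * o.1.2 - 8 * o.2) + 13 * (-r + 1 - 2 * p.2) := by
    simp only [anchor, Prod.fst_add, Prod.snd_add]; ring
  rw [e, Int.cast_add]
  congr 1
  split_ifs with hr
  · obtain ⟨n, rfl⟩ := hr
    rw [← h (-n - p.2)]
    congr 1; ring
  · obtain ⟨n, rfl⟩ := Int.not_even_iff_odd.1 hr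
    rw [← h' (-n - p.2)]
    congr 1; ring

theorem partner_anchor (p : ℤ × ℤ) (r : ℤ) (o : Site × ℤ) :
    partner (anchor p r + o).1 (anchor p r + o).2 = partnerK (stClass o.1 o.2) := by
  rw [partner_eq, stClass_anchor]
  split_ifs
  · rw [partnerK_add_thirteen]
  · rw [add_zero]

theorem basis_anchor (p : ℤ × ℤ) (r : ℤ) (o : Site × ℤ) :
    basis (anchor p r + o).1 (anchor p r + o).2 =
      if Even r then (basisK (stClass o.1 o.2)).swap else basisK (stClass o.1 o.2) := by
  rw [basis_eq, stClass_anchor]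
  split_ifs
  · rw [basisK_add_thirteen]
  · rw [add_zero]

/-- The anchors are precisely the space-time points of phase 0, one in thirteen; the witnesses
invert the affine map. -/
theorem exists_anchor {x y t : ℤ} (h : (t + 8 * x + 2 * y) % 13 = 0) :
    ∃ p r, anchor p r = ((x, y), t) := by
  refine ⟨((5 * x - 2 * y - t) / 13, x - 3 * ((5 * x - 2 * y - t) / 13)),
    (5 * x - 2 * y - t) / 13 + (x - 3 * ((5 * x - 2 * y - t) / 13)) - y + 1, ?_⟩
  simp only [anchor, Prod.mk.injEq]
  omega

theorem anchor_injective {p p' : ℤ × ℤ} {r r' : ℤ} (h : anchor p r = anchor p' r') :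
    p = p' ∧ r = r' := by
  simp only [anchor, Prod.mk.injEq] at h
  exact ⟨Prod.ext (by omega) (by omega), by omega⟩

theorem placeFlag_partner {y : CCSpider} {m : ℕ} (h : placeFlag y m = true) :
    partner (place y m).1 (place y m).2 = none := by
  unfold placeFlag at h
  split at h
  · exact (partner_anchor _ _ _).trans (by decide)
  · cases h

/-- The `m`-th spider on the path of a spider of the colour code. -/
def spider (y : CCSpider) (m : ℕ) : FSpider :=
  ⟨((place y m).1, (place y m).2, placeFlag y m), placeFlag_partner⟩

theorem spider_ext {s s' : FSpider} (h1 : s.1.1 = s'.1.1) (h2 : s.1.2.1 = s'.1.2.1)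
    (h3 : s.1.2.2 = s'.1.2.2) : s = s' :=
  Subtype.ext (Prod.ext h1 (Prod.ext h2 h3))

/-- The kind of a spider of the colour code. -/
def kind : CCSpider → Option Bool
  | .inr _ => none
  | .inl ((_, k), _) => some k

/-- The kind and the position on its path, from the phase. -/
def decodePhase : ℤ → Bool → Option Bool × ℕ
  | 11, _ => (none, 0)
  | 6, _ => (none, 1)
  | 7, _ => (none, 2)
  | 2, _ => (none, 3)
  | 3, _ => (some false, 0)
  | 5, _ => (some false, 1)
  | 4, _ => (some false, 2)
  | 12, _ => (some false, 3)
  | 1, _ => (some true, 1)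
  | 9, _ => (some true, 2)
  | 8, _ => (some true, 3)
  | 10, _ => (some true, 4)
  | _, true => (some true, 0)
  | _, false => (some false, 4)

/-- The fourteen spiders of a cell are told apart by the thirteen phases, together with the flag at
phase 0, where a single-qubit measurement contributes two spiders to two different vertices. -/
theorem decodePhase_place {y : CCSpider} {m : ℕ} (hm : m < pathLen y) :
    decodePhase (((place y m).2 + 8 * (place y m).1.1 + 2 * (place y m).1.2) % 13)
      (placeFlag y m) = (kind y, m) := by
  have key : ∀ p r (o : Site × ℤ), ((anchor p r + o).2 + 8 * (anchor p r + o).1.1 +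
      2 * (anchor p r + o).1.2) % 13 = (o.2 + 8 * o.1.1 + 2 * o.1.2) % 13 := by
    intro p r o
    simp only [anchor, Prod.fst_add, Prod.snd_add]
    omega
  rcases y with ⟨⟨p, k⟩, r⟩ | ⟨p, r⟩
  · cases k <;> simp only [pathLen] at hm <;> simp only [place, key] <;> interval_cases m <;> rfl
  · simp only [pathLen] at hm
    simp only [place, key]
    interval_cases m <;> rfl

theorem spider_injective {y y' : CCSpider} {m m' : ℕ} (hm : m < pathLen y) (hm' : m' < pathLen y')
    (h : spider y m = spider y' m') : y = y' ∧ m = m' := by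
  have h0 := congrArg Subtype.val h
  have h1 : (place y m).1 = (place y' m').1 := congrArg (fun x => x.1) h0
  have h2 : (place y m).2 = (place y' m').2 := congrArg (fun x => x.2.1) h0
  have h3 : placeFlag y m = placeFlag y' m' := congrArg (fun x => x.2.2) h0
  have h4 := decodePhase_place hm
  rw [h1, h2, h3, decodePhase_place hm', Prod.mk.injEq] at h4
  obtain ⟨h4, rfl⟩ := h4
  refine ⟨?_, rfl⟩
  have h5 : place y m' = place y' m' := Prod.ext h1 h2
  rcases y with ⟨⟨p, k⟩, r⟩ | ⟨p, r⟩ <;> rcases y' with ⟨⟨p', k'⟩, r'⟩ | ⟨p', r'⟩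
  · obtain rfl : k' = k := Option.some_injective _ h4
    obtain ⟨rfl, rfl⟩ := anchor_injective (add_right_cancel h5)
    rfl
  · cases h4
  · cases h4
  · obtain ⟨rfl, rfl⟩ := anchor_injective (add_right_cancel h5)
    rfl

/-- The phase, with the flag at phase 0, tells which offset to subtract, and what is left is an
anchor. -/
theorem exists_spider (s : FSpider) : ∃ x : CCSpider × ℕ, x.2 < pathLen x.1 ∧
    spider x.1 x.2 = s := by
  obtain ⟨⟨⟨x, y⟩, t, k⟩, hs⟩ := s
  have key : ∀ o : Site × ℤ, (t + 8 * x + 2 * y) % 13 = (o.2 + 8 * o.1.1 + 2 * o.1.2) % 13 →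
      ∃ p r, anchor p r + o = ((x, y), t) := by
    intro o ho
    obtain ⟨p, r, h⟩ := exists_anchor (x := x - o.1.1) (y := y - o.1.2) (t := t - o.2) (by omega)
    refine ⟨p, r, ?_⟩
    rw [h]
    ext <;> simp
  have hk : ∀ y' m, place y' m = ((x, y), t) → partnerK (stClass (x, y) t) ≠ none →
      placeFlag y' m = k := by
    intro y' m h hne
    rw [← partner_eq] at hne
    have h1 : k = false := by
      by_contra hk
      exact hne (hs (by simpa using hk))
    have h2 : placeFlag y' m = false := by
      by_contra hk
      have := placeFlag_partner (by simpa using hk)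
      rw [h] at this
      exact hne this
    rw [h1, h2]
  have fin : ∀ y' m, m < pathLen y' → place y' m = ((x, y), t) → placeFlag y' m = k →
      ∃ x' : CCSpider × ℕ, x'.2 < pathLen x'.1 ∧ spider x'.1 x'.2 = ⟨((x, y), t, k), hs⟩ :=
    fun y' m h1 h2 h3 => ⟨(y', m), h1, Subtype.ext (by
      change ((place y' m).1, (place y' m).2, placeFlag y' m) = _
      rw [h2, h3])⟩
  have face : ∀ m < 4, (t + 8 * x + 2 * y) % 13 =
      ((faceOffset m).2 + 8 * (faceOffset m).1.1 + 2 * (faceOffset m).1.2) % 13 →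
      partnerK (stClass (faceOffset m).1 (faceOffset m).2) ≠ none →
      ∃ x' : CCSpider × ℕ, x'.2 < pathLen x'.1 ∧ spider x'.1 x'.2 = ⟨((x, y), t, k), hs⟩ := by
    intro m hm h hne
    obtain ⟨p, r, hp⟩ := key _ h
    refine fin (.inr (p, r)) m hm hp (hk _ _ hp ?_)
    rwa [← partner_anchor p r, hp, partner_eq] at hne
  have vertex : ∀ k' m, m < 5 → (t + 8 * x + 2 * y) % 13 =
      ((vertexOffset k' m).2 + 8 * (vertexOffset k' m).1.1 + 2 * (vertexOffset k' m).1.2) % 13 →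
      (partnerK (stClass (vertexOffset k' m).1 (vertexOffset k' m).2) ≠ none ∨
        ∀ p r, placeFlag (.inl ((p, k'), r)) m = k) →
      ∃ x' : CCSpider × ℕ, x'.2 < pathLen x'.1 ∧ spider x'.1 x'.2 = ⟨((x, y), t, k), hs⟩ := by
    intro k' m hm h hne
    obtain ⟨p, r, hp⟩ := key _ h
    refine fin (.inl ((p, k'), r)) m hm hp ?_
    rcases hne with hne | hne
    · refine hk _ _ hp ?_
      rwa [← partner_anchor p r, hp, partner_eq] at hne
    · exact hne p r
  have h0 := Int.emod_nonneg (t + 8 * x + 2 * y) (by norm_num : (13 : ℤ) ≠ 0)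
  have h1 := Int.emod_lt_of_pos (t + 8 * x + 2 * y) (by norm_num : (0 : ℤ) < 13)
  generalize (t + 8 * x + 2 * y) % 13 = φ at *
  interval_cases φ
  · cases k
    · exact vertex false 4 (by norm_num) rfl (Or.inr fun _ _ => rfl)
    · exact vertex true 0 (by norm_num) rfl (Or.inr fun _ _ => rfl)
  · exact vertex true 1 (by norm_num) rfl (Or.inl (by decide))
  · exact face 3 (by norm_num) rfl (by decide)
  · exact vertex false 0 (by norm_num) rfl (Or.inl (by decide))
  · exact vertex false 2 (by norm_num) rfl (Or.inl (by decide))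
  · exact vertex false 1 (by norm_num) rfl (Or.inl (by decide))
  · exact face 1 (by norm_num) rfl (by decide)
  · exact face 2 (by norm_num) rfl (by decide)
  · exact vertex true 3 (by norm_num) rfl (Or.inl (by decide))
  · exact vertex true 2 (by norm_num) rfl (Or.inl (by decide))
  · exact vertex true 4 (by norm_num) rfl (Or.inl (by decide))
  · exact face 0 (by norm_num) rfl (by decide)
  · exact vertex false 3 (by norm_num) rfl (Or.inl (by decide))

/-- A piece of world-line leaves the spider. -/
def Live (s : FSpider) : Prop := s.1.2.2 = true ∨ partner s.1.1 s.1.2.1 ≠ none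

/-- Two spiders at the same space-time point can only be the halves of a single-qubit measurement,
and just one of these has an outgoing wire. -/
theorem eq_of_live {s s' : FSpider} (h1 : s.1.1 = s'.1.1) (h2 : s.1.2.1 = s'.1.2.1)
    (hs : Live s) (hs' : Live s') : s = s' := by
  refine spider_ext h1 h2 ?_
  have h3 := s.2
  have h4 := s'.2
  unfold Live at hs hs'
  rw [← h1, ← h2] at hs' h4
  rcases hb : s.1.2.2 with _ | _ <;> rcases hb' : s'.1.2.2 with _ | _ <;> simp_all

theorem fDiagram_adj {s s' : FSpider} : fDiagram.wires.Adj s s' ↔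
    (s'.1.1 = s.1.1 ∧ s'.1.2.1 = s.1.2.1 + 1 ∧ s'.1.2.2 = false ∧ Live s) ∨
    (s.1.1 = s'.1.1 ∧ s.1.2.1 = s'.1.2.1 + 1 ∧ s.1.2.2 = false ∧ Live s') ∨
    (s'.1.2.1 = s.1.2.1 ∧ ∃ d, partner s.1.1 s.1.2.1 = some d ∧ s'.1.1 = s.1.1 + d) := by
  have hne : ∀ {q d : Site} {t : ℤ}, partner q t = some d → q ≠ q + d := by
    intro q d t h h0
    have h1 := (partner_spec h).2.2
    rw [left_eq_add] at h0
    subst h0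
    exact absurd h1 (by decide)
  rw [fDiagram, SimpleGraph.fromRel_adj]
  constructor
  · rintro ⟨-, (h | h) | (h | ⟨h1, d, h2, h3⟩)⟩
    · exact Or.inl h
    · exact Or.inr (Or.inr h)
    · exact Or.inr (Or.inl h)
    · refine Or.inr (Or.inr ⟨h1.symm, -d, ?_, by rw [h3, add_neg_cancel_right]⟩)
      rw [h1, h3]
      exact (partner_spec h2).1
  · rintro (h | h | ⟨h1, d, h2, h3⟩)
    · refine ⟨fun h0 => ?_, Or.inl (Or.inl h)⟩
      have := h.2.1
      rw [h0] at this
      omega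
    · refine ⟨fun h0 => ?_, Or.inr (Or.inl h)⟩
      have := h.2.1
      rw [h0] at this
      omega
    · exact ⟨fun h0 => hne h2 (by rw [← h3, ← h0]), Or.inl (Or.inr ⟨h1, d, h2, h3⟩)⟩

theorem adj_pair_iff {s sOut sIn sPair s' : FSpider} {d : Site} (hd : partner s.1.1 s.1.2.1 = some d)
    (ho : sOut.1 = (s.1.1, s.1.2.1 + 1, false))
    (hi1 : sIn.1.1 = s.1.1) (hi2 : s.1.2.1 = sIn.1.2.1 + 1) (hi : Live sIn)
    (hp1 : sPair.1.1 = s.1.1 + d) (hp2 : sPair.1.2.1 = s.1.2.1) :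
    fDiagram.wires.Adj s s' ↔ s' = sOut ∨ s' = sIn ∨ s' = sPair := by
  have hf : s.1.2.2 = false := by
    by_contra h
    have := s.2 (by simpa using h)
    rw [hd] at this
    cases this
  have hl : Live s := Or.inr (by rw [hd]; simp)
  rw [fDiagram_adj]
  refine or_congr ?_ (or_congr ?_ ?_)
  · constructor
    · rintro ⟨h1, h2, h3, -⟩
      exact spider_ext (by rw [h1, ho]) (by rw [h2, ho]) (by rw [h3, ho])
    · rintro rfl
      rw [ho]
      exact ⟨rfl, rfl, rfl, hl⟩
  · constructor
    · rintro ⟨h1, h2, -, h4⟩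
      exact eq_of_live (by rw [← h1, hi1]) (by omega) h4 hi
    · rintro rfl
      exact ⟨hi1.symm, hi2, hf, hi⟩
  · constructor
    · rintro ⟨h1, d', h2, h3⟩
      obtain rfl : d = d' := Option.some_injective _ (hd.symm.trans h2)
      have h5 := (partner_spec hd).1
      refine eq_of_live (by rw [h3, hp1]) (by rw [h1, hp2]) (Or.inr ?_) (Or.inr ?_)
      · rw [h3, h1, h5]; simp
      · rw [hp1, hp2, h5]; simp
    · rintro rfl
      exact ⟨hp2, d, hd, hp1⟩

theorem adj_end_iff {s sIn s' : FSpider} (hd : partner s.1.1 s.1.2.1 = none)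
    (hf : s.1.2.2 = false) (hi1 : sIn.1.1 = s.1.1) (hi2 : s.1.2.1 = sIn.1.2.1 + 1)
    (hi : Live sIn) : fDiagram.wires.Adj s s' ↔ s' = sIn := by
  have hl : ¬ Live s := by
    rintro (h | h)
    · rw [hf] at h; cases h
    · exact h hd
  rw [fDiagram_adj]
  constructor
  · rintro (⟨-, -, -, h⟩ | ⟨h1, h2, -, h4⟩ | ⟨-, d, h, -⟩)
    · exact absurd h hl
    · exact eq_of_live (by rw [← h1, hi1]) (by omega) h4 hi
    · rw [hd] at h; cases h
  · rintro rfl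
    exact Or.inr (Or.inl ⟨hi1.symm, hi2, hf, hi⟩)

theorem adj_start_iff {s sOut s' : FSpider} (hd : partner s.1.1 s.1.2.1 = none)
    (hf : s.1.2.2 = true) (ho : sOut.1 = (s.1.1, s.1.2.1 + 1, false)) :
    fDiagram.wires.Adj s s' ↔ s' = sOut := by
  rw [fDiagram_adj]
  constructor
  · rintro (⟨h1, h2, h3, -⟩ | ⟨-, -, h, -⟩ | ⟨-, d, h, -⟩)
    · exact spider_ext (by rw [h1, ho]) (by rw [h2, ho]) (by rw [h3, ho])
    · rw [hf] at h; cases h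
    · rw [hd] at h; cases h
  · rintro rfl
    rw [ho]
    exact Or.inl ⟨rfl, rfl, rfl, Or.inl hf⟩

theorem partner_place_inr (p : ℤ × ℤ) (r : ℤ) (m : ℕ) :
    partner (spider (.inr (p, r)) m).1.1 (spider (.inr (p, r)) m).1.2.1 =
      partnerK (stClass (faceOffset m).1 (faceOffset m).2) :=
  partner_anchor _ _ _

theorem partner_place_inl (p : ℤ × ℤ) (k : Bool) (r : ℤ) (m : ℕ) :
    partner (spider (.inl ((p, k), r)) m).1.1 (spider (.inl ((p, k), r)) m).1.2.1 =
      partnerK (stClass (vertexOffset k m).1 (vertexOffset k m).2) :=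
  partner_anchor _ _ _

theorem live_inr (p : ℤ × ℤ) (r : ℤ) (m : ℕ)
    (h : partnerK (stClass (faceOffset m).1 (faceOffset m).2) ≠ none) :
    Live (spider (.inr (p, r)) m) := Or.inr (by rwa [partner_place_inr])

theorem live_inl (p : ℤ × ℤ) (k : Bool) (r : ℤ) (m : ℕ)
    (h : partnerK (stClass (vertexOffset k m).1 (vertexOffset k m).2) ≠ none) :
    Live (spider (.inl ((p, k), r)) m) := Or.inr (by rwa [partner_place_inl])

theorem colour_spider {y : CCSpider} {m : ℕ} (hm : m < pathLen y) :
    fDiagram.colour (spider y m) = ccDiagram.colour y := by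
  rcases y with ⟨⟨p, k⟩, r⟩ | ⟨p, r⟩
  · have h1 := partner_place_inl p k r m
    have h2 : basis (spider (.inl ((p, k), r)) m).1.1 (spider (.inl ((p, k), r)) m).1.2.1 = _ :=
      basis_anchor p r _
    simp only [fDiagram, ccDiagram, ccBasis]
    rw [h1, h2]
    simp only [pathLen] at hm
    by_cases hr : Even r
    · simp only [hr, if_true]
      cases k <;> interval_cases m <;> decide
    · simp only [hr, if_false]
      cases k <;> interval_cases m <;> decide
  · have h1 := partner_place_inr p r m
    have h2 : basis (spider (.inr (p, r)) m).1.1 (spider (.inr (p, r)) m).1.2.1 = _ :=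
      basis_anchor p r _
    simp only [fDiagram, ccDiagram, ccBasis]
    rw [h1, h2]
    simp only [pathLen] at hm
    by_cases hr : Even r
    · simp only [hr, if_true]
      interval_cases m <;> decide
    · simp only [hr, if_false]
      interval_cases m <;> decide

theorem ccDiagram_adj_link (y y' : CCSpider) :
    ccDiagram.wires.Adj y y' ↔ y' ∈ (link y).map fun l => l.2.1 := by
  rw [ccDiagram, SimpleGraph.fromRel_adj]
  rcases y with ⟨⟨⟨i, j⟩, k⟩, r⟩ | ⟨⟨i, j⟩, r⟩ <;>
    rcases y' with ⟨⟨⟨i', j'⟩, k'⟩, r'⟩ | ⟨⟨i', j'⟩, r'⟩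
  · cases k <;> cases k' <;>
      simp only [link, ne_eq, Sum.inl.injEq, Prod.mk.injEq, List.map_cons, List.map_nil,
        List.mem_cons, reduceCtorEq, List.not_mem_nil, or_false, false_or, Bool.true_eq_false,
        Bool.false_eq_true, and_false, false_and, not_false_eq_true, and_true] <;> omega
  · cases k <;>
      simp [link, hexagon] <;> omega
  · cases k' <;>
      simp [link, hexagon] <;> omega
  · simp [link]

theorem link_symm (y : CCSpider) : ∀ l ∈ link y, (l.2.2, y, l.1) ∈ link l.2.1 := by
  rcases y with ⟨⟨⟨i, j⟩, k⟩, r⟩ | ⟨⟨i, j⟩, r⟩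
  · cases k <;> simp [link]
  · simp [link]

theorem nodup_link (y : CCSpider) : ((link y).map fun l => l.2.1).Nodup := by
  rcases y with ⟨⟨⟨i, j⟩, k⟩, r⟩ | ⟨⟨i, j⟩, r⟩
  · cases k <;> simp [link] <;> omega
  · simp [link]

theorem link_lt (y : CCSpider) : ∀ l ∈ link y, l.1 < pathLen y := by
  rcases y with ⟨⟨⟨i, j⟩, k⟩, r⟩ | ⟨⟨i, j⟩, r⟩
  · cases k <;> simp [link, pathLen]
  · simp [link, pathLen]

set_option linter.unusedSimpArgs false in
set_option linter.unreachableTactic false in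
set_option linter.unnecessarySeqFocus false in
set_option linter.unusedTactic false in
-- Local verification of the unfusion: the wires of the Floquetified diagram at each of the fourteen
-- types of spiders are matched with path wires and legs.
theorem adj_spider (y : CCSpider) (m : ℕ) (hm : m < pathLen y) (s : FSpider) :
    fDiagram.wires.Adj (spider y m) s ↔
      (m + 1 < pathLen y ∧ s = spider y (m + 1)) ∨ (0 < m ∧ s = spider y (m - 1)) ∨
        ∃ l ∈ link y, l.1 = m ∧ s = spider l.2.1 l.2.2 := by
  -- A spider of a weight-two measurement has three neighbours: `yo` later on its world-line, `yi`
  -- earlier on it, and `yp` across the measurement.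
  have pair : ∀ {y m} (yo : CCSpider) (mo : ℕ) (yi : CCSpider) (mi : ℕ) (yp : CCSpider) (mp : ℕ)
      (d : Site), partner (spider y m).1.1 (spider y m).1.2.1 = some d →
      (place yo mo = ((place y m).1, (place y m).2 + 1)) → placeFlag yo mo = false →
      (place yi mi = ((place y m).1, (place y m).2 - 1)) → Live (spider yi mi) →
      (place yp mp = ((place y m).1 + d, (place y m).2)) →
      (fDiagram.wires.Adj (spider y m) s ↔
        s = spider yo mo ∨ s = spider yi mi ∨ s = spider yp mp) := by
    intro y m yo mo yi mi yp mp d hd h1 h2 h3 h4 h5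
    refine adj_pair_iff hd ?_ ?_ ?_ h4 ?_ ?_
    · change ((place yo mo).1, (place yo mo).2, placeFlag yo mo) = _
      rw [h1, h2]; rfl
    · change (place yi mi).1 = _
      rw [h3]; rfl
    · change _ = (place yi mi).2 + 1
      rw [h3, sub_add_cancel]; rfl
    · change (place yp mp).1 = _
      rw [h5]; rfl
    · change (place yp mp).2 = _
      rw [h5]; rfl
  rcases y with ⟨⟨⟨i, j⟩, k⟩, r⟩ | ⟨⟨i, j⟩, r⟩
  · cases k <;> simp only [pathLen] at hm <;> interval_cases m
    · exact (pair (.inl (((i, j), false), r + 1)) 2 (.inr ((i, j), r)) 3 (.inl (((i, j), false), r)) 1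
        (0, 1) ((partner_place_inl _ _ _ _).trans (by decide))
        (by simp [place, anchor, faceOffset, vertexOffset] <;> omega)
        rfl (by simp [place, anchor, faceOffset, vertexOffset] <;> omega)
        (live_inr _ _ _ (by decide))
        (by simp [place, anchor, faceOffset, vertexOffset] <;> omega)).trans
        (by simp [link, pathLen]; tauto)
    · exact (pair (.inr ((i, j + 1), r)) 1 (.inl (((i, j), false), r)) 2 (.inl (((i, j), false), r)) 0
        (0, -1) ((partner_place_inl _ _ _ _).trans (by decide))
        (by simp [place, anchor, faceOffset, vertexOffset] <;> omega)
        rfl (by simp [place, anchor, faceOffset, vertexOffset] <;> omega)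
        (live_inl _ _ _ _ (by decide))
        (by simp [place, anchor, faceOffset, vertexOffset] <;> omega)).trans
        (by simp [link, pathLen]; tauto)
    · exact (pair (.inl (((i, j), false), r)) 1 (.inl (((i, j), false), r - 1)) 0 (.inl (((i, j), false), r)) 3
        (1, 0) ((partner_place_inl _ _ _ _).trans (by decide))
        (by simp [place, anchor, faceOffset, vertexOffset] <;> omega)
        rfl (by simp [place, anchor, faceOffset, vertexOffset] <;> omega)
        (live_inl _ _ _ _ (by decide))
        (by simp [place, anchor, faceOffset, vertexOffset] <;> omega)).trans
        (by simp [link, pathLen]; tauto)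
    · exact (pair (.inl (((i, j), false), r)) 4 (.inr ((i + 1, j), r)) 0 (.inl (((i, j), false), r)) 2
        (-1, 0) ((partner_place_inl _ _ _ _).trans (by decide))
        (by simp [place, anchor, faceOffset, vertexOffset] <;> omega)
        rfl (by simp [place, anchor, faceOffset, vertexOffset] <;> omega)
        (live_inr _ _ _ (by decide))
        (by simp [place, anchor, faceOffset, vertexOffset] <;> omega)).trans
        (by simp [link, pathLen]; tauto)
    · refine (adj_end_iff (sIn := spider (.inl (((i, j), false), r)) 3)
        ((partner_place_inl _ _ _ _).trans (by decide)) rfl ?_ ?_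
        (live_inl _ _ _ _ (by decide))).trans (by simp [link, pathLen])
      · rfl
      · change _ = (place (.inl (((i, j), false), r)) 3).2 + 1
        simp [spider, place, vertexOffset]; omega
    · refine (adj_start_iff (sOut := spider (.inl (((i, j), true), r)) 1)
        ((partner_place_inl _ _ _ _).trans (by decide)) rfl ?_).trans (by simp [link, pathLen])
      refine Prod.ext rfl (Prod.ext ?_ rfl)
      change (place (.inl (((i, j), true), r)) 1).2 = (place (.inl (((i, j), true), r)) 0).2 + 1
      simp [place, vertexOffset]; omega
    · exact (pair (.inr ((i, j + 1), r)) 3 (.inl (((i, j), true), r)) 0 (.inl (((i, j), true), r)) 2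
        (1, 0) ((partner_place_inl _ _ _ _).trans (by decide))
        (by simp [place, anchor, faceOffset, vertexOffset] <;> omega)
        rfl (by simp [place, anchor, faceOffset, vertexOffset] <;> omega) (Or.inl rfl)
        (by simp [place, anchor, faceOffset, vertexOffset] <;> omega)).trans
        (by simp [link, pathLen]; tauto)
    · exact (pair (.inl (((i, j), true), r + 1)) 4 (.inl (((i, j), true), r)) 3 (.inl (((i, j), true), r)) 1
        (-1, 0) ((partner_place_inl _ _ _ _).trans (by decide))
        (by simp [place, anchor, faceOffset, vertexOffset] <;> omega)
        rfl (by simp [place, anchor, faceOffset, vertexOffset] <;> omega)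
        (live_inl _ _ _ _ (by decide))
        (by simp [place, anchor, faceOffset, vertexOffset] <;> omega)).trans
        (by simp [link, pathLen]; tauto)
    · exact (pair (.inl (((i, j), true), r)) 2 (.inr ((i + 1, j), r)) 2 (.inl (((i, j), true), r)) 4
        (0, 1) ((partner_place_inl _ _ _ _).trans (by decide))
        (by simp [place, anchor, faceOffset, vertexOffset] <;> omega)
        rfl (by simp [place, anchor, faceOffset, vertexOffset] <;> omega)
        (live_inr _ _ _ (by decide))
        (by simp [place, anchor, faceOffset, vertexOffset] <;> omega)).trans
        (by simp [link, pathLen]; tauto)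
    · exact (pair (.inr ((i + 1, j + 1), r)) 0 (.inl (((i, j), true), r - 1)) 2 (.inl (((i, j), true), r)) 3
        (0, -1) ((partner_place_inl _ _ _ _).trans (by decide))
        (by simp [place, anchor, faceOffset, vertexOffset] <;> omega)
        rfl (by simp [place, anchor, faceOffset, vertexOffset] <;> omega)
        (live_inl _ _ _ _ (by decide))
        (by simp [place, anchor, faceOffset, vertexOffset] <;> omega)).trans
        (by simp [link, pathLen]; tauto)
  · simp only [pathLen] at hm
    interval_cases m
    · exact (pair (.inl (((i - 1, j), false), r)) 3 (.inl (((i - 1, j - 1), true), r)) 4 (.inr ((i, j), r)) 1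
        (1, 0) ((partner_place_inr _ _ _).trans (by decide))
        (by simp [place, anchor, faceOffset, vertexOffset] <;> omega)
        rfl (by simp [place, anchor, faceOffset, vertexOffset] <;> omega)
        (live_inl _ _ _ _ (by decide))
        (by simp [place, anchor, faceOffset, vertexOffset] <;> omega)).trans
        (by simp [link, pathLen]; tauto)
    · exact (pair (.inr ((i, j), r)) 2 (.inl (((i, j - 1), false), r)) 1 (.inr ((i, j), r)) 0
        (-1, 0) ((partner_place_inr _ _ _).trans (by decide))
        (by simp [place, anchor, faceOffset, vertexOffset] <;> omega)
        rfl (by simp [place, anchor, faceOffset, vertexOffset] <;> omega)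
        (live_inl _ _ _ _ (by decide))
        (by simp [place, anchor, faceOffset, vertexOffset] <;> omega)).trans
        (by simp [link, pathLen]; tauto)
    · exact (pair (.inl (((i - 1, j), true), r)) 3 (.inr ((i, j), r)) 1 (.inr ((i, j), r)) 3 (1, 0)
        ((partner_place_inr _ _ _).trans (by decide))
        (by simp [place, anchor, faceOffset, vertexOffset] <;> omega)
        rfl (by simp [place, anchor, faceOffset, vertexOffset] <;> omega)
        (live_inr _ _ _ (by decide))
        (by simp [place, anchor, faceOffset, vertexOffset] <;> omega)).trans
        (by simp [link, pathLen]; tauto)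
    · exact (pair (.inl (((i, j), false), r)) 0 (.inl (((i, j - 1), true), r)) 1 (.inr ((i, j), r)) 2
        (-1, 0) ((partner_place_inr _ _ _).trans (by decide))
        (by simp [place, anchor, faceOffset, vertexOffset] <;> omega)
        rfl (by simp [place, anchor, faceOffset, vertexOffset] <;> omega)
        (live_inl _ _ _ _ (by decide))
        (by simp [place, anchor, faceOffset, vertexOffset] <;> omega)).trans
        (by simp [link, pathLen]; tauto)

/-- The Floquetified diagram arises from the one of the colour code by unfusing spiders. -/
noncomputable def unfusion : PathUnfusion fDiagram ccDiagram where
  π s := (exists_spider s).choose.1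
  pos s := (exists_spider s).choose.2
  len := pathLen
  sp := spider
  link := link
  pos_lt s := (exists_spider s).choose_spec.1
  sp_pos s := (exists_spider s).choose_spec.2
  π_sp y m hm := (spider_injective (exists_spider (spider y m)).choose_spec.1 hm
    (exists_spider (spider y m)).choose_spec.2).1
  pos_sp y m hm := (spider_injective (exists_spider (spider y m)).choose_spec.1 hm
    (exists_spider (spider y m)).choose_spec.2).2
  colour_eq s := by
    rw [← colour_spider (exists_spider s).choose_spec.1, (exists_spider s).choose_spec.2]
  two_le_len y := by rcases y with _ | _ <;> simp [pathLen]
  adj_link := ccDiagram_adj_link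
  nodup_link := nodup_link
  link_ne_nil y := by rcases y with ⟨⟨⟨i, j⟩, _ | _⟩, r⟩ | ⟨⟨i, j⟩, r⟩ <;> simp [link]
  link_lt := link_lt
  link_symm := link_symm
  adj_sp y m hm s := adj_spider y m hm s

theorem place_ccShift (d : ℤ × ℤ) (n : ℤ) (y : CCSpider) (m : ℕ) :
    place (ccShift d n y) m = place y m +
      ((3 * d.1 + d.2, d.1 + d.2 - n), 3 * d.2 + 2 * n) := by
  rcases y with ⟨⟨p, k⟩, r⟩ | ⟨p, r⟩ <;>
    (ext <;> simp [place, ccShift, anchor] <;> ring)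

theorem placeFlag_ccShift (d : ℤ × ℤ) (n : ℤ) (y : CCSpider) (m : ℕ) :
    placeFlag (ccShift d n y) m = placeFlag y m := by
  rcases y with ⟨⟨p, _ | _⟩, r⟩ | ⟨p, r⟩ <;> cases m <;> rfl

theorem pathLen_ccShift (d : ℤ × ℤ) (n : ℤ) (y : CCSpider) :
    pathLen (ccShift d n y) = pathLen y := by
  rcases y with ⟨⟨p, _ | _⟩, r⟩ | ⟨p, r⟩ <;> rfl

/-- A translation of the colour code corresponds to one of the Floquetified code. -/
theorem unfusion_ccShift {d : ℤ × ℤ} {n : ℤ} {s s' : FSpider}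
    (h : s'.1 = (s.1.1 + (3 * d.1 + d.2, d.1 + d.2 - n), s.1.2.1 + (3 * d.2 + 2 * n), s.1.2.2)) :
    unfusion.π s' = ccShift d n (unfusion.π s) ∧ unfusion.pos s' = unfusion.pos s := by
  have h1 := unfusion.sp_pos s
  have h2 := unfusion.pos_lt s
  generalize unfusion.π s = y at *
  generalize unfusion.pos s = m at *
  subst h1
  have h3 : s' = spider (ccShift d n y) m := by
    refine Subtype.ext (h.trans ?_)
    change _ = ((place (ccShift d n y) m).1, (place (ccShift d n y) m).2,
      placeFlag (ccShift d n y) m)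
    rw [place_ccShift, placeFlag_ccShift]
    rfl
  have h4 : m < unfusion.len (ccShift d n y) := by
    change m < pathLen _
    rw [pathLen_ccShift]; exact h2
  rw [h3]
  exact ⟨unfusion.π_sp _ _ h4, unfusion.pos_sp _ _ h4⟩

/-! ## Detecting regions of the colour code -/

theorem even_ncard_list {ι : Type*} {L : List ι} (hL : L.Nodup) (P : ι → Prop) [DecidablePred P] :
    Even {i | P i ∧ i ∈ L}.ncard ↔ (L.map fun i => if P i then (1 : ZMod 2) else 0).sum = 0 := by
  classical
  have h1 : {i | P i ∧ i ∈ L} = ((L.filter fun i => P i).toFinset : Set ι) := by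
    ext i
    simp [and_comm]
  have h2 : ∀ l : List ι, (l.map fun i => if P i then (1 : ZMod 2) else 0).sum =
      ((l.filter fun i => P i).length : ZMod 2) := by
    intro l
    induction l with
    | nil => rfl
    | cons a l ih =>
      rw [List.map_cons, List.sum_cons, ih, List.filter_cons]
      by_cases h : P a
      · simp [h, add_comm]
      · simp [h]
  rw [h1, Set.ncard_coe_finset, List.toFinset_card_of_nodup (hL.filter _), h2,
    ZMod.natCast_eq_zero_iff_even]

theorem odd_ncard_iff {ι : Type*} {L : List ι} (hL : L.Nodup) (S : Finset ι)
    (f : ι → ZMod 2) (hf : ∀ i ∈ L, f i = 1 ↔ i ∈ S) {P : ι → Prop} (hP : ∀ i ∈ S, P i ↔ i ∈ L) :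
    Odd {i | i ∈ S ∧ P i}.ncard ↔ (L.map f).sum = 1 := by
  classical
  have h1 : {i | i ∈ S ∧ P i} = {i | i ∈ S ∧ i ∈ L} := by
    ext i
    exact and_congr_right fun hi => hP i hi
  have h2 : L.map f = L.map fun i => if i ∈ S then (1 : ZMod 2) else 0 := by
    refine List.map_congr_left fun i hi => ?_
    have := hf i hi
    rcases zmod_two_cases (f i) with h | h
    · rw [h, if_neg]
      rw [← this, h]
      exact zero_ne_one
    · rw [h, if_pos (this.1 h)]
  rw [h1, ← Nat.not_even_iff_odd, even_ncard_list hL, h2]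
  rcases zmod_two_cases ((L.map fun i => if i ∈ S then (1 : ZMod 2) else 0).sum) with h | h <;>
    simp [h]

theorem exists_sum {t₀ : ℤ} (f : ℤ → ZMod 2) (hf : ∀ n < t₀, f n = 0) :
    ∃ F : ℤ → ZMod 2, (∀ n < t₀, F n = 0) ∧ (∀ n, F (n + 1) = F n + f (n + 1)) ∧
      ((∀ n, f n = 0) → ∀ n, F n = 0) := by
  refine ⟨fun n => ∑ k ∈ Finset.range (n + 1 - t₀).toNat, f (t₀ + k), fun n hn => ?_, fun n => ?_,
    fun h n => Finset.sum_eq_zero fun k _ => h _⟩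
  · have : (n + 1 - t₀).toNat = 0 := by omega
    simp [this]
  · by_cases hn : n + 1 < t₀
    · have h1 : (n + 1 + 1 - t₀).toNat = 0 := by omega
      have h2 : (n + 1 - t₀).toNat = 0 := by omega
      simp [h1, h2, hf _ hn]
    · have h1 : (n + 1 + 1 - t₀).toNat = (n + 1 - t₀).toNat + 1 := by omega
      dsimp only
      rw [h1, Finset.sum_range_succ]
      congr 2
      omega

/-- A finitely supported function on the triangular lattice vanishes if its sums over all triangles
of one orientation vanish. -/
theorem eq_zero_of_triangles {V : ℤ × ℤ → ZMod 2} {N : ℤ} (hN : ∀ p, N < p.1 + p.2 → V p = 0)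
    (h : ∀ i j, V (i, j) + V (i + 1, j) + V (i, j + 1) = 0) (p : ℤ × ℤ) : V p = 0 := by
  have key : ∀ (n : ℕ) (i j : ℤ), N - n < i + j → V (i, j) = 0 := by
    intro n
    induction n with
    | zero => exact fun i j hij => hN _ (by simpa using hij)
    | succ n ih =>
      intro i j hij
      push_cast at hij
      have := h i j
      rwa [ih (i + 1) j (by omega), ih i (j + 1) (by omega), add_zero, add_zero] at this
  exact key (N + 1 - (p.1 + p.2)).toNat p.1 p.2 (by omega)

/-- The diagram is bipartite by colour. Hence in a web of either colour each wire has exactly one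
end at which the all-or-none condition applies. -/
theorem ccDiagram_colour_adj {y y' : CCSpider} (h : ccDiagram.wires.Adj y y') :
    ccDiagram.colour y' = (ccDiagram.colour y).swap := by
  have hm : ∀ r : ℤ, ccBasis (r - 1) = (ccBasis r).swap := fun r => by
    have := ccBasis_add_one (r - 1)
    rw [sub_add_cancel] at this
    rw [this, PauliBasis.swap_swap]
  rw [ccDiagram_adj_link] at h
  rcases y with ⟨⟨⟨i, j⟩, _ | _⟩, r⟩ | ⟨⟨i, j⟩, r⟩ <;>
    simp only [link, List.map_cons, List.map_nil, List.mem_cons, List.not_mem_nil, or_false] at h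
  · rcases h with rfl | rfl | rfl | rfl | rfl <;> simp [ccDiagram, ccBasis_add_one, hm]
  · rcases h with rfl | rfl | rfl | rfl | rfl <;> simp [ccDiagram, ccBasis_add_one, hm]
  · rcases h with rfl | rfl | rfl | rfl | rfl | rfl <;> simp [ccDiagram]

/-- The vertices of a hexagon. -/
def hexList (p : ℤ × ℤ) : List ((ℤ × ℤ) × Bool) :=
  [((p.1, p.2), false), ((p.1 - 1, p.2), false), ((p.1, p.2 - 1), false),
    ((p.1 - 1, p.2), true), ((p.1, p.2 - 1), true), ((p.1 - 1, p.2 - 1), true)]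

theorem mem_hexagon {p : ℤ × ℤ} {v : (ℤ × ℤ) × Bool} :
    v ∈ hexagon ((1, 0) : ℤ × ℤ) (0, 1) p ↔ v ∈ hexList p := by
  obtain ⟨i, j⟩ := p
  simp [hexagon, hexList]

/-- The spiders all of whose legs are highlighted in a basic region. -/
def Touched (i : (ℤ × ℤ) × ℤ) : CCSpider → Prop
  | .inr (p, r) => p = i.1 ∧ (r = i.2 ∨ r = i.2 + 2)
  | .inl (v, r) => r = i.2 + 1 ∧ v ∈ hexList i.1

theorem mem_ccRegion {i : (ℤ × ℤ) × ℤ} {b : PauliBasis} {y y' : CCSpider} :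
    s(y, y') ∈ ccRegion i b ↔
      b = ccBasis i.2 ∧ ccDiagram.wires.Adj y y' ∧ (Touched i y ∨ Touched i y') := by
  rw [ccRegion]
  refine and_congr_right fun _ => and_congr_right fun _ => ?_
  simp only [Sym2.mem_iff]
  have h : ∀ y, Touched i y ↔ Sum.inr (i.1, i.2) = y ∨ Sum.inr (i.1, i.2 + 2) = y ∨
      ∃ v ∈ hexagon ((1, 0) : ℤ × ℤ) (0, 1) i.1, Sum.inl (v, i.2 + 1) = y := by
    rintro (⟨v, r⟩ | ⟨p, r⟩)
    · simp only [Touched, mem_hexagon, reduceCtorEq, Sum.inl.injEq, Prod.mk.injEq, false_or]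
      constructor
      · rintro ⟨rfl, h⟩
        exact ⟨v, h, rfl, rfl⟩
      · rintro ⟨v, h, rfl, rfl⟩
        exact ⟨rfl, h⟩
    · simp only [Touched, Sum.inr.injEq, Prod.mk.injEq, reduceCtorEq, and_false, exists_false,
        or_false, eq_comm (a := i.1), eq_comm (b := r)]
      tauto
  rw [h, h]
  simp only [and_or_left, exists_or]
  clear h
  grind

theorem colour_of_touched {i : (ℤ × ℤ) × ℤ} {y : CCSpider} (h : Touched i y) :
    ccDiagram.colour y = (ccBasis i.2).swap := by
  rcases y with ⟨v, r⟩ | ⟨p, r⟩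
  · obtain ⟨rfl, -⟩ := h
    exact ccBasis_add_one _
  · obtain ⟨-, rfl | rfl⟩ := h
    · rfl
    · simp [ccDiagram, ccBasis_add_two]

/-- The touched spiders all have the colour opposite to the region, so only that end of the wire
needs to be inspected. -/
theorem mem_ccRegion_of_colour {i : (ℤ × ℤ) × ℤ} {b : PauliBasis} {y y' : CCSpider}
    (hb : b = ccBasis i.2) (h : ccDiagram.wires.Adj y y') (hy : ccDiagram.colour y = b.swap) :
    s(y, y') ∈ ccRegion i b ↔ Touched i y := by
  have h1 := ccDiagram_colour_adj h
  have h2 : ¬ Touched i y' := fun h2 => by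
    rw [colour_of_touched h2, hy, PauliBasis.swap_swap, ← hb] at h1
    exact b.swap_ne h1
  rw [mem_ccRegion]
  simp [hb, h, h2]

instance (i : (ℤ × ℤ) × ℤ) (y : CCSpider) : Decidable (Touched i y) := by
  unfold Touched
  split <;> infer_instance

/-- A vertex spider of the colour of the region has no touched neighbour or two: the face spider at
time `t` or `t + 2` and the vertex spider between them. A face spider at time `t + 1` meets the
hexagon in 0, 2 or 6 vertices. -/
theorem sum_touched {i : (ℤ × ℤ) × ℤ} {y : CCSpider} (hy : ccDiagram.colour y = ccBasis i.2) :
    ((link y).map fun l => if Touched i l.2.1 then (1 : ZMod 2) else 0).sum = 0 := by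
  obtain ⟨⟨a, b⟩, t⟩ := i
  have hne : ∀ r : ℤ, ccBasis r = ccBasis t → r ≠ t + 1 := by
    rintro r h rfl
    rw [ccBasis_add_one] at h
    exact PauliBasis.swap_ne _ h
  have hne' : ∀ r : ℤ, (ccBasis r).swap = ccBasis t → r ≠ t ∧ r ≠ t + 2 := by
    refine fun r h => ⟨?_, ?_⟩
    · rintro rfl
      exact PauliBasis.swap_ne _ h
    · rintro rfl
      rw [ccBasis_add_two] at h
      exact PauliBasis.swap_ne _ h
  have hz : ∀ (y : CCSpider), (∀ l ∈ link y, ¬ Touched ((a, b), t) l.2.1) →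
      ((link y).map fun l => if Touched ((a, b), t) l.2.1 then (1 : ZMod 2) else 0).sum = 0 := by
    intro y h
    refine List.sum_eq_zero fun x hx => ?_
    obtain ⟨l, hl, rfl⟩ := List.mem_map.1 hx
    exact if_neg (h l hl)
  rcases y with ⟨⟨⟨i, j⟩, _ | _⟩, r⟩ | ⟨⟨i, j⟩, r⟩
  · have := hne r hy
    simp only [link, List.map_cons, List.map_nil, List.sum_cons, List.sum_nil, Touched, hexList,
      List.mem_cons, List.not_mem_nil, Prod.mk.injEq, Bool.false_eq_true, and_true, and_false,
      or_false]
    split_ifs <;> first | rfl | omega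
  · have := hne r hy
    simp only [link, List.map_cons, List.map_nil, List.sum_cons, List.sum_nil, Touched, hexList,
      List.mem_cons, List.not_mem_nil, Prod.mk.injEq, Bool.true_eq_false, and_true, and_false,
      false_or, or_false]
    split_ifs <;> first | rfl | omega
  -- Only faces in the three-by-three window around the given one can share vertices with it.
  · by_cases hr : r = t + 1 ∧ -1 ≤ i - a ∧ i - a ≤ 1 ∧ -1 ≤ j - b ∧ j - b ≤ 1
    · obtain ⟨rfl, h1, h2, h3, h4⟩ := hr
      obtain ⟨x, rfl⟩ : ∃ x, i = a + x := ⟨i - a, by ring⟩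
      obtain ⟨y, rfl⟩ : ∃ y, j = b + y := ⟨j - b, by ring⟩
      rw [add_sub_cancel_left] at h1 h2 h3 h4
      simp only [link, List.map_cons, List.map_nil, List.sum_cons, List.sum_nil, Touched, hexList,
        List.mem_cons, List.not_mem_nil, Prod.mk.injEq, Bool.true_eq_false, Bool.false_eq_true,
        and_true, and_false, or_false, false_or, true_and]
      interval_cases x <;> interval_cases y <;>
        (repeat first | rw [if_pos (by omega)] | rw [if_neg (by omega)]) <;> rfl
    · refine hz _ fun l hl => ?_
      simp only [link, List.mem_cons, List.not_mem_nil, or_false] at hl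
      rcases hl with rfl | rfl | rfl | rfl | rfl | rfl <;>
        simp only [Touched, hexList, List.mem_cons, List.not_mem_nil, Prod.mk.injEq,
          Bool.true_eq_false, Bool.false_eq_true, and_true, and_false, or_false, false_or] <;>
        omega

theorem ccRegion_subset (i : (ℤ × ℤ) × ℤ) (b : PauliBasis) :
    ccRegion i b ⊆ ccDiagram.wires.edgeSet := fun _ h => h.2.1

theorem ccRegion_eq_empty {i : (ℤ × ℤ) × ℤ} {b : PauliBasis} (h : b ≠ ccBasis i.2) :
    ccRegion i b = ∅ :=
  Set.eq_empty_of_forall_notMem fun _ he => h he.1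

theorem isWeb_empty {σ : Type} (D : ZXDiagram σ) (b : PauliBasis) : IsWeb D b ∅ :=
  ⟨Set.empty_subset _, fun _ => ⟨fun _ => by simp, fun _ => Or.inr fun _ _ _ => by simp⟩⟩

theorem isWeb_ccRegion (i : (ℤ × ℤ) × ℤ) (b : PauliBasis) : IsWeb ccDiagram b (ccRegion i b) := by
  by_cases hb : b = ccBasis i.2
  · refine unfusion.isWeb_iff.2 ⟨ccRegion_subset i b, fun y => ⟨fun hy => ?_, fun hy l hl l' hl' => ?_⟩⟩
    · rw [← sum_touched (i := i) (hy.trans hb), PathUnfusion.legSum]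
      refine congrArg List.sum (List.map_congr_left fun l hl => ?_)
      have h1 := unfusion.adj_of_link hl
      have h2 := ccDiagram_colour_adj h1
      rw [hy] at h2
      rw [if_pos trivial, ind_comm, ind]
      simp only [mem_ccRegion_of_colour hb h1.symm h2]
    · refine ind_congr ?_
      rw [mem_ccRegion_of_colour hb (unfusion.adj_of_link hl) hy,
        mem_ccRegion_of_colour hb (unfusion.adj_of_link hl') hy]
  · rw [ccRegion_eq_empty hb]
    exact isWeb_empty _ _

theorem finite_ccRegion (i : (ℤ × ℤ) × ℤ) (b : PauliBasis) : (ccRegion i b).Finite := by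
  have h1 : {y | Touched i y}.Finite := by
    refine ((List.finite_toSet (Sum.inr (i.1, i.2) :: Sum.inr (i.1, i.2 + 2) ::
      (hexList i.1).map fun v => (Sum.inl (v, i.2 + 1) : CCSpider)))).subset ?_
    rintro (⟨v, r⟩ | ⟨p, r⟩) h
    · obtain ⟨rfl, h⟩ := h
      exact List.mem_cons_of_mem _ (List.mem_cons_of_mem _ (List.mem_map.2 ⟨v, h, rfl⟩))
    · obtain ⟨rfl, rfl | rfl⟩ := h <;> simp
  refine (h1.biUnion fun y _ => (List.finite_toSet (link y)).image
    fun l => s(y, l.2.1)).subset ?_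
  intro e he
  induction e using Sym2.ind with
  | _ y y' =>
    obtain ⟨-, h2, h3⟩ := mem_ccRegion.1 he
    have key : ∀ {y y'}, ccDiagram.wires.Adj y y' → Touched i y →
        s(y, y') ∈ ⋃ y ∈ {y | Touched i y}, (fun l => s(y, l.2.1)) '' {l | l ∈ link y} := by
      intro y y' h ht
      obtain ⟨l, hl, rfl⟩ := List.mem_map.1 ((unfusion.adj_link _ _).1 h)
      exact Set.mem_biUnion ht ⟨l, hl, rfl⟩
    rcases h3 with h3 | h3
    · exact key h2 h3
    · rw [Sym2.eq_swap]
      exact key h2.symm h3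

theorem isDetectingRegion_ccRegion (i : (ℤ × ℤ) × ℤ) :
    IsDetectingRegion ccDiagram (ccRegion i) :=
  ⟨isPauliWeb_iff.2 (isWeb_ccRegion i), finite_ccRegion i⟩

/-- A finite web of the colour code only touches spiders in a bounded part of space-time. -/
theorem exists_bound {E : Set (Sym2 CCSpider)} (hE : E.Finite) : ∃ N : ℤ,
    (∀ p r y, N < |p.1| ∨ N < |p.2| ∨ N < |r| → ind E (.inr (p, r)) y = 0) ∧
    (∀ v r y, N < |r| → ind E (.inl (v, r)) y = 0) := by
  let size : CCSpider → ℤ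
    | .inl (_, r) => |r|
    | .inr (p, r) => max (max |p.1| |p.2|) |r|
  have hY : {y | ∃ e ∈ E, y ∈ e}.Finite := by
    have : {y | ∃ e ∈ E, y ∈ e} = ⋃ e ∈ E, {y | y ∈ e} := by ext y; simp
    rw [this]
    refine hE.biUnion fun e _ => ?_
    induction e using Sym2.ind with
    | _ a b => exact (Set.toFinite {a, b}).subset fun y hy => by simpa using hy
  obtain ⟨N, hN⟩ := (hY.image size).bddAbove
  have key : ∀ y y', N < size y → ind E y y' = 0 := fun y y' h => by
    rw [ind_eq_zero]
    intro he
    have := hN ⟨y, ⟨_, he, Sym2.mem_mk_left _ _⟩, rfl⟩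
    omega
  refine ⟨N, fun p r y h => key _ _ ?_, fun v r y h => key _ _ h⟩
  rcases h with h | h | h
  · exact lt_max_of_lt_left (lt_max_of_lt_left h)
  · exact lt_max_of_lt_left (lt_max_of_lt_right h)
  · exact lt_max_of_lt_right h

theorem ccBasis_sub_one (r : ℤ) : ccBasis (r - 1) = (ccBasis r).swap := by
  have := ccBasis_add_one (r - 1)
  rw [sub_add_cancel] at this
  rw [this, PauliBasis.swap_swap]

/-- The coefficients of a finite web of the colour code with respect to the basic regions. -/
theorem exists_coeff {b : PauliBasis} {E : Set (Sym2 CCSpider)} (hE : E.Finite)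
    (h : IsWeb ccDiagram b E) : ∃ V : (ℤ × ℤ) × ℤ → ZMod 2,
    {i | ccBasis i.2 = b ∧ V i = 1}.Finite ∧
    (∀ p r, ccBasis r = b → ∀ y, ccDiagram.wires.Adj (.inr (p, r)) y →
      ind E (.inr (p, r)) y = V (p, r) + V (p, r - 2)) ∧
    ∀ i j k r, ccBasis r = b → ∀ y, ccDiagram.wires.Adj (.inl (((i, j), k), r + 1)) y →
      ind E (.inl (((i, j), k), r + 1)) y = V ((i + 1, j), r) + V ((i, j + 1), r) +
        V (if k then (i + 1, j + 1) else (i, j), r) := by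
  obtain ⟨N, hN1, hN2⟩ := exists_bound hE
  obtain ⟨-, hw⟩ := unfusion.isWeb_iff.1 h
  have hadj : ∀ {y y'}, ccDiagram.wires.Adj y y' → ∃ l ∈ link y, l.2.1 = y' := fun h =>
    List.mem_map.1 ((unfusion.adj_link _ _).1 h)
  have hoth : ∀ {y y' y''}, ccDiagram.colour y = b.swap → ccDiagram.wires.Adj y y' →
      ccDiagram.wires.Adj y y'' → ind E y y' = ind E y y'' := by
    intro y y' y'' hy h1 h2
    obtain ⟨l, hl, rfl⟩ := hadj h1
    obtain ⟨l', hl', rfl⟩ := hadj h2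
    exact (hw y).2 hy l hl l' hl'
  have hup : ∀ v r, ccDiagram.wires.Adj (.inl (v, r)) (.inl (v, r + 1)) := by
    rintro ⟨⟨i, j⟩, _ | _⟩ r <;> rw [ccDiagram_adj_link] <;> simp [link]
  have hface : ∀ p r, ccDiagram.wires.Adj (.inr (p, r)) (.inl ((p, false), r)) := by
    rintro ⟨i, j⟩ r
    rw [ccDiagram_adj_link]
    simp [link]
  -- `F p n` counts modulo 2 the highlighted face spiders of `p` at times up to `n` in the right
  -- basis. A basic region highlights its face at `r` and `r + 2`, so this is the coefficient of the
  -- region that starts at the latest such time.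
  have hex : ∀ p : ℤ × ℤ, ∃ F : ℤ → ZMod 2, (∀ n < -N, F n = 0) ∧
      (∀ n, F (n + 1) = F n +
        if ccBasis (n + 1) = b then ind E (.inr (p, n + 1)) (.inl ((p, false), n + 1)) else 0) ∧
      ((∀ n, (if ccBasis n = b then ind E (.inr (p, n)) (.inl ((p, false), n)) else 0) = 0) →
        ∀ n, F n = 0) := by
    intro p
    refine exists_sum (fun n => if ccBasis n = b then
      ind E (.inr (p, n)) (.inl ((p, false), n)) else 0) fun n hn => ?_
    rw [hN1 p n _ (Or.inr (Or.inr (lt_abs.2 (Or.inr (by omega))))), ite_self]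
  choose F hF1 hF2 hF3 using hex
  have hstep : ∀ p r, ccBasis r = b →
      F p r = F p (r - 2) + ind E (.inr (p, r)) (.inl ((p, false), r)) := by
    intro p r hr
    have h1 := hF2 p (r - 1)
    have h2 := hF2 p (r - 2)
    rw [show r - 2 + 1 = r - 1 by ring, if_neg, add_zero] at h2
    · rw [show r - 1 + 1 = r by ring, h2, if_pos hr] at h1
      exact h1
    · rw [ccBasis_sub_one, hr]
      exact b.swap_ne
  have hfar : ∀ p : ℤ × ℤ, N < |p.1| ∨ N < |p.2| → ∀ n, F p n = 0 := by
    intro p hp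
    refine hF3 p fun n => ?_
    rw [hN1 p n _ (by tauto), ite_self]
  have hface' : ∀ {f r v}, ccBasis r = b → ccDiagram.wires.Adj (.inr (f, r)) (.inl (v, r)) →
      ind E (.inl (v, r)) (.inr (f, r)) = F f r + F f (r - 2) := by
    intro f r v hr hv
    rw [ind_comm, hoth (by rw [← hr]; rfl) hv (hface f r), hstep f r hr, add_right_comm,
      zmod_two_add_self, zero_add]
  -- Parity at the vertex spider of time `r` expresses the change along the world-line through the
  -- three incident face legs, which are the increments of `F`. Both sides vanish in the far past,
  -- so they agree at all times.
  have hvert : ∀ i j k r, ccBasis r = b → ind E (.inl (((i, j), k), r + 1))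
      (.inl (((i, j), k), r + 1 + 1)) = F (i + 1, j) r + F (i, j + 1) r +
        F (if k then (i + 1, j + 1) else (i, j)) r := by
    intro i j k
    have hrec : ∀ r, ccBasis r = b → ind E (.inl (((i, j), k), r + 1))
        (.inl (((i, j), k), r + 1 + 1)) = ind E (.inl (((i, j), k), r - 1)) (.inl (((i, j), k), r)) +
        ((F (i + 1, j) r + F (i + 1, j) (r - 2)) + (F (i, j + 1) r + F (i, j + 1) (r - 2)) +
        (F (if k then (i + 1, j + 1) else (i, j)) r +
          F (if k then (i + 1, j + 1) else (i, j)) (r - 2))) := by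
      intro r hr
      have h1 := (hw (.inl (((i, j), k), r))).1 hr
      have h3 : ind E (.inl (((i, j), k), r + 1)) (.inl (((i, j), k), r + 1 + 1)) =
          ind E (.inl (((i, j), k), r)) (.inl (((i, j), k), r + 1)) := by
        rw [ind_comm (Sum.inl (((i, j), k), r))]
        refine hoth ?_ (hup _ _) (hup _ _).symm
        change ccBasis (r + 1) = _
        rw [ccBasis_add_one, hr]
      rw [h3, ind_comm (Sum.inl (((i, j), k), r - 1)), ← zmod_two_add_eq_zero, ← h1,
        PathUnfusion.legSum]
      cases k
      · rw [← hface' hr (f := (i + 1, j)) (v := ((i, j), false)), ← hface' hr (f := (i, j + 1))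
          (v := ((i, j), false)), if_neg Bool.false_ne_true, ← hface' hr (f := (i, j)) (v := ((i, j), false))]
        · rw [show unfusion.link = link from rfl]
          simp only [link, List.map_cons, List.map_nil, List.sum_cons, List.sum_nil, if_true]
          ring
        all_goals rw [ccDiagram_adj_link]; simp [link]
      · rw [← hface' hr (f := (i + 1, j)) (v := ((i, j), true)), ← hface' hr (f := (i, j + 1))
          (v := ((i, j), true)), if_pos rfl, ← hface' hr (f := (i + 1, j + 1))
          (v := ((i, j), true))]
        · rw [show unfusion.link = link from rfl]
          simp only [link, List.map_cons, List.map_nil, List.sum_cons, List.sum_nil, if_true]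
          ring
        all_goals rw [ccDiagram_adj_link]; simp [link]
    -- The induction advances by two timesteps, since only every other timestep has the right basis.
    have hind : ∀ (n : ℕ) r, r < -N - 1 + 2 * n → ccBasis r = b → ind E (.inl (((i, j), k), r + 1))
      (.inl (((i, j), k), r + 1 + 1)) = F (i + 1, j) r + F (i, j + 1) r +
        F (if k then (i + 1, j + 1) else (i, j)) r := by
      intro n
      induction n with
      | zero =>
        intro r hr _
        rw [hN2 _ _ _ (lt_abs.2 (Or.inr (by push_cast at hr; omega))), hF1 _ _ (by push_cast at hr; omega),
          hF1 _ _ (by push_cast at hr; omega), hF1 _ _ (by push_cast at hr; omega)]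
        rfl
      | succ n ih =>
        intro r hr hb
        have h1 := ih (r - 2) (by push_cast at hr; omega) (by
          rw [← hb, ← ccBasis_add_two (r - 2), sub_add_cancel])
        rw [show r - 2 + 1 = r - 1 by ring, sub_add_cancel] at h1
        rw [hrec r hb, h1]
        have h2 : ∀ a b c a' b' c' : ZMod 2,
            a + b + c + ((a' + a) + (b' + b) + (c' + c)) = a' + b' + c' := by decide
        exact h2 _ _ _ _ _ _
    intro r
    exact hind (r + N + 2).toNat r (by omega)
  refine ⟨fun i => F i.1 i.2, ?_, ?_, ?_⟩
  · refine (((Set.finite_Icc (-N) N).prod (Set.finite_Icc (-N) N)).prod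
      (Set.finite_Icc (-N) N)).subset ?_
    rintro ⟨⟨i, j⟩, r⟩ ⟨hr, hV⟩
    dsimp only at hr hV
    have h0 : ∀ {x : ZMod 2}, x = 1 → x ≠ 0 := by rintro _ rfl; exact one_ne_zero
    replace hV := h0 hV
    have h1 : ∀ x : ℤ, ¬ N < |x| → x ∈ Set.Icc (-N) N := fun x hx => by
      rw [Set.mem_Icc, ← abs_le]
      exact not_lt.1 hx
    refine ⟨⟨h1 _ fun h => hV (hfar _ (Or.inl h) r), h1 _ fun h => hV (hfar _ (Or.inr h) r)⟩,
      ?_, ?_⟩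
    · by_contra hlt
      exact hV (hF1 _ _ (not_le.1 hlt))
    · by_contra hlt
      have hlt : N < r := not_le.1 hlt
      -- At late times the world-lines are not highlighted, so `F` sums to zero over all triangles
      -- of one orientation; having finite support in space it vanishes. Hence only finitely many
      -- coefficients are nonzero.
      refine hV (eq_zero_of_triangles (V := fun p => F p r) (N := 2 * N) (fun p hp => ?_)
        (fun i j => ?_) (i, j))
      · refine hfar p ?_ r
        rw [lt_abs, lt_abs]
        omega
      · have := hvert i j false r hr
        rw [hN2 _ _ _ (lt_abs.2 (Or.inl (by omega)))] at this
        rw [this]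
        simp only [Bool.false_eq_true, if_false]
        ring
  · intro p r hr y hy
    change _ = F p r + F p (r - 2)
    rw [hoth (by rw [← hr]; rfl) hy (hface p r), hstep p r hr, add_right_comm,
      zmod_two_add_self, zero_add]
  · intro i j k r hr y hy
    rw [← hvert i j k r hr]
    refine hoth ?_ hy (hup _ _)
    change ccBasis (r + 1) = _
    rw [ccBasis_add_one, hr]

/-- Every detecting region of the colour code is a product of basic ones. -/
theorem exists_isProductOf_ccRegion {h : PauliBasis → Set (Sym2 CCSpider)}
    (hh : IsDetectingRegion ccDiagram h) : ∃ S, IsProductOf ccRegion S h := by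
  have hweb := isPauliWeb_iff.1 hh.1
  choose V hV1 hV2 hV3 using fun b => exists_coeff (hh.2 b) (hweb b)
  have hfin : {i : (ℤ × ℤ) × ℤ | V (ccBasis i.2) i = 1}.Finite := by
    refine ((hV1 .X).union (hV1 .Z)).subset fun i hi => ?_
    rcases hb : ccBasis i.2 with _ | _
    · exact Or.inl ⟨hb, by rw [← hb]; exact hi⟩
    · exact Or.inr ⟨hb, by rw [← hb]; exact hi⟩
  have hS : ∀ i, i ∈ hfin.toFinset ↔ V (ccBasis i.2) i = 1 := fun i => hfin.mem_toFinset
  -- It suffices to compare both sides at the end of the wire whose colour is opposite to `b`. A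
  -- vertex spider is touched by the regions of its three faces, a face spider by the two regions
  -- that end or start there.
  have key : ∀ b y y', ccDiagram.wires.Adj y y' → ccDiagram.colour y = b.swap →
      (s(y, y') ∈ h b ↔ Odd {i | i ∈ hfin.toFinset ∧ s(y, y') ∈ ccRegion i b}.ncard) := by
    intro b y y' hy hc
    have hP : ∀ i, s(y, y') ∈ ccRegion i b ↔ b = ccBasis i.2 ∧ Touched i y := fun i => by
      by_cases hb : b = ccBasis i.2
      · rw [mem_ccRegion_of_colour hb hy hc]
        simp [hb]
      · rw [ccRegion_eq_empty hb]
        simp [hb]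
    rw [← ind_eq_one]
    rcases y with ⟨⟨⟨i, j⟩, k⟩, r⟩ | ⟨p, r⟩
    · obtain ⟨r, rfl⟩ : ∃ r', r = r' + 1 := ⟨r - 1, by ring⟩
      have hr : ccBasis r = b := by
        have : ccBasis (r + 1) = b.swap := hc
        rw [ccBasis_add_one] at this
        rw [← PauliBasis.swap_swap (ccBasis r), this, PauliBasis.swap_swap]
      rw [hV3 b i j k r hr _ hy, odd_ncard_iff
        (L := [((i + 1, j), r), ((i, j + 1), r), (if k then (i + 1, j + 1) else (i, j), r)])
        (by cases k <;> simp) _ (V b)]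
      · simp [add_assoc]
      · intro x hx
        rw [hS]
        have : x.2 = r := by
          simp only [List.mem_cons, List.not_mem_nil, or_false] at hx
          rcases hx with rfl | rfl | rfl <;> rfl
        rw [this, hr]
      · rintro ⟨⟨i', j'⟩, r'⟩ -
        rw [hP]
        simp only [Touched, hexList, List.mem_cons, List.not_mem_nil, or_false]
        constructor
        · rintro ⟨-, h1, h2⟩
          obtain rfl : r = r' := by omega
          cases k <;> simp only [Prod.mk.injEq, Bool.true_eq_false, Bool.false_eq_true, and_true,
            and_false, or_false, false_or, if_true, if_false] at h2 ⊢ <;> omega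
        · intro h2
          have h3 : r' = r := by
            simp only [Prod.mk.injEq] at h2
            tauto
          subst h3
          refine ⟨hr.symm, rfl, ?_⟩
          cases k <;> simp only [Prod.mk.injEq, Bool.true_eq_false, Bool.false_eq_true, and_true,
            and_false, or_false, false_or, if_true, if_false] at h2 ⊢ <;> omega
    · have hr : ccBasis r = b := by
        have : (ccBasis r).swap = b.swap := hc
        rw [← PauliBasis.swap_swap (ccBasis r), this, PauliBasis.swap_swap]
      have hr2 : ccBasis (r - 2) = b := by
        rw [← hr, ← ccBasis_add_two (r - 2), sub_add_cancel]
      rw [hV2 b p r hr _ hy, odd_ncard_iff (L := [(p, r), (p, r - 2)]) (by simp; omega) _ (V b)]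
      · simp
      · intro x hx
        rw [hS]
        simp only [List.mem_cons, List.not_mem_nil, or_false] at hx
        rcases hx with rfl | rfl
        · rw [hr]
        · rw [hr2]
      · rintro ⟨p', r'⟩ -
        rw [hP]
        simp only [Touched, List.mem_cons, List.not_mem_nil, or_false, Prod.mk.injEq]
        constructor
        · rintro ⟨-, rfl, h⟩
          rcases h with rfl | rfl
          · exact Or.inl ⟨rfl, rfl⟩
          · exact Or.inr ⟨rfl, by ring⟩
        · rintro (⟨rfl, rfl⟩ | ⟨rfl, rfl⟩)
          · exact ⟨hr.symm, rfl, Or.inl rfl⟩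
          · exact ⟨hr2.symm, rfl, Or.inr (by ring)⟩
  refine ⟨hfin.toFinset, fun b e => ?_⟩
  by_cases he : e ∈ ccDiagram.wires.edgeSet
  · induction e using Sym2.ind with
    | _ y y' =>
      by_cases hc : ccDiagram.colour y = b.swap
      · exact key b y y' he hc
      · rw [Sym2.eq_swap]
        have he' : ccDiagram.wires.Adj y y' := he
        refine key b y' y he'.symm ?_
        rw [ccDiagram_colour_adj he', PauliBasis.eq_swap_of_ne hc, PauliBasis.swap_swap]
  · have : {i | i ∈ hfin.toFinset ∧ e ∈ ccRegion i b} = ∅ :=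
      Set.eq_empty_of_forall_notMem fun i hi => he (ccRegion_subset _ _ hi.2)
    rw [this]
    simp only [Set.ncard_empty, Nat.not_odd_zero, iff_false]
    exact fun h' => he ((hweb b).1 h')

/-! ## Detecting regions of the unfused diagram -/

theorem odd_ncard_sum {ι : Type*} (S : Finset ι) (P : ι → Prop) [DecidablePred P] :
    Odd {i | i ∈ S ∧ P i}.ncard ↔ ∑ i ∈ S, (if P i then (1 : ZMod 2) else 0) = 1 := by
  classical
  have h1 : {i | i ∈ S ∧ P i} = ((S.filter P : Finset ι) : Set ι) := by
    ext i
    simp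
  rw [h1, Set.ncard_coe_finset, Finset.sum_boole, ← Nat.not_even_iff_odd,
    ← ZMod.natCast_eq_zero_iff_even]
  rcases zmod_two_cases (((S.filter P).card : ℕ) : ZMod 2) with h | h <;> simp [h]

namespace PathUnfusion

variable {σ τ ι : Type} {D : ZXDiagram σ} {D' : ZXDiagram τ} (U : PathUnfusion D D')
variable {b : PauliBasis} {E' : Set (Sym2 τ)}

theorem extends_ext (h' : PauliBasis → Set (Sym2 τ)) :
    Extends D U.π (fun b => U.ext b (h' b)) h' := by
  intro b s s' h hne
  obtain ⟨l, hl, h1, h2, h3⟩ := U.exists_link h hne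
  rw [h3, h2]
  nth_rw 1 [h1]
  exact U.mem_ext_link hl

theorem push_of_extends {h : PauliBasis → Set (Sym2 σ)} {h' : PauliBasis → Set (Sym2 τ)}
    (hh' : ∀ b, h' b ⊆ D'.wires.edgeSet) (he : Extends D U.π h h') (b : PauliBasis) :
    U.push (h b) = h' b := by
  have key : ∀ y, ∀ l ∈ U.link y,
      (s(U.sp y l.1, U.sp l.2.1 l.2.2) ∈ h b ↔ s(y, l.2.1) ∈ h' b) := by
    intro y l hl
    have h1 := U.π_sp y l.1 (U.link_lt y l hl)
    have h2 := U.π_sp l.2.1 l.2.2 (U.link_lt' hl)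
    rw [he b _ _ (U.adj_sp_of_link hl) (by rw [h1, h2]; exact (U.adj_of_link hl).ne), h1, h2]
  ext e
  constructor
  · rintro ⟨y, l, hl, rfl, h⟩
    exact (key y l hl).1 h
  · intro h
    induction e using Sym2.ind with
    | _ y y' =>
      obtain ⟨l, hl, rfl⟩ := List.mem_map.1 ((U.adj_link _ _).1 (hh' b h))
      exact (U.mem_push hl).2 ((key y l hl).2 h)

/-- An extension has a prescribed restriction to the legs, and the legs force the rest. -/
theorem eq_ext_of_extends {h : PauliBasis → Set (Sym2 σ)} {h' : PauliBasis → Set (Sym2 τ)}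
    (hh : IsPauliWeb D h) (hh' : ∀ b, h' b ⊆ D'.wires.edgeSet) (he : Extends D U.π h h') :
    h = fun b => U.ext b (h' b) := by
  funext b
  rw [← U.push_of_extends hh' he b, U.ext_push (isPauliWeb_iff.1 hh b)]

theorem isDetectingRegion_ext {h' : PauliBasis → Set (Sym2 τ)} (hh' : IsDetectingRegion D' h') :
    IsDetectingRegion D fun b => U.ext b (h' b) :=
  ⟨isPauliWeb_iff.2 fun b => U.isWeb_ext (isPauliWeb_iff.1 hh'.1 b),
    fun b => U.finite_ext (hh'.2 b)⟩

theorem isDetectingRegion_push {h : PauliBasis → Set (Sym2 σ)} (hh : IsDetectingRegion D h) :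
    IsDetectingRegion D' fun b => U.push (h b) :=
  ⟨isPauliWeb_iff.2 fun b => (U.isWeb_spec (isPauliWeb_iff.1 hh.1 b)).1,
    fun b => U.finite_push (hh.2 b)⟩

theorem inner_of_colour {y : τ} {m : ℕ} (hy : D'.colour y = b) :
    U.inner b E' y m ↔ U.legSum E' y (· ≤ m) = 1 := by
  rw [inner, hy]
  simp [b.ne_swap]

theorem inner_of_colour_swap (hE' : IsWeb D' b E') {y : τ} {m : ℕ} (hy : D'.colour y = b.swap)
    {l : ℕ × τ × ℕ} (hl : l ∈ U.link y) : U.inner b E' y m ↔ s(y, l.2.1) ∈ E' := by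
  rw [inner, hy]
  simp only [PauliBasis.swap_ne, false_and, true_and, false_or]
  refine ⟨fun ⟨l', hl', h⟩ => ?_, fun h => ⟨l, hl, h⟩⟩
  rw [← ind_eq_one, ((U.isWeb_iff.1 hE').2 y).2 hy l hl l' hl', ind_eq_one]
  exact h

/-- Partial leg sums are additive in the web, and in the other colour a single leg decides; so
extension commutes with sums modulo 2. -/
theorem isProductOf_ext {R : ι → PauliBasis → Set (Sym2 τ)} {h' : PauliBasis → Set (Sym2 τ)}
    {S : Finset ι} (hR : ∀ i b, IsWeb D' b (R i b)) (hh' : ∀ b, IsWeb D' b (h' b))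
    (h : IsProductOf R S h') :
    IsProductOf (fun i b => U.ext b (R i b)) S fun b => U.ext b (h' b) := by
  classical
  have hind : ∀ b y y', ind (h' b) y y' = ∑ i ∈ S, ind (R i b) y y' := by
    intro b y y'
    have h1 := h b s(y, y')
    rw [odd_ncard_sum, ← ind_eq_one] at h1
    have h2 : ∑ i ∈ S, ind (R i b) y y' =
        ∑ i ∈ S, if s(y, y') ∈ R i b then (1 : ZMod 2) else 0 :=
      Finset.sum_congr rfl fun i _ => by rw [ind]
    rw [h2]
    revert h1
    generalize ind (h' b) y y' = x
    generalize (∑ i ∈ S, if s(y, y') ∈ R i b then (1 : ZMod 2) else 0) = z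
    revert x z
    decide
  intro b e
  by_cases he : e ∈ D.wires.edgeSet
  · rcases U.edge_cases he with ⟨y, l, hl, rfl⟩ | ⟨y, m, hm, rfl⟩
    · simp only [U.mem_ext_link hl]
      exact h b _
    · simp only [U.mem_ext_succ hm]
      by_cases hy : D'.colour y = b
      · simp only [U.inner_of_colour hy]
        rw [odd_ncard_sum]
        have h1 : U.legSum (h' b) y (· ≤ m) = ∑ i ∈ S, U.legSum (R i b) y (· ≤ m) := by
          have : ∀ L : List (ℕ × τ × ℕ),
              (L.map fun l => if l.1 ≤ m then ind (h' b) y l.2.1 else 0).sum =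
              ∑ i ∈ S, (L.map fun l => if l.1 ≤ m then ind (R i b) y l.2.1 else 0).sum := by
            intro L
            induction L with
            | nil => simp
            | cons l L ih =>
              simp only [List.map_cons, List.sum_cons, Finset.sum_add_distrib, ← ih, hind b y l.2.1]
              split_ifs <;> simp
          exact this _
        rw [h1]
        refine Iff.of_eq (congrArg (· = 1) (Finset.sum_congr rfl fun i _ => ?_))
        rcases zmod_two_cases (U.legSum (R i b) y (· ≤ m)) with h0 | h0 <;> rw [h0] <;> decide
      · replace hy := PauliBasis.eq_swap_of_ne hy
        obtain ⟨l, hl⟩ := List.exists_mem_of_ne_nil _ (U.link_ne_nil y)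
        simp only [U.inner_of_colour_swap (hh' b) hy hl, U.inner_of_colour_swap (hR _ b) hy hl]
        exact h b _
  · have : {i | i ∈ S ∧ e ∈ U.ext b (R i b)} = ∅ :=
      Set.eq_empty_of_forall_notMem fun i hi => he (U.ext_subset hi.2)
    rw [this]
    simp only [Set.ncard_empty, Nat.not_odd_zero, iff_false]
    exact fun h' => he (U.ext_subset h')

end PathUnfusion

/-- The detecting regions of the Floquetified code that extend the basic ones of the colour code. -/
noncomputable def region (i : (ℤ × ℤ) × ℤ) (b : PauliBasis) : Set (Sym2 FSpider) :=
  unfusion.ext b (ccRegion i b)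

/-- A detecting region is pushed to the colour code, decomposed there, and recovered by extension.
-/
theorem exists_isProductOf_region {h : PauliBasis → Set (Sym2 FSpider)}
    (hh : IsDetectingRegion fDiagram h) : ∃ S, IsProductOf region S h := by
  have h1 := unfusion.isDetectingRegion_push hh
  obtain ⟨S, hS⟩ := exists_isProductOf_ccRegion h1
  have h2 := unfusion.isProductOf_ext isWeb_ccRegion (isPauliWeb_iff.1 h1.1) hS
  refine ⟨S, fun b e => ?_⟩
  rw [← unfusion.ext_push (isPauliWeb_iff.1 hh.1 b)]
  exact h2 b e

/-! ## Translations of the basic regions -/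

/-- Exchange of the bases by translation through an odd number of timesteps. -/
def turn (n : ℤ) (b : PauliBasis) : PauliBasis := if Even n then b else b.swap

theorem turn_swap (n : ℤ) (b : PauliBasis) : turn n b.swap = (turn n b).swap := by
  unfold turn
  split_ifs <;> rfl

theorem turn_inj {n : ℤ} {b c : PauliBasis} : turn n b = turn n c ↔ b = c := by
  unfold turn
  split_ifs <;> cases b <;> cases c <;> simp [PauliBasis.swap]

theorem ccBasis_add (r n : ℤ) : ccBasis (r + n) = turn n (ccBasis r) := by
  unfold ccBasis turn
  by_cases h1 : Even r <;> by_cases h2 : Even n <;> simp [Int.even_add, h1, h2, PauliBasis.swap]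

theorem colour_ccShift (d : ℤ × ℤ) (n : ℤ) (y : CCSpider) :
    ccDiagram.colour (ccShift d n y) = turn n (ccDiagram.colour y) := by
  rcases y with ⟨⟨p, k⟩, r⟩ | ⟨p, r⟩
  · exact ccBasis_add r n
  · change (ccBasis (r + n)).swap = turn n (ccBasis r).swap
    rw [ccBasis_add, turn_swap]

theorem ccShift_ccShift (d d' : ℤ × ℤ) (n n' : ℤ) (y : CCSpider) :
    ccShift d n (ccShift d' n' y) = ccShift (d' + d) (n' + n) y := by
  rcases y with ⟨⟨p, k⟩, r⟩ | ⟨p, r⟩ <;> simp [ccShift, add_assoc]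

theorem ccShift_zero (y : CCSpider) : ccShift 0 0 y = y := by
  rcases y with ⟨⟨p, k⟩, r⟩ | ⟨p, r⟩ <;> simp [ccShift]

theorem ccShift_neg (d : ℤ × ℤ) (n : ℤ) (y : CCSpider) : ccShift d n (ccShift (-d) (-n) y) = y := by
  rw [ccShift_ccShift, neg_add_cancel, neg_add_cancel, ccShift_zero]

theorem link_ccShift (d : ℤ × ℤ) (n : ℤ) (y : CCSpider) :
    link (ccShift d n y) = (link y).map fun l => (l.1, ccShift d n l.2.1, l.2.2) := by
  obtain ⟨a, c⟩ := d
  rcases y with ⟨⟨⟨i, j⟩, _ | _⟩, r⟩ | ⟨⟨i, j⟩, r⟩ <;>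
    simp [link, ccShift] <;> refine ⟨?_, ?_⟩ <;> ring_nf <;> simp

theorem touched_ccShift (d : ℤ × ℤ) (n : ℤ) (i : (ℤ × ℤ) × ℤ) (y : CCSpider) :
    Touched (i + (d, n)) (ccShift d n y) ↔ Touched i y := by
  obtain ⟨⟨a, c⟩, t⟩ := i
  obtain ⟨d1, d2⟩ := d
  rcases y with ⟨⟨⟨i, j⟩, _ | _⟩, r⟩ | ⟨⟨i, j⟩, r⟩ <;>
    simp [Touched, ccShift, hexList] <;> omega

theorem mem_ccRegion_ccShift {d : ℤ × ℤ} {n : ℤ} {i : (ℤ × ℤ) × ℤ} {b : PauliBasis}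
    {y : CCSpider} {l : ℕ × CCSpider × ℕ} (hl : l ∈ link y) :
    s(ccShift d n y, ccShift d n l.2.1) ∈ ccRegion (i + (d, n)) (turn n b) ↔
      s(y, l.2.1) ∈ ccRegion i b := by
  have h1 : ccDiagram.wires.Adj y l.2.1 := unfusion.adj_of_link hl
  have h2 : (l.1, ccShift d n l.2.1, l.2.2) ∈ link (ccShift d n y) := by
    rw [link_ccShift]
    exact List.mem_map.2 ⟨l, hl, rfl⟩
  have h3 : ccDiagram.wires.Adj (ccShift d n y) (ccShift d n l.2.1) := unfusion.adj_of_link h2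
  rw [mem_ccRegion, mem_ccRegion, touched_ccShift, touched_ccShift]
  simp only [h1, h3, true_and, Prod.snd_add, ccBasis_add, turn_inj]

theorem inner_ccShift {d : ℤ × ℤ} {n : ℤ} {i : (ℤ × ℤ) × ℤ} {b : PauliBasis} {y : CCSpider}
    {m : ℕ} : unfusion.inner (turn n b) (ccRegion (i + (d, n)) (turn n b)) (ccShift d n y) m ↔
      unfusion.inner b (ccRegion i b) y m := by
  have h1 : unfusion.legSum (ccRegion (i + (d, n)) (turn n b)) (ccShift d n y) (· ≤ m) =
      unfusion.legSum (ccRegion i b) y (· ≤ m) := by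
    rw [PathUnfusion.legSum, PathUnfusion.legSum, show unfusion.link = link from rfl, link_ccShift,
      List.map_map]
    refine congrArg List.sum (List.map_congr_left fun l hl => ?_)
    exact if_congr Iff.rfl (ind_congr (mem_ccRegion_ccShift hl)) rfl
  rw [PathUnfusion.inner, PathUnfusion.inner, h1, colour_ccShift, ← turn_swap, turn_inj, turn_inj,
    show unfusion.link = link from rfl, link_ccShift]
  refine or_congr Iff.rfl (and_congr Iff.rfl ?_)
  simp only [List.mem_map]
  constructor
  · rintro ⟨_, ⟨l, hl, rfl⟩, h⟩
    exact ⟨l, hl, (mem_ccRegion_ccShift hl).1 h⟩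
  · rintro ⟨l, hl, h⟩
    exact ⟨_, ⟨l, hl, rfl⟩, (mem_ccRegion_ccShift hl).2 h⟩

/-- The translation of space that corresponds to a translation of the colour code. -/
def spaceShift (d : ℤ × ℤ) (n : ℤ) : Site := (3 * d.1 + d.2, d.1 + d.2 - n)

/-- The translation of time that corresponds to a translation of the colour code. -/
def timeShift (d : ℤ × ℤ) (n : ℤ) : ℤ := 3 * d.2 + 2 * n

theorem spider_ccShift (d : ℤ × ℤ) (n : ℤ) (y : CCSpider) (m : ℕ) :
    (spider (ccShift d n y) m).1 = ((spider y m).1.1 + spaceShift d n,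
      (spider y m).1.2.1 + timeShift d n, (spider y m).1.2.2) := by
  change ((place (ccShift d n y) m).1, (place (ccShift d n y) m).2,
    placeFlag (ccShift d n y) m) = _
  rw [place_ccShift, placeFlag_ccShift]
  rfl

/-- The path structure and the basic regions are both equivariant under translations of the colour
code, which `place` turns into space-time translations. Odd time shifts exchange the bases. Taking
the trivial shift on one side compares plain triples, free of the constraint on flags. -/
theorem shiftWires_region (d : ℤ × ℤ) (n : ℤ) (i : (ℤ × ℤ) × ℤ) (b : PauliBasis) :
    shiftWires 0 0 (region (i + (d, n)) (turn n b)) =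
      shiftWires (spaceShift d n) (timeShift d n) (region i b) := by
  have key : ∀ y y' m m', Sym2.map (fun s : FSpider => (s.1.1 + (0 : Site), s.1.2.1 + (0 : ℤ), s.1.2.2))
      s(spider (ccShift d n y) m, spider (ccShift d n y') m') =
      Sym2.map (fun s : FSpider => (s.1.1 + spaceShift d n, s.1.2.1 + timeShift d n, s.1.2.2))
        s(spider y m, spider y' m') := by
    intro y y' m m'
    rw [Sym2.map_mk, Sym2.map_mk, spider_ccShift, spider_ccShift]
    simp only [add_zero]
  ext e
  constructor
  · rintro ⟨_, ⟨y, l, hl, h, rfl⟩ | ⟨y, m, hm, h, rfl⟩, rfl⟩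
    · obtain ⟨y, rfl⟩ : ∃ y', y = ccShift d n y' := ⟨_, (ccShift_neg d n y).symm⟩
      rw [show unfusion.link = link from rfl, link_ccShift] at hl
      obtain ⟨l, hl', rfl⟩ := List.mem_map.1 hl
      exact ⟨_, Or.inl ⟨y, l, hl', (mem_ccRegion_ccShift hl').1 h, rfl⟩, (key _ _ _ _).symm⟩
    · obtain ⟨y, rfl⟩ : ∃ y', y = ccShift d n y' := ⟨_, (ccShift_neg d n y).symm⟩
      rw [show unfusion.len = pathLen from rfl, pathLen_ccShift] at hm
      exact ⟨_, Or.inr ⟨y, m, hm, inner_ccShift.1 h, rfl⟩, (key _ _ _ _).symm⟩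
  · rintro ⟨_, ⟨y, l, hl, h, rfl⟩ | ⟨y, m, hm, h, rfl⟩, rfl⟩
    · refine ⟨_, Or.inl ⟨ccShift d n y, (l.1, ccShift d n l.2.1, l.2.2), ?_,
        (mem_ccRegion_ccShift hl).2 h, rfl⟩, key _ _ _ _⟩
      rw [show unfusion.link = link from rfl, link_ccShift]
      exact List.mem_map.2 ⟨l, hl, rfl⟩
    · refine ⟨_, Or.inr ⟨ccShift d n y, m, ?_, inner_ccShift.2 h, rfl⟩, key _ _ _ _⟩
      rw [show unfusion.len = pathLen from rfl, pathLen_ccShift]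
      exact hm

/-! ## Detectors -/

theorem stClass_spaceShift (d : ℤ × ℤ) (n : ℤ) :
    stClass (spaceShift d n) (timeShift d n) = if Even n then 0 else 13 := by
  have h0 : ∀ m : ℤ, ((26 * m : ℤ) : ZMod 26) = 0 := fun m =>
    (ZMod.intCast_zmod_eq_zero_iff_dvd _ 26).2 ⟨m, rfl⟩
  rw [stClass_eq_cast]
  simp only [spaceShift, timeShift]
  split_ifs with hn
  · obtain ⟨m, rfl⟩ := hn
    rw [← h0 (-d.2 - m)]
    congr 1
    ring
  · obtain ⟨m, rfl⟩ := Int.not_even_iff_odd.1 hn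
    rw [← zero_add (13 : ZMod 26), ← h0 (-d.2 - m - 1), show (13 : ZMod 26) = ((13 : ℤ) : ZMod 26)
      from rfl, ← Int.cast_add]
    congr 1
    ring

theorem basis_spaceShift (d : ℤ × ℤ) (n : ℤ) (q : Site) (t : ℤ) :
    basis (q + spaceShift d n) (t + timeShift d n) = turn n (basis q t) := by
  have h := stClass_spaceShift d n
  unfold turn
  split_ifs at h ⊢
  · exact basis_translate h q t
  · exact basis_translate_swap h q t

theorem partner_spaceShift (d : ℤ × ℤ) (n : ℤ) (q : Site) (t : ℤ) :
    partner (q + spaceShift d n) (t + timeShift d n) = partner q t := by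
  have h := stClass_spaceShift d n
  split_ifs at h
  · exact partner_translate h q t
  · exact partner_translate_swap h q t

theorem mem_shiftWires {D : Site} {N : ℤ} {E : Set (Sym2 FSpider)} {q q' : Site} {t t' : ℤ}
    {k k' : Bool} : s((q + D, t + N, k), (q' + D, t' + N, k')) ∈ shiftWires D N E ↔
      ∃ s s' : FSpider, s.1 = (q, t, k) ∧ s'.1 = (q', t', k') ∧ s(s, s') ∈ E := by
  constructor
  · rintro ⟨e, he, h⟩
    induction e using Sym2.ind with
    | _ s s' =>
      have hs : ∀ {s : FSpider} {q : Site} {t : ℤ} {k : Bool},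
          (s.1.1 + D, s.1.2.1 + N, s.1.2.2) = (q + D, t + N, k) → s.1 = (q, t, k) := by
        intro s q t k h
        simp only [Prod.mk.injEq, add_left_inj] at h
        exact Prod.ext h.1 (Prod.ext h.2.1 h.2.2)
      rcases Sym2.eq_iff.1 h with ⟨h1, h2⟩ | ⟨h1, h2⟩
      · exact ⟨s, s', hs h1, hs h2, he⟩
      · exact ⟨s', s, hs h2, hs h1, by rwa [Sym2.eq_swap]⟩
  · rintro ⟨s, s', h1, h2, h⟩
    refine ⟨_, h, ?_⟩
    rw [Sym2.map_mk, h1, h2]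

theorem exists_mem_shiftWires {D : Site} {N : ℤ} {E : Set (Sym2 FSpider)} {q : Site} {t : ℤ}
    {k : Bool} : (∃ z, s((q + D, t + N, k), z) ∈ shiftWires D N E) ↔
      ∃ s : FSpider, s.1 = (q, t, k) ∧ ∃ e ∈ E, s ∈ e := by
  constructor
  · rintro ⟨⟨q', t', k'⟩, h⟩
    rw [← sub_add_cancel q' D, ← sub_add_cancel t' N, mem_shiftWires] at h
    obtain ⟨s, s', h1, -, h2⟩ := h
    exact ⟨s, h1, _, h2, Sym2.mem_mk_left _ _⟩
  · rintro ⟨s, h1, e, he, hs⟩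
    obtain ⟨s', rfl⟩ := Sym2.mem_iff_exists.1 hs
    exact ⟨_, mem_shiftWires.2 ⟨s, s', h1, rfl, he⟩⟩

theorem pairTouched_region_add {d : ℤ × ℤ} {n : ℤ} {i : (ℤ × ℤ) × ℤ} {q : Site} {t : ℤ} :
    PairTouched (region (i + (d, n))) (q + spaceShift d n) (t + timeShift d n) ↔
      PairTouched (region i) q t := by
  unfold PairTouched
  rw [partner_spaceShift, basis_spaceShift]
  refine exists_congr fun e => and_congr_right fun _ => ?_
  rw [← mem_shiftWires (D := 0) (N := 0), shiftWires_region, ← mem_shiftWires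
    (D := spaceShift d n) (N := timeShift d n), add_zero, add_zero, add_zero, add_right_comm]

theorem singleTouched_region_add {d : ℤ × ℤ} {n : ℤ} {i : (ℤ × ℤ) × ℤ} {q : Site} {t : ℤ}
    {k : Bool} :
    SingleTouched (region (i + (d, n))) (q + spaceShift d n) (t + timeShift d n) k ↔
      SingleTouched (region i) q t k := by
  unfold SingleTouched
  rw [partner_spaceShift, basis_spaceShift]
  refine and_congr_right fun _ => ?_
  rw [← exists_mem_shiftWires (D := 0) (N := 0), shiftWires_region, ← exists_mem_shiftWires
    (D := spaceShift d n) (N := timeShift d n), add_zero, add_zero]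

/-- The measurement at a space-time point, with its time. -/
def measOf (x : Site × ℤ) : ℤ × Measurement Site := (x.2, measAt x.1 x.2)

/-- The translation of measurements that corresponds to a translation of the colour code. -/
noncomputable def measShift (d : ℤ × ℤ) (n : ℤ) (x : ℤ × Measurement Site) :
    ℤ × Measurement Site :=
  (x.1 + timeShift d n, ⟨turn n x.2.basis, x.2.support.map (addRightEmbedding (spaceShift d n))⟩)

theorem measShift_injective (d : ℤ × ℤ) (n : ℤ) : Function.Injective (measShift d n) := by
  rintro ⟨t, b, s⟩ ⟨t', b', s'⟩ h
  simp only [measShift, Prod.mk.injEq, Measurement.mk.injEq, add_left_inj, turn_inj,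
    Finset.map_inj] at h
  obtain ⟨rfl, rfl, rfl⟩ := h
  rfl

theorem measShift_measOf (d : ℤ × ℤ) (n : ℤ) (q : Site) (t : ℤ) :
    measShift d n (measOf (q, t)) = measOf (q + spaceShift d n, t + timeShift d n) := by
  simp only [measShift, measOf, measAt, Prod.mk.injEq, Measurement.mk.injEq, true_and,
    basis_spaceShift, partner_spaceShift]
  rcases partner q t with _ | e <;> simp [addRightEmbedding, add_right_comm]

/-- Hence all detectors are translates of the one at the origin, possibly with the bases exchanged.
-/
theorem detector_region_add (d : ℤ × ℤ) (n : ℤ) (i : (ℤ × ℤ) × ℤ) :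
    detector (region (i + (d, n))) = measShift d n '' detector (region i) := by
  ext x
  constructor
  · rintro ⟨q, t, rfl, h⟩
    obtain ⟨q, rfl⟩ : ∃ q', q = q' + spaceShift d n := ⟨_, (sub_add_cancel _ _).symm⟩
    obtain ⟨t, rfl⟩ : ∃ t', t = t' + timeShift d n := ⟨_, (sub_add_cancel _ _).symm⟩
    simp only [pairTouched_region_add, singleTouched_region_add] at h
    exact ⟨_, ⟨q, t, rfl, h⟩, measShift_measOf d n q t⟩
  · rintro ⟨_, ⟨q, t, rfl, h⟩, rfl⟩
    refine ⟨_, _, measShift_measOf d n q t, ?_⟩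
    simpa only [pairTouched_region_add, singleTouched_region_add] using h

/-- The sum of the highlightings, in a basic region, of the wires that leave a path of its basis
before a given position. -/
def touchedSum (i : (ℤ × ℤ) × ℤ) (y : CCSpider) (m : ℕ) : ZMod 2 :=
  ((link y).map fun l => if l.1 ≤ m ∧ Touched i l.2.1 then (1 : ZMod 2) else 0).sum

theorem legSum_ccRegion {i : (ℤ × ℤ) × ℤ} {y : CCSpider} {m : ℕ}
    (hy : ccDiagram.colour y = ccBasis i.2) :
    unfusion.legSum (ccRegion i (ccBasis i.2)) y (· ≤ m) = touchedSum i y m := by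
  rw [PathUnfusion.legSum, touchedSum]
  refine congrArg List.sum (List.map_congr_left fun l hl => ?_)
  have h1 := unfusion.adj_of_link hl
  have h2 := ccDiagram_colour_adj h1
  rw [hy] at h2
  rw [ind_comm, ind]
  simp only [mem_ccRegion_of_colour rfl h1.symm h2, ite_and]

theorem val_eq_of_partner {s : FSpider} {d : Site} (h : partner s.1.1 s.1.2.1 = some d) :
    s.1 = (s.1.1, s.1.2.1, false) := by
  have h1 : s.1.2.2 = false := by
    by_contra h2
    rw [s.2 (by simpa using h2)] at h
    cases h
  exact Prod.ext rfl (Prod.ext rfl h1)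

theorem place_eq_of_val {y : CCSpider} {m : ℕ} {q : Site} {t : ℤ} {k : Bool}
    (h : (spider y m).1 = (q, t, k)) : place y m = (q, t) :=
  Prod.ext (show (spider y m).1.1 = q by rw [h]) (show (spider y m).1.2.1 = t by rw [h])

theorem colour_of_partner {s : FSpider} {d : Site} (h : partner s.1.1 s.1.2.1 = some d) :
    fDiagram.colour s = basis s.1.1 s.1.2.1 := by
  simp only [fDiagram, h]

theorem colour_of_partner_none {s : FSpider} (h : partner s.1.1 s.1.2.1 = none) :
    fDiagram.colour s = (basis s.1.1 s.1.2.1).swap := by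
  simp only [fDiagram, h]

/-- Consecutive spiders of a path that share their time are joined by a measurement, not by a
world-line, and the wire carries the partial leg sum. -/
theorem pairTouched_of_touchedSum {i : (ℤ × ℤ) × ℤ} {y : CCSpider} {m : ℕ}
    (hm : m + 1 < pathLen y) (hy : ccDiagram.colour y = ccBasis i.2)
    (ht : (place y (m + 1)).2 = (place y m).2) (hs : touchedSum i y m = 1) :
    PairTouched (region i) (place y m).1 (place y m).2 := by
  have h1 : fDiagram.wires.Adj (spider y m) (spider y (m + 1)) := unfusion.adj_sp_succ hm
  rw [fDiagram_adj] at h1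
  have h2 : (spider y (m + 1)).1.2.1 = (spider y m).1.2.1 := ht
  rcases h1 with ⟨-, h, -⟩ | ⟨-, h, -⟩ | ⟨-, d, hd, hq⟩
  · omega
  · omega
  · have hd' := (partner_spec hd).1
    rw [← hq, ← h2] at hd'
    have h3 := val_eq_of_partner hd'
    rw [h2, hq] at h3
    refine ⟨d, hd, spider y m, spider y (m + 1), val_eq_of_partner hd, h3, ?_⟩
    have h4 : basis (place y m).1 (place y m).2 = ccBasis i.2 := by
      rw [← hy, ← colour_spider (m := m) (by omega), colour_of_partner hd]
      rfl
    rw [h4]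
    refine (unfusion.mem_ext_succ hm).2 ((unfusion.inner_of_colour hy).2 ?_)
    rw [legSum_ccRegion hy, hs]

/-- The two spiders of a weight-two measurement have equal colour, while wires between different
paths change the colour. So the measurement is an inner wire of a path, traversed in one of the two
directions. -/
theorem exists_of_pairTouched {i : (ℤ × ℤ) × ℤ} {q : Site} {t : ℤ}
    (h : PairTouched (region i) q t) : ∃ y m, m + 1 < pathLen y ∧
      ccDiagram.colour y = ccBasis i.2 ∧ (place y (m + 1)).2 = (place y m).2 ∧
      touchedSum i y m = 1 ∧ measOf (q, t) = measOf (place y m) := by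
  obtain ⟨d, hd, s, s', hs, hs', he⟩ := h
  obtain ⟨hd', hb, -⟩ := partner_spec hd
  have hc : fDiagram.colour s = basis q t := by
    have hp : partner s.1.1 s.1.2.1 = some d := by rw [hs]; exact hd
    rw [colour_of_partner hp, hs]
  have hc' : fDiagram.colour s' = basis q t := by
    have hp : partner s'.1.1 s'.1.2.1 = some (-d) := by rw [hs']; exact hd'
    rw [colour_of_partner hp, hs', hb]
  rcases he with ⟨y, l, hl, -, h2⟩ | ⟨y, m, hm, h1, h2⟩
  · exfalso
    have h3 := ccDiagram_colour_adj (unfusion.adj_of_link hl)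
    rw [← colour_spider (link_lt y l hl), ← colour_spider (unfusion.link_lt' hl)] at h3
    rcases Sym2.eq_iff.1 h2 with ⟨rfl, rfl⟩ | ⟨rfl, rfl⟩
    · exact PauliBasis.swap_ne _ ((h3.symm.trans hc').trans hc.symm)
    · exact PauliBasis.swap_ne _ ((h3.symm.trans hc).trans hc'.symm)
  · have hm' : m + 1 < pathLen y := hm
    have hy : ccDiagram.colour y = basis q t ∧ (place y (m + 1)).2 = (place y m).2 ∧
        measOf (q, t) = measOf (place y m) := by
      rcases Sym2.eq_iff.1 h2 with ⟨rfl, rfl⟩ | ⟨rfl, rfl⟩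
      · have e1 : place y m = (q, t) := place_eq_of_val hs
        refine ⟨(colour_spider (by omega)).symm.trans hc, ?_, by rw [e1]⟩
        rw [e1]
        exact congrArg (fun x => x.2.1) hs'
      · have e1 : place y m = (q + d, t) := place_eq_of_val hs'
        refine ⟨(colour_spider (by omega)).symm.trans hc', ?_, ?_⟩
        · rw [e1]
          exact congrArg (fun x => x.2.1) hs
        · rw [e1, measOf, measOf, measAt_add_partner hd]
    have h3 := (unfusion.inner_of_colour hy.1).1 h1
    have hbi : basis q t = ccBasis i.2 := by
      by_contra hne
      rw [ccRegion_eq_empty hne, PathUnfusion.legSum, List.sum_eq_zero] at h3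
      · exact zero_ne_one h3
      · intro x hx
        obtain ⟨l, -, rfl⟩ := List.mem_map.1 hx
        simp [ind]
    have hy' := hy.1.trans hbi
    rw [hbi, legSum_ccRegion hy'] at h3
    exact ⟨y, m, hm', hy', hy.2.1, h3, hy.2.2⟩

theorem touched_of_mem_region {i : (ℤ × ℤ) × ℤ} {b : PauliBasis} {y : CCSpider} {m : ℕ}
    (hm : m < pathLen y) (hy : ccDiagram.colour y = b.swap) {e : Sym2 FSpider}
    (he : e ∈ region i b) (hs : spider y m ∈ e) : Touched i y := by
  have key : ∀ y', ccDiagram.wires.Adj y y' → s(y, y') ∈ ccRegion i b → Touched i y :=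
    fun y' h1 h2 => (mem_ccRegion_of_colour (mem_ccRegion.1 h2).1 h1 hy).1 h2
  rcases he with ⟨y', l, hl, h, rfl⟩ | ⟨y', n, hn, h, rfl⟩
  · have h1 := unfusion.adj_of_link hl
    rcases Sym2.mem_iff.1 hs with h2 | h2
    · obtain ⟨rfl, -⟩ := spider_injective hm (link_lt y' l hl) h2
      exact key _ h1 h
    · obtain ⟨rfl, -⟩ := spider_injective hm (unfusion.link_lt' hl) h2
      exact key _ h1.symm (by rwa [Sym2.eq_swap])
  · have hn' : n + 1 < pathLen y' := hn
    have h1 : y = y' := by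
      rcases Sym2.mem_iff.1 hs with h2 | h2
      · exact (spider_injective hm (by omega) h2).1
      · exact (spider_injective hm hn' h2).1
    subst h1
    rcases h with ⟨h, -⟩ | ⟨-, l, hl, h⟩
    · exact absurd (hy.symm.trans h) b.swap_ne
    · exact key _ (unfusion.adj_of_link hl) h

/-- A one-legged spider has the colour opposite to the measured basis, so it lies on a path where
all wires or none are highlighted in that basis; this happens exactly when the unfused spider is
touched. -/
theorem singleTouched_iff {i : (ℤ × ℤ) × ℤ} {q : Site} {t : ℤ} {k : Bool} :
    SingleTouched (region i) q t k ↔ ∃ y m, m < pathLen y ∧ Touched i y ∧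
      partner (place y m).1 (place y m).2 = none ∧ place y m = (q, t) ∧ placeFlag y m = k := by
  constructor
  · rintro ⟨hp, s, hs, e, he, hse⟩
    obtain ⟨⟨y, m⟩, hm, rfl⟩ := exists_spider s
    dsimp only at hm hs hse
    have e1 : place y m = (q, t) := place_eq_of_val hs
    have hp' : partner (spider y m).1.1 (spider y m).1.2.1 = none := by rw [hs]; exact hp
    refine ⟨y, m, hm, touched_of_mem_region hm ?_ he hse, by rw [e1]; exact hp, e1,
      congrArg (fun x => x.2.2) hs⟩
    rw [← colour_spider hm, colour_of_partner_none hp', hs]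
  · rintro ⟨y, m, hm, ht, hp, hqt, rfl⟩
    obtain rfl : (place y m).1 = q := congrArg Prod.fst hqt
    obtain rfl : (place y m).2 = t := congrArg Prod.snd hqt
    have hy := colour_of_touched ht
    have hb : basis (place y m).1 (place y m).2 = ccBasis i.2 := by
      have h1 : fDiagram.colour (spider y m) = (basis (place y m).1 (place y m).2).swap :=
        colour_of_partner_none hp
      rw [colour_spider hm, hy] at h1
      rw [← PauliBasis.swap_swap (basis _ _), ← h1, PauliBasis.swap_swap]
    refine ⟨hp, spider y m, rfl, ?_⟩
    rw [hb]
    obtain ⟨l, hl⟩ := List.exists_mem_of_ne_nil _ (unfusion.link_ne_nil y)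
    have hin : ∀ n, unfusion.inner (ccBasis i.2) (ccRegion i (ccBasis i.2)) y n := fun n =>
      (unfusion.inner_of_colour_swap (isWeb_ccRegion _ _) hy hl).2
        ((mem_ccRegion_of_colour rfl (unfusion.adj_of_link hl) hy).2 ht)
    have h2 := unfusion.two_le_len y
    have h3 : unfusion.len y = pathLen y := rfl
    by_cases h4 : m + 1 < pathLen y
    · exact ⟨_, (unfusion.mem_ext_succ h4).2 (hin m), Sym2.mem_mk_left _ _⟩
    · obtain ⟨n, rfl⟩ : ∃ n, m = n + 1 := ⟨m - 1, by omega⟩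
      exact ⟨_, (unfusion.mem_ext_succ hm).2 (hin n), Sym2.mem_mk_right _ _⟩

/-- The spiders that are touched by the basic region at the origin. -/
def touchedList : List CCSpider :=
  .inr ((0, 0), 0) :: .inr ((0, 0), 2) :: (hexList (0, 0)).map fun v => .inl (v, 1)

theorem mem_touchedList {y : CCSpider} (h : Touched 0 y) : y ∈ touchedList := by
  rcases y with ⟨v, r⟩ | ⟨p, r⟩
  · obtain ⟨rfl, h⟩ := h
    exact List.mem_cons_of_mem _ (List.mem_cons_of_mem _ (List.mem_map.2 ⟨v, h, rfl⟩))
  · obtain ⟨rfl, rfl | rfl⟩ := h <;> simp [touchedList] <;> rfl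

/-- The wires of weight-two measurements in the detector of the basic region at the origin. -/
def pairSteps : List (CCSpider × ℕ) :=
  [(.inl (((0, 0), false), 2), 0), (.inl (((-1, 0), false), 2), 2), (.inl (((-1, 0), false), 0), 0),
    (.inl (((-1, 0), false), 0), 2), (.inl (((0, -1), false), 0), 0), (.inr ((-1, 1), 1), 2),
    (.inl (((-1, 0), true), 2), 3), (.inr ((0, 1), 1), 0), (.inl (((0, -1), true), 2), 1),
    (.inl (((0, -1), true), 2), 3), (.inr ((1, -1), 1), 0), (.inl (((0, -1), true), 0), 1),
    (.inr ((0, -1), 1), 2), (.inl (((-1, -1), true), 0), 3)]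

/-- The halves of single-qubit measurements in the detector of the basic region at the origin. -/
def singleHalves : List ((Site × ℤ) × Bool) :=
  [(((2, 1), 8), false), (((-1, 0), 8), false), (((1, 0), 5), false), (((-1, 0), 8), true),
    (((1, 0), 5), true), (((-2, -1), 5), true)]

/-- Only the eight touched spiders have to be searched. Of the six halves found, four make up two
complete measurements. -/
theorem singleTouched_zero {q : Site} {t : ℤ} {k : Bool} :
    SingleTouched (region 0) q t k ↔ ((q, t), k) ∈ singleHalves := by
  rw [singleTouched_iff]
  constructor
  · have h : ∀ y ∈ touchedList, ∀ m ∈ List.range 5, m < pathLen y →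
        partner (place y m).1 (place y m).2 = none → (place y m, placeFlag y m) ∈ singleHalves := by decide +kernel
    rintro ⟨y, m, hm, ht, hp, h1, h2⟩
    have := h y (mem_touchedList ht) m
      (List.mem_range.2 (hm.trans_le (by rcases y with _ | _ <;> simp [pathLen]))) hm hp
    rwa [h1, h2] at this
  · have h : ∀ x ∈ singleHalves, ∃ y ∈ touchedList, Touched 0 y ∧ ∃ m < 5, m < pathLen y ∧
        partner (place y m).1 (place y m).2 = none ∧ place y m = x.1 ∧ placeFlag y m = x.2 := by
      decide +kernel
    intro hx
    obtain ⟨y, -, h1, m, -, h2, h3⟩ := h _ hx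
    exact ⟨y, m, h2, h1, h3⟩

instance : DecidableEq (Measurement Site) := fun m m' =>
  decidable_of_iff (m.basis = m'.basis ∧ m.support = m'.support) Measurement.ext_iff.symm

/-- The detector of the basic region at the origin. -/
def detectorFinset : Finset (ℤ × Measurement Site) :=
  ((pairSteps.map fun x => measOf (place x.1 x.2)) ++
    singleHalves.map fun x => measOf x.1).toFinset

set_option synthInstance.maxHeartbeats 200000 in
set_option synthInstance.maxSize 2048 in
theorem detector_region_zero : detector (region 0) = detectorFinset := by
  ext x
  rw [detectorFinset, List.coe_toFinset]
  change _ ↔ x ∈ (pairSteps.map fun x => measOf (place x.1 x.2)) ++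
    singleHalves.map fun x => measOf x.1
  rw [List.mem_append, List.mem_map, List.mem_map]
  constructor
  · rintro ⟨q, t, rfl, h | ⟨k, h⟩⟩
    · left
      obtain ⟨y, m, h1, -, h2, h3, h4⟩ := exists_of_pairTouched h
      -- A nonzero leg sum requires a touched neighbour, so it is enough to search the paths
      -- adjacent to the eight touched spiders.
      have key : ∀ y ∈ touchedList, ∀ l ∈ link y, ∀ m ∈ List.range 4, m + 1 < pathLen l.2.1 →
          (place l.2.1 (m + 1)).2 = (place l.2.1 m).2 → touchedSum 0 l.2.1 m = 1 →
          place l.2.1 m ∈ pairSteps.map fun x => place x.1 x.2 := by decide +kernel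
      obtain ⟨l, hl, hl'⟩ : ∃ l ∈ link y, Touched 0 l.2.1 := by
        by_contra hne
        push Not at hne
        rw [touchedSum, List.sum_eq_zero] at h3
        · exact zero_ne_one h3
        · intro x hx
          obtain ⟨l, hl, rfl⟩ := List.mem_map.1 hx
          exact if_neg fun h => hne l hl h.2
      have hm : m ∈ List.range 4 := by
        rw [List.mem_range]
        rcases y with _ | _ <;> simp only [pathLen] at h1 <;> omega
      obtain ⟨x, hx, hx'⟩ := List.mem_map.1
        (key _ (mem_touchedList hl') _ (link_symm y l hl) m hm h1 h2 h3)
      exact ⟨x, hx, by rw [hx', ← h4]; rfl⟩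
    · exact Or.inr ⟨_, singleTouched_zero.1 h, rfl⟩
  · rintro (⟨⟨y, m⟩, h, rfl⟩ | ⟨⟨⟨q, t⟩, k⟩, h, rfl⟩)
    · have key : ∀ x ∈ pairSteps, x.2 + 1 < pathLen x.1 ∧ ccDiagram.colour x.1 = ccBasis 0 ∧
          (place x.1 (x.2 + 1)).2 = (place x.1 x.2).2 ∧ touchedSum 0 x.1 x.2 = 1 := by
        unfold ccDiagram
        decide +kernel
      obtain ⟨h1, h2, h3, h4⟩ := key _ h
      exact ⟨_, _, rfl, Or.inl (pairTouched_of_touchedSum h1 h2 h3 h4)⟩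
    · exact ⟨q, t, rfl, Or.inr ⟨k, singleTouched_zero.2 h⟩⟩

theorem detector_region (i : (ℤ × ℤ) × ℤ) :
    {x ∈ detector (region i) | x.2.support.card = 2}.ncard = 14 ∧
    {x ∈ detector (region i) | x.2.support.card = 1}.ncard = 4 ∧
    (∃ t₀ : ℤ, Prod.fst '' detector (region i) = Set.Icc t₀ (t₀ + 7)) ∧
    {x : Site × ℤ | SingleTouched (region i) x.1 x.2 false ∧
      SingleTouched (region i) x.1 x.2 true}.ncard = 2 := by
  obtain ⟨d, n⟩ := i
  -- Translations are injective on measurements and keep the weight, so the counts may be made at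
  -- the origin.
  have hcard : ∀ c, {x ∈ detector (region (d, n)) | x.2.support.card = c}.ncard =
      (detectorFinset.filter fun x => x.2.support.card = c).card := by
    intro c
    have h1 := detector_region_add d n 0
    rw [zero_add] at h1
    have h2 : {x ∈ detector (region (d, n)) | x.2.support.card = c} =
        measShift d n '' ((detectorFinset.filter fun x => x.2.support.card = c : Finset _) :
          Set (ℤ × Measurement Site)) := by
      rw [h1, detector_region_zero]
      ext x
      simp only [Set.mem_ofPred_eq, Set.mem_image, Finset.coe_filter, Finset.mem_coe]
      constructor
      · rintro ⟨⟨x, hx, rfl⟩, hc⟩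
        exact ⟨x, ⟨hx, by simpa [measShift] using hc⟩, rfl⟩
      · rintro ⟨x, ⟨hx, hc⟩, rfl⟩
        exact ⟨⟨x, hx, rfl⟩, by simpa [measShift] using hc⟩
    rw [h2, Set.ncard_image_of_injective _ (measShift_injective d n), Set.ncard_coe_finset]
  -- The detector at the origin occupies the timesteps 3 to 10.
  refine ⟨?_, ?_, ⟨3 + timeShift d n, ?_⟩, ?_⟩
  · rw [hcard]
    decide +kernel
  · rw [hcard]
    decide +kernel
  · have h1 := detector_region_add d n 0
    rw [zero_add] at h1
    have h2 : Prod.fst '' (detectorFinset : Set (ℤ × Measurement Site)) = Set.Icc 3 10 := by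
      have : detectorFinset.image Prod.fst = Finset.Icc 3 10 := by decide +kernel
      rw [← Finset.coe_image, this, Finset.coe_Icc]
    rw [h1, detector_region_zero, Set.image_image]
    have h3 : (fun x => (measShift d n x).1) =
        (fun t => t + timeShift d n) ∘ (Prod.fst : ℤ × Measurement Site → ℤ) := rfl
    rw [h3, Set.image_comp, h2, Set.image_add_const_Icc]
    congr 1
    ring
  · have h1 : {x : Site × ℤ | SingleTouched (region (d, n)) x.1 x.2 false ∧
        SingleTouched (region (d, n)) x.1 x.2 true} =
        (fun x => x + (spaceShift d n, timeShift d n)) ''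
          (({((-1, 0), 8), ((1, 0), 5)} : Finset (Site × ℤ)) : Set (Site × ℤ)) := by
      have h2 : ∀ q t k, SingleTouched (region (d, n)) (q + spaceShift d n) (t + timeShift d n) k ↔
          ((q, t), k) ∈ singleHalves := fun q t k => by
        have := singleTouched_region_add (d := d) (n := n) (i := 0) (q := q) (t := t) (k := k)
        rwa [zero_add, singleTouched_zero] at this
      have h3 : ∀ q t, ((q, t), false) ∈ singleHalves ∧ ((q, t), true) ∈ singleHalves ↔
          (q, t) ∈ ({((-1, 0), 8), ((1, 0), 5)} : Finset (Site × ℤ)) := by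
        rintro ⟨a, b⟩ t
        simp only [singleHalves, List.mem_cons, List.not_mem_nil, Prod.mk.injEq, and_true,
          Bool.true_eq_false, Bool.false_eq_true, and_false, or_false, false_or,
          Finset.mem_insert, Finset.mem_singleton]
        omega
      ext x
      constructor
      · intro hx
        obtain ⟨⟨q, t⟩, rfl⟩ : ∃ x', x = x' + (spaceShift d n, timeShift d n) :=
          ⟨_, (sub_add_cancel _ _).symm⟩
        exact ⟨_, (h3 q t).1 ⟨(h2 q t _).1 hx.1, (h2 q t _).1 hx.2⟩, rfl⟩
      · rintro ⟨⟨q, t⟩, hx, rfl⟩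
        have := (h3 q t).2 hx
        exact ⟨(h2 q t _).2 this.1, (h2 q t _).2 this.2⟩
    rw [h1, Set.ncard_image_of_injective _ (add_left_injective _), Set.ncard_coe_finset]
    rfl

theorem zx_bulk : ∃ π : FSpider → CCSpider, IsUnfusion fDiagram ccDiagram π ∧
    (∀ f, (π ⁻¹' {Sum.inr f}).ncard = 4) ∧
    (∀ v, (π ⁻¹' {Sum.inl v}).ncard = 5) ∧
    (∃ d, ∀ s s' : FSpider,
      s'.1 = (s.1.1, s.1.2.1 + 13, s.1.2.2) → π s' = ccShift d 2 (π s)) ∧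
    (∀ i, IsDetectingRegion ccDiagram (ccRegion i)) ∧
    (∀ h, IsDetectingRegion ccDiagram h → ∃ S, IsProductOf ccRegion S h) ∧
    ∃ R : (ℤ × ℤ) × ℤ → PauliBasis → Set (Sym2 FSpider),
      (∀ i, IsDetectingRegion fDiagram (R i) ∧ Extends fDiagram π (R i) (ccRegion i) ∧
        ∀ h, IsPauliWeb fDiagram h → Extends fDiagram π h (ccRegion i) → h = R i) ∧
      (∀ h, IsDetectingRegion fDiagram h → ∃ S, IsProductOf R S h) ∧
      (∀ i j, ∃ (d : Site) (n : ℤ),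
        (∀ b, shiftWires 0 0 (R j b) = shiftWires d n (R i b)) ∨
        (∀ b, shiftWires 0 0 (R j b.swap) = shiftWires d n (R i b))) ∧
      (∀ i,
        {x ∈ detector (R i) | x.2.support.card = 2}.ncard = 14 ∧
        {x ∈ detector (R i) | x.2.support.card = 1}.ncard = 4 ∧
        (∃ t₀ : ℤ, Prod.fst '' detector (R i) = Set.Icc t₀ (t₀ + 7)) ∧
        {x : Site × ℤ | SingleTouched (R i) x.1 x.2 false ∧
          SingleTouched (R i) x.1 x.2 true}.ncard = 2) := by
  -- The translation `(-1, 3)` with two timesteps has spatial image `(3 * (-1) + 3, -1 + 3 - 2) =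
  -- (0, 0)` and temporal image `3 * 3 + 2 * 2 = 13`.
  refine ⟨unfusion.π, unfusion.isUnfusion, fun f => unfusion.ncard_fibre _,
    fun v => unfusion.ncard_fibre _, ⟨(-1, 3), fun s s' h => ?_⟩, isDetectingRegion_ccRegion,
    fun h => exists_isProductOf_ccRegion, region, fun i => ⟨?_, ?_, ?_⟩,
    fun h => exists_isProductOf_region, fun i j => ?_, detector_region⟩
  · refine (unfusion_ccShift (d := (-1, 3)) (n := 2) (h.trans ?_)).1
    ext <;> simp
  · exact unfusion.isDetectingRegion_ext (isDetectingRegion_ccRegion i)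
  · exact unfusion.extends_ext _
  · exact fun h hh he => unfusion.eq_ext_of_extends hh (ccRegion_subset i) he
  · obtain ⟨⟨d, n⟩, rfl⟩ : ∃ x, j = i + x := ⟨j - i, (add_sub_cancel _ _).symm⟩
    refine ⟨spaceShift d n, timeShift d n, ?_⟩
    have h := shiftWires_region d n i
    unfold turn at h
    split_ifs at h
    · exact Or.inl h
    · exact Or.inr h

end FloquetColour

theorem mainTheorem2 :
    -- the qubits sit on a square lattice, measurements have weight one or two, the period is 13
    ((∀ t, ∀ m ∈ bulkRound t,
        (∃ q, m.support = {q}) ∨ ∃ p q, Adjacent p q ∧ m.support = {p, q}) ∧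
      (∀ t q, ∃! m, m ∈ bulkRound t ∧ q ∈ m.support) ∧
      HasPeriod bulkRound 13 ∧
      (∀ t,
        bulkRound (t - 2) = (fun m => (m.map (· + (0, 1))).swap) '' bulkRound t ∧
        bulkRound (t - 8) = (fun m => (m.map (· + (1, 0))).swap) '' bulkRound t ∧
        bulkRound t = (fun m => m.map (· + (3, 1))) '' bulkRound t ∧
        bulkRound t = (fun m => m.map (· + (-2, 8))) '' bulkRound t ∧
        bulkRound (t + 1) = (fun m => m.map (· + (-1, -3))) '' bulkRound t)) ∧
    -- the ZX-diagram of this code is an unfusion of the ZX-diagram of the colour code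
    (∃ π : FSpider → CCSpider, IsUnfusion fDiagram ccDiagram π ∧
      (∀ f, (π ⁻¹' {Sum.inr f}).ncard = 4) ∧
      (∀ v, (π ⁻¹' {Sum.inl v}).ncard = 5) ∧
      (∃ d, ∀ s s' : FSpider,
        s'.1 = (s.1.1, s.1.2.1 + 13, s.1.2.2) → π s' = ccShift d 2 (π s)) ∧
      -- the detectors
      (∀ i, IsDetectingRegion ccDiagram (ccRegion i)) ∧
      (∀ h, IsDetectingRegion ccDiagram h → ∃ S, IsProductOf ccRegion S h) ∧
      ∃ R : (ℤ × ℤ) × ℤ → PauliBasis → Set (Sym2 FSpider),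
        (∀ i, IsDetectingRegion fDiagram (R i) ∧ Extends fDiagram π (R i) (ccRegion i) ∧
          ∀ h, IsPauliWeb fDiagram h → Extends fDiagram π h (ccRegion i) → h = R i) ∧
        (∀ h, IsDetectingRegion fDiagram h → ∃ S, IsProductOf R S h) ∧
        (∀ i j, ∃ (d : Site) (n : ℤ),
          (∀ b, shiftWires 0 0 (R j b) = shiftWires d n (R i b)) ∨
          (∀ b, shiftWires 0 0 (R j b.swap) = shiftWires d n (R i b))) ∧
        (∀ i,
          {x ∈ detector (R i) | x.2.support.card = 2}.ncard = 14 ∧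
          {x ∈ detector (R i) | x.2.support.card = 1}.ncard = 4 ∧
          (∃ t₀ : ℤ, Prod.fst '' detector (R i) = Set.Icc t₀ (t₀ + 7)) ∧
          {x : Site × ℤ | SingleTouched (R i) x.1 x.2 false ∧
            SingleTouched (R i) x.1 x.2 true}.ncard = 2)) ∧
    -- the code on a torus with `a` columns of `b` tiles
    (∀ (a b : ℕ) (c : ℤ), 0 < a → 0 < b →
      Nat.card (Site ⧸ tileLattice a b c) = 26 * a * b ∧
      HasPeriod (torusSchedule (tileLattice a b c)) 13 ∧
      (∀ t, ∀ m ∈ torusRound (tileLattice a b c) t,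
        (∃ q, m.support = {q}) ∨
          ∃ p q : Site, Adjacent p q ∧ (p : Site ⧸ tileLattice a b c) ≠ q ∧
            (m.support : Set (Site ⧸ tileLattice a b c)) = {↑p, ↑q}) ∧
      (3 ∣ a → ∃ T, EncodesFrom (torusSchedule (tileLattice a b c)) T 4) ∧
      (¬ 3 ∣ a → EncodesFrom (torusSchedule (tileLattice a b c)) 12 0)) ∧
    -- the colour code on a three-colourable honeycomb torus
    (∀ Λ : AddSubgroup (ℤ × ℤ), Λ.FiniteIndex → (∀ p ∈ Λ, (3 : ℤ) ∣ p.1 - p.2) →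
      HasPeriod (toricCCSchedule Λ) 2 ∧ EncodesFrom (toricCCSchedule Λ) 1 4) := by
  exact ⟨bulk_schedule, zx_bulk, torus, toricCC⟩
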